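/- **Conventions.** Let $\mathrm{Gr}$ be the category of the real Grassmann algebras $\Lambda_n=\bigwedge\mathbb R^n$, $n\ge 0$, with the parity-preserving unital algebra homomorphisms; $\Lambda=\Lambda_{0}\oplus\Lambda_{1}$ denotes the decomposition of a Grassmann algebra into its even and odd part. For a real super vector space $V=V_0\oplus V_1$ let $\overline V:\mathrm{Gr}\to\mathrm{Sets}$ be the functor $\overline V(\Lambda)=(\Lambda\otimes V)_0=(\Lambda_0\otimes V_0)\oplus(\Lambda_1\otimes V_1)$. Then $\overline{\mathbb R}(\Lambda)=\Lambda_0$ is a ring object, and $\overline V$ is an $\overline{\mathbb R}$-module in $\mathrm{Sets}^{\mathrm{Gr}}$. An $\overline{\mathbb R}$-module in $\mathrm{Sets}^{\mathrm{Gr}}$ is *superrepresentable* if it is isomorphic, as an $\overline{\mathbb R}$-module, to $\overline E$ for some real super vector space $E$ (without topology). A (Banach) *supermanifold* $\mathcal M$ is a functor $\mathrm{Gr}\to\mathrm{Sets}$ with a supersmooth atlas: it is covered by subfunctors that are naturally identified with open subfunctors of $\overline{V}$, $V$ a real Banach super vector space, in such a way that the intersections of charts are open in each chart and that the changes of charts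 are *supersmooth*, i.e. for every $\Lambda$ smooth with $\Lambda_0$-linear derivatives. Morphisms of supermanifolds are the natural transformations that are supersmooth in charts. For a Grassmann algebra $\Lambda$ let $\mathcal P(\Lambda)$ be the superpoint with $\mathcal P(\Lambda)(\Lambda')=\mathrm{Hom}_{\mathrm{Gr}}(\Lambda,\Lambda')$, with its global chart $\mathcal P(\Lambda_n)\cong\overline{\mathbb R^{0|n}}$; a morphism $\varphi:\Lambda\to\Lambda'$ induces $\mathcal P(\varphi):\mathcal P(\Lambda')\to\mathcal P(\Lambda)$. A smooth *super vector bundle* $\pi:\mathcal E\to\mathcal M$ with typical fibre a Banach super vector space $V$ is a functor $\mathcal E$ over $\mathcal M$ that has, over the sets of an open cover of $\mathcal M$ by subfunctors $\mathcal U_i$, trivializations $\mathcal E|_{\mathcal U_i}\cong\mathcal U_i\times\overline V$ with changes that are supersmooth and $\overline{\mathbb R}$-linear in the fibres. Its sections are the supersmooth $\sigma:\mathcal M\to\mathcal E$ with $\pi\circ\sigma=\mathrm{id}$; they form a real vector space $\Gamma(\mathcal M,\mathcal E)$ with the pointwise operations. The bundle $\Pi\mathcal E$ is the super vector bundle over $\mathcal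 M$ with typical fibre $\Pi V$ (reversed parity) that has trivializations over the same $\mathcal U_i$ and whose changes of trivialization $g'_{ij}$ are determined by those of $\mathcal E$ through $c\,g'_{ij}(x,w)=g_{ij}(x,c\,w)$ for all $\Lambda$, odd $c\in\Lambda_1$ and $w\in\overline{\Pi V}(\Lambda)$. **Theorem.** Let $\pi:\mathcal E\to\mathcal M$ be a smooth super vector bundle. Let $\widehat\Gamma(\mathcal M,\mathcal E):\mathrm{Gr}\to\mathrm{Sets}$ be the functor $$\widehat\Gamma(\mathcal M,\mathcal E)(\Lambda)=\Gamma\bigl(\mathcal P(\Lambda)\times\mathcal M,\ \mathrm{pr}_{\mathcal M}^*\mathcal E\bigr),\qquad \widehat\Gamma(\mathcal M,\mathcal E)(\varphi)(\sigma)=\sigma\circ(\mathcal P(\varphi)\times\mathrm{id}_{\mathcal M}),$$ where sections of $\mathrm{pr}_{\mathcal M}^*\mathcal E$ are regarded as morphisms $\mathcal P(\Lambda)\times\mathcal M\to\mathcal E$ over $\mathcal M$. With the pointwise operations $$(\sigma+\tau)(p,m)=\sigma(p,m)+\tau(p,m),\qquad (\lambda\sigma)(p,m)=p(\lambda)\,\sigma(p,m)$$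 for $\lambda\in\Lambda_0$, $p\in\mathcal P(\Lambda)(\Lambda')$ and $m\in\mathcal M(\Lambda')$, this functor is an $\overline{\mathbb R}$-module, and it is superrepresentable. More precisely, the bundle $\Pi\mathcal E$ exists, and as $\overline{\mathbb R}$-modules $$\widehat\Gamma(\mathcal M,\mathcal E)\cong\overline E,\qquad E=E_0\oplus E_1,\quad E_0=\Gamma(\mathcal M,\mathcal E),\quad E_1=\Gamma(\mathcal M,\Pi\mathcal E).$$ -/

import Mathlib

open CategoryTheory TensorProduct
open scoped ContDiff

universe u v w

namespace SuperGeom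

noncomputable section

/-- The object `Λ_rank` of the category `Gr` of real Grassmann algebras. -/
structure Gr where
  rank : ℕ

namespace Gr

/-- The real Grassmann algebra on `rank` odd generators. -/
abbrev Alg (A : Gr) : Type := ExteriorAlgebra ℝ (Fin A.rank → ℝ)

/-- The even (`i = 0`) and odd (`i = 1`) part of the Grassmann algebra. -/
abbrev part (A : Gr) (i : ZMod 2) : Submodule ℝ A.Alg :=
  CliffordAlgebra.evenOdd (0 : QuadraticForm ℝ (Fin A.rank → ℝ)) i

/-- The even subalgebra of the Grassmann algebra. -/
abbrev Even (A : Gr) : Subalgebra ℝ A.Alg :=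
  CliffordAlgebra.even (0 : QuadraticForm ℝ (Fin A.rank → ℝ))

/-- The `i`-th odd generator. -/
def gen (A : Gr) (i : Fin A.rank) : A.part 1 :=
  ⟨ExteriorAlgebra.ι ℝ (Pi.single i 1), CliffordAlgebra.ι_mem_evenOdd_one _ _⟩

/-- A morphism of Grassmann algebras: a unital algebra homomorphism preserving parity. -/
@[ext]
structure Hom (A B : Gr) where
  alg : A.Alg →ₐ[ℝ] B.Alg
  parity : ∀ i, ∀ x ∈ A.part i, alg x ∈ B.part i

instance : Category Gr where
  Hom := Hom
  id A := ⟨AlgHom.id ℝ _, fun _ _ h => h⟩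
  comp f g := ⟨g.alg.comp f.alg, fun i x h => g.parity i _ (f.parity i x h)⟩

variable {A B C : Gr}

/-- The restriction of a morphism to the part of parity `i`. -/
def Hom.res (φ : A ⟶ B) (i : ZMod 2) : A.part i →ₗ[ℝ] B.part i :=
  φ.alg.toLinearMap.restrict (φ.parity i)

/-- The restriction of a morphism to the even subalgebras. -/
def Hom.resEven (φ : A ⟶ B) (a : A.Even) : B.Even := ⟨φ.alg a, φ.parity 0 _ a.2⟩

@[simp] lemma Hom.res_id (i : ZMod 2) : Hom.res (𝟙 A) i = LinearMap.id := rfl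

@[simp] lemma Hom.res_comp (φ : A ⟶ B) (ψ : B ⟶ C) (i : ZMod 2) :
    Hom.res (φ ≫ ψ) i = (Hom.res ψ i).comp (Hom.res φ i) := rfl

/-- Multiplication of homogeneous elements. -/
def mulPart (i j k : ZMod 2) (h : i + j = k) (a : A.part i) : A.part j →ₗ[ℝ] A.part k :=
  (LinearMap.mulLeft ℝ (a : A.Alg)).restrict fun _ hx =>
    h ▸ CliffordAlgebra.evenOdd_mul_le _ _ _ (Submodule.mul_mem_mul a.2 hx)

/-- Each homogeneous part is a module over the even subalgebra, by multiplication. -/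
instance (i : ZMod 2) : SMul A.Even (A.part i) where
  smul a x := mulPart 0 i i (zero_add i) ⟨a, a.2⟩ x

lemma coe_smul_part (i : ZMod 2) (a : A.Even) (x : A.part i) :
    ((a • x : A.part i) : A.Alg) = a * x := rfl

instance (i : ZMod 2) : Module A.Even (A.part i) where
  one_smul x := Subtype.ext (by simp [coe_smul_part])
  mul_smul a b x := Subtype.ext (by simp [coe_smul_part, mul_assoc])
  smul_zero a := Subtype.ext (by simp [coe_smul_part])
  zero_smul x := Subtype.ext (by simp [coe_smul_part])
  smul_add a x y := Subtype.ext (by simp [coe_smul_part, mul_add])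
  add_smul a b x := Subtype.ext (by simp [coe_smul_part, add_mul])

instance (i : ZMod 2) : SMulCommClass ℝ A.Even (A.part i) where
  smul_comm r a x := Subtype.ext (by simp [coe_smul_part])

instance : Module.Finite ℝ A.Alg :=
  Module.Finite.of_basis (Pi.basisFun ℝ (Fin A.rank)).ExteriorAlgebra

instance (i : ZMod 2) : Module.Finite ℝ (A.part i) :=
  FiniteDimensional.finiteDimensional_submodule _

end Gr

/-- `Λ_i ⊗ V`, where `Λ_i` is a homogeneous part of a Grassmann algebra. -/
def GTensor (A : Gr) (i : ZMod 2) (V : Type u) [AddCommGroup V] [Module ℝ V] : Type u :=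
  A.part i ⊗[ℝ] V

namespace GTensor

section Algebraic

variable (A : Gr) {B C : Gr} (i : ZMod 2) (V : Type u) [AddCommGroup V] [Module ℝ V]

instance : AddCommGroup (GTensor A i V) := inferInstanceAs (AddCommGroup (A.part i ⊗[ℝ] V))
instance : Module ℝ (GTensor A i V) := inferInstanceAs (Module ℝ (A.part i ⊗[ℝ] V))
instance : Module A.Even (GTensor A i V) := inferInstanceAs (Module A.Even (A.part i ⊗[ℝ] V))

variable {A V}

/-- The tensor product `L ⊗ T` of two linear maps. -/
def lmap {i j : ZMod 2} {W : Type*} [AddCommGroup W] [Module ℝ W] (L : A.part i →ₗ[ℝ] B.part j)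
    (T : V →ₗ[ℝ] W) : GTensor A i V →ₗ[ℝ] GTensor B j W :=
  TensorProduct.map L T

/-- The map `φ ⊗ id` induced by a morphism `φ` of Grassmann algebras. -/
def map (φ : A ⟶ B) : GTensor A i V →ₗ[ℝ] GTensor B i V :=
  lmap (Gr.Hom.res φ i) LinearMap.id

/-- The pure tensor `p ⊗ v`. -/
def tmul (p : A.part i) : V →ₗ[ℝ] GTensor A i V := TensorProduct.mk ℝ (A.part i) V p

variable {i}

@[elab_as_elim]
lemma induction {P : GTensor A i V → Prop} (h0 : P 0) (ht : ∀ p v, P (tmul i p v))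
    (ha : ∀ x y, P x → P y → P (x + y)) (x : GTensor A i V) : P x :=
  TensorProduct.induction_on (motive := P) x h0 ht ha

lemma smul_tmul (a : A.Even) (p : A.part i) (v : V) : a • tmul i p v = tmul i (a • p) v := rfl

lemma map_tmul (φ : A ⟶ B) (p : A.part i) (v : V) :
    map i φ (tmul i p v) = tmul i (Gr.Hom.res φ i p) v := rfl

lemma lmap_tmul {j : ZMod 2} {W : Type*} [AddCommGroup W] [Module ℝ W]
    (L : A.part i →ₗ[ℝ] B.part j) (T : V →ₗ[ℝ] W) (p : A.part i) (v : V) :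
    lmap L T (tmul i p v) = tmul j (L p) (T v) := rfl

lemma lmap_lmap {W X : Type*} [AddCommGroup W] [Module ℝ W] [AddCommGroup X] [Module ℝ X]
    {j k : ZMod 2} (L : A.part i →ₗ[ℝ] B.part j) (K : B.part j →ₗ[ℝ] C.part k) (T : V →ₗ[ℝ] W)
    (S : W →ₗ[ℝ] X) (x : GTensor A i V) :
    lmap K S (lmap L T x) = lmap (K.comp L) (S.comp T) x := by
  induction x using GTensor.induction with
  | h0 => simp
  | ht p v => rfl
  | ha x y hx hy => simp only [map_add, hx, hy]

lemma lmap_smul {W : Type*} [AddCommGroup W] [Module ℝ W] (T : V →ₗ[ℝ] W) (a : A.Even)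
    (x : GTensor A i V) : lmap LinearMap.id T (a • x) = a • lmap LinearMap.id T x := by
  induction x using GTensor.induction with
  | h0 => simp
  | ht p v => rfl
  | ha x y hx hy => simp only [smul_add, map_add, hx, hy]

lemma lmap_id (x : GTensor A i V) : lmap LinearMap.id LinearMap.id x = x := by
  induction x using GTensor.induction with
  | h0 => simp
  | ht p v => rfl
  | ha x y hx hy => simp only [map_add, hx, hy]

lemma lmap_zero {j : ZMod 2} {W : Type*} [AddCommGroup W] [Module ℝ W]
    (L : A.part i →ₗ[ℝ] B.part j) (x : GTensor A i V) : lmap L (0 : V →ₗ[ℝ] W) x = 0 := by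
  induction x using GTensor.induction with
  | h0 => simp
  | ht p v => simp [lmap_tmul]
  | ha x y hx hy => simp only [map_add, hx, hy, add_zero]

lemma lmap_add {j : ZMod 2} {W : Type*} [AddCommGroup W] [Module ℝ W]
    (L : A.part i →ₗ[ℝ] B.part j) (S T : V →ₗ[ℝ] W) (x : GTensor A i V) :
    lmap L S x + lmap L T x = lmap L (S + T) x := by
  induction x using GTensor.induction with
  | h0 => simp
  | ht p v => simp [lmap_tmul]
  | ha x y hx hy => simp only [map_add, ← hx, ← hy]; abel

variable (i)

lemma map_id (x : GTensor A i V) : map i (𝟙 A) x = x := by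
  induction x using GTensor.induction with
  | h0 => simp
  | ht p v => rfl
  | ha x y hx hy => rw [map_add, hx, hy]

lemma map_comp (φ : A ⟶ B) (ψ : B ⟶ C) (x : GTensor A i V) :
    map i (φ ≫ ψ) x = map i ψ (map i φ x) := by
  induction x using GTensor.induction with
  | h0 => simp
  | ht p v => rfl
  | ha x y hx hy => simp only [map_add, hx, hy]

lemma map_smul_even (φ : A ⟶ B) (a : A.Even) (x : GTensor A i V) :
    map i φ (a • x) = Gr.Hom.resEven φ a • map i φ x := by
  induction x using GTensor.induction with
  | h0 => simp
  | ht p v =>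
    rw [smul_tmul, map_tmul, map_tmul, smul_tmul]
    congr 2
    exact Subtype.ext (map_mul φ.alg (a : A.Alg) (p : A.Alg))
  | ha x y hx hy => simp only [smul_add, map_add, hx, hy]

/-- Left multiplication by a homogeneous element of the Grassmann algebra. -/
def mulLeft (i j k : ZMod 2) (h : i + j = k) (a : A.part i) : GTensor A j V →ₗ[ℝ] GTensor A k V :=
  lmap (Gr.mulPart i j k h a) LinearMap.id

/-- Coordinates of `Λ_i ⊗ V` with respect to a basis of `Λ_i`. -/
def coord : GTensor A i V ≃ₗ[ℝ] (Fin (Module.finrank ℝ (A.part i)) → V) :=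
  (TensorProduct.equivFinsuppOfBasisLeft (Module.finBasis ℝ (A.part i))).trans
    (Finsupp.linearEquivFunOnFinite ℝ V _)

end Algebraic

section Normed

variable (A : Gr) (i : ZMod 2) (V : Type u) [NormedAddCommGroup V] [NormedSpace ℝ V]

/-- For a normed space `V`, the space `Λ_i ⊗ V` is normed by means of coordinates (all choices of
a basis of the finite-dimensional space `Λ_i` give equivalent norms). -/
instance : NormedAddCommGroup (GTensor A i V) :=
  NormedAddCommGroup.induced _ _ (coord i (A := A) (V := V)) (coord i).injective

instance : NormedSpace ℝ (GTensor A i V) :=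
  NormedSpace.induced ℝ _ _ (coord i (A := A) (V := V))


variable {A i V} {B : Gr} {j : ZMod 2} {W : Type*} [NormedAddCommGroup W] [NormedSpace ℝ W]

lemma isometry_coord : Isometry (coord i (A := A) (V := V)) :=
  AddMonoidHomClass.isometry_of_norm _ fun _ => rfl

lemma coord_tmul (p : A.part i) (v : V) (k) :
    coord i (tmul i p v) k = (Module.finBasis ℝ (A.part i)).repr p k • v :=
  TensorProduct.equivFinsuppOfBasisLeft_apply_tmul_apply _ _ _ _

lemma continuous_tmul (p : A.part i) : Continuous (tmul i p : V → GTensor A i V) := by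
  rw [isometry_coord.isEmbedding.continuous_iff]
  refine continuous_pi fun k => ?_
  simp only [Function.comp_apply, coord_tmul]
  fun_prop

lemma eq_sum_tmul (x : GTensor A i V) :
    x = ∑ k, tmul i (Module.finBasis ℝ (A.part i) k) (coord i x k) := by
  apply (coord i).injective
  ext k
  simp [map_sum, coord_tmul, Finsupp.single_apply]

lemma continuous_lmap (L : A.part i →ₗ[ℝ] B.part j) (T : V →L[ℝ] W) :
    Continuous (lmap L (T : V →ₗ[ℝ] W)) := by
  have h : ∀ x : GTensor A i V, lmap L (T : V →ₗ[ℝ] W) x =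
      ∑ k, tmul j (L (Module.finBasis ℝ (A.part i) k)) (T (coord i x k)) := by
    intro x
    conv_lhs => rw [eq_sum_tmul x, map_sum]
    rfl
  rw [funext h]
  refine continuous_finsetSum _ fun k _ => (continuous_tmul _).comp (T.continuous.comp ?_)
  exact (continuous_apply k).comp isometry_coord.continuous

end Normed

end GTensor

/-! ### Super vector spaces and their functors of points -/

/-- The set `(Λ ⊗ V)_0 = (Λ_0 ⊗ V_0) ⊕ (Λ_1 ⊗ V_1)` of `Λ`-points of the super vector space
`V = V₀ ⊕ V₁`, a module over the even part of `Λ`. -/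
abbrev Bar (A : Gr) (V₀ V₁ : Type u) [AddCommGroup V₀] [Module ℝ V₀] [AddCommGroup V₁]
    [Module ℝ V₁] : Type u :=
  GTensor A 0 V₀ × GTensor A 1 V₁

namespace Bar

variable {A B C : Gr} {V₀ V₁ : Type u} [AddCommGroup V₀] [Module ℝ V₀] [AddCommGroup V₁]
    [Module ℝ V₁]

/-- The map `(φ ⊗ id)` on points. -/
def map (φ : A ⟶ B) : Bar A V₀ V₁ →ₗ[ℝ] Bar B V₀ V₁ :=
  (GTensor.map 0 φ).prodMap (GTensor.map 1 φ)

lemma map_id (x : Bar A V₀ V₁) : map (𝟙 A) x = x :=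
  Prod.ext (GTensor.map_id 0 x.1) (GTensor.map_id 1 x.2)

lemma map_comp (φ : A ⟶ B) (ψ : B ⟶ C) (x : Bar A V₀ V₁) : map (φ ≫ ψ) x = map ψ (map φ x) :=
  Prod.ext (GTensor.map_comp 0 φ ψ x.1) (GTensor.map_comp 1 φ ψ x.2)

lemma map_smul_even (φ : A ⟶ B) (a : A.Even) (x : Bar A V₀ V₁) :
    map φ (a • x) = Gr.Hom.resEven φ a • map φ x :=
  Prod.ext (GTensor.map_smul_even 0 φ a x.1) (GTensor.map_smul_even 1 φ a x.2)

/-- Multiplication by an odd element of `Λ`, as a map `(Λ ⊗ ΠV)_0 → (Λ ⊗ V)_0`, where `ΠV` is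
`V` with reversed parity. -/
def oddMul (a : A.part 1) : Bar A V₁ V₀ →ₗ[ℝ] Bar A V₀ V₁ :=
  ((GTensor.mulLeft 1 1 0 (by decide) a).comp (LinearMap.snd ℝ _ _)).prod
    ((GTensor.mulLeft 1 0 1 (by decide) a).comp (LinearMap.fst ℝ _ _))

end Bar

/-- A real Banach super vector space `V = even ⊕ odd`. -/
structure SBanach : Type (u + 1) where
  even : Type u
  odd : Type u
  [normedEven : NormedAddCommGroup even]
  [spaceEven : NormedSpace ℝ even]
  [completeEven : CompleteSpace even]
  [normedOdd : NormedAddCommGroup odd]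
  [spaceOdd : NormedSpace ℝ odd]
  [completeOdd : CompleteSpace odd]

namespace SBanach

attribute [instance] normedEven spaceEven completeEven normedOdd spaceOdd completeOdd

/-- The direct sum of super vector spaces. -/
abbrev prod (V : SBanach.{u}) (W : SBanach.{v}) : SBanach.{max u v} :=
  ⟨V.even × W.even, V.odd × W.odd⟩

/-- The change of parity. -/
abbrev flip (V : SBanach.{u}) : SBanach.{u} := ⟨V.odd, V.even⟩

/-- The purely odd super vector space `ℝ^{0|k}`. -/
abbrev oddSpace (k : ℕ) : SBanach.{0} := ⟨PUnit, Fin k → ℝ⟩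

end SBanach

/-- The `Λ`-points of a Banach super vector space. -/
abbrev Pt (A : Gr) (V : SBanach.{u}) : Type u := Bar A V.even V.odd

namespace GTensor

section Prod

variable (A : Gr) (i : ZMod 2) (V : Type u) (W : Type v) [NormedAddCommGroup V] [NormedSpace ℝ V]
  [NormedAddCommGroup W] [NormedSpace ℝ W]

/-- `Λ_i ⊗ (V ⊕ W) = (Λ_i ⊗ V) ⊕ (Λ_i ⊗ W)`. -/
def prodEquiv : (GTensor A i V × GTensor A i W) ≃L[ℝ] GTensor A i (V × W) where
  toFun p := lmap LinearMap.id (ContinuousLinearMap.inl ℝ V W : V →ₗ[ℝ] V × W) p.1 +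
      lmap LinearMap.id (ContinuousLinearMap.inr ℝ V W : W →ₗ[ℝ] V × W) p.2
  invFun q := (lmap LinearMap.id (ContinuousLinearMap.fst ℝ V W : V × W →ₗ[ℝ] V) q,
      lmap LinearMap.id (ContinuousLinearMap.snd ℝ V W : V × W →ₗ[ℝ] W) q)
  map_add' p q := by simp only [Prod.fst_add, Prod.snd_add, map_add]; abel
  map_smul' r p := by simp
  left_inv p := by
    ext
    · simp only [map_add, lmap_lmap]
      exact (congrArg₂ (· + ·) (lmap_id p.1) (lmap_zero LinearMap.id p.2)).trans (add_zero _)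
    · simp only [map_add, lmap_lmap]
      exact (congrArg₂ (· + ·) (lmap_zero LinearMap.id p.1) (lmap_id p.2)).trans (zero_add _)
  right_inv q := by
    simp only [lmap_lmap, lmap_add]
    refine Eq.trans ?_ (lmap_id q)
    congr 2
    ext <;> simp
  continuous_toFun := ((continuous_lmap _ _).comp continuous_fst).add
    ((continuous_lmap _ _).comp continuous_snd)
  continuous_invFun := (continuous_lmap _ _).prodMk (continuous_lmap _ _)

end Prod

end GTensor

/-- The `Λ`-points of a direct sum. -/
def join (A : Gr) (V : SBanach.{u}) (W : SBanach.{v}) :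
    (Pt A V × Pt A W) ≃L[ℝ] Pt A (V.prod W) :=
  (ContinuousLinearEquiv.prodProdProdComm ℝ _ _ _ _).trans
    ((GTensor.prodEquiv A 0 V.even W.even).prodCongr (GTensor.prodEquiv A 1 V.odd W.odd))

lemma join_smul (A : Gr) (V : SBanach.{u}) (W : SBanach.{v}) (a : A.Even) (p : Pt A V × Pt A W) :
    join A V W (a • p) = a • join A V W p := by
  ext <;> simp [join, GTensor.prodEquiv, GTensor.lmap_smul]

lemma join_map {A B : Gr} (φ : A ⟶ B) (V : SBanach.{u}) (W : SBanach.{v})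
    (p : Pt A V × Pt A W) :
    join B V W (Bar.map φ p.1, Bar.map φ p.2) = Bar.map φ (join A V W p) := by
  ext <;> simp [join, GTensor.prodEquiv, Bar.map, GTensor.map, GTensor.lmap_lmap]

/-! ### Supersmooth maps and supermanifolds -/

section SuperSmooth

variable (A : Gr) {X Y Z : Type*}
  [NormedAddCommGroup X] [NormedSpace ℝ X] [Module A.Even X]
  [NormedAddCommGroup Y] [NormedSpace ℝ Y] [Module A.Even Y]
  [NormedAddCommGroup Z] [NormedSpace ℝ Z] [Module A.Even Z]

/-- On the open set `D`, the map `g` is smooth and its derivatives are linear over the even part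
of the Grassmann algebra. -/
def SuperSmoothOn (g : X → Y) (D : Set X) : Prop :=
  ContDiffOn ℝ ∞ g D ∧ ∀ x ∈ D, ∀ (a : A.Even) (v : X), fderiv ℝ g x (a • v) = a • fderiv ℝ g x v

variable {A}

lemma SuperSmoothOn.differentiableAt {g : X → Y} {D : Set X} (h : SuperSmoothOn A g D)
    (hD : IsOpen D) {x : X} (hx : x ∈ D) : DifferentiableAt ℝ g x :=
  ((h.1 x hx).contDiffAt (hD.mem_nhds hx)).differentiableAt (by simp)

lemma SuperSmoothOn.mono {g : X → Y} {D D' : Set X} (h : SuperSmoothOn A g D) (hs : D' ⊆ D) :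
    SuperSmoothOn A g D' :=
  ⟨h.1.mono hs, fun x hx => h.2 x (hs hx)⟩

/-- Supersmoothness is local. -/
lemma SuperSmoothOn.of_local {g : X → Y} {D : Set X}
    (H : ∀ x ∈ D, ∃ D' g', IsOpen D' ∧ x ∈ D' ∧ SuperSmoothOn A g' D' ∧ Set.EqOn g g' D') :
    SuperSmoothOn A g D := by
  refine ⟨fun x hx => ?_, fun x hx a v => ?_⟩
  · obtain ⟨D', g', ho, hxD, hg, he⟩ := H x hx
    have h1 : ContDiffAt ℝ ∞ g' x := (hg.1 x hxD).contDiffAt (ho.mem_nhds hxD)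
    exact (h1.congr_of_eventuallyEq (he.eventuallyEq_of_mem (ho.mem_nhds hxD))).contDiffWithinAt
  · obtain ⟨D', g', ho, hxD, hg, he⟩ := H x hx
    rw [(he.eventuallyEq_of_mem (ho.mem_nhds hxD)).fderiv_eq]
    exact hg.2 x hxD a v

lemma SuperSmoothOn.comp {g : X → Y} {h : Y → Z} {D : Set X} {D' : Set Y}
    (hh : SuperSmoothOn A h D') (hg : SuperSmoothOn A g D) (ho : IsOpen D) (ho' : IsOpen D')
    (hm : Set.MapsTo g D D') : SuperSmoothOn A (h ∘ g) D := by
  refine ⟨hh.1.comp hg.1 hm, fun x hx a v => ?_⟩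
  rw [fderiv_comp x (hh.differentiableAt ho' (hm hx)) (hg.differentiableAt ho hx)]
  simp [hg.2 x hx, hh.2 _ (hm hx)]

lemma SuperSmoothOn.prodMk {g : X → Y} {h : X → Z} {D : Set X}
    (hg : SuperSmoothOn A g D) (hh : SuperSmoothOn A h D) (ho : IsOpen D) :
    SuperSmoothOn A (fun x => (g x, h x)) D := by
  refine ⟨hg.1.prodMk hh.1, fun x hx a v => ?_⟩
  rw [(hg.differentiableAt ho hx).fderiv_prodMk (hh.differentiableAt ho hx)]
  simp [hg.2 x hx, hh.2 x hx]

lemma SuperSmoothOn.of_linear (L : X →L[ℝ] Y) (hL : ∀ (a : A.Even) v, L (a • v) = a • L v)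
    (D : Set X) : SuperSmoothOn A L D :=
  ⟨L.contDiff.contDiffOn, fun x _ a v => by simp [hL]⟩

end SuperSmooth

/-- A Banach supermanifold: a functor `pts` on the category of Grassmann algebras with a
supersmooth atlas.  The `i`-th chart identifies, naturally in the Grassmann algebra, the subfunctor
`source i` of `pts` with an open subfunctor of the functor of points of the Banach super vector
space `model i`; the charts cover, the intersection of two charts is open in each of them, and the
changes of charts are supersmooth. The manifold structure of each set `pts.obj A` is the one given
by the charts. -/
structure SuperManifold : Type (u + 1) where
  pts : Gr ⥤ Type u
  ι : Type u
  model : ι → SBanach.{u}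
  source : ι → ∀ A : Gr, Set (pts.obj A)
  coord : ∀ (i : ι) (A : Gr), pts.obj A → Pt A (model i)
  injOn : ∀ i A, Set.InjOn (coord i A) (source i A)
  source_map : ∀ i {A B : Gr} (φ : A ⟶ B), ∀ x ∈ source i A, pts.map φ x ∈ source i B
  coord_map : ∀ i {A B : Gr} (φ : A ⟶ B), ∀ x ∈ source i A,
    coord i B (pts.map φ x) = Bar.map φ (coord i A x)
  cover : ∀ A x, ∃ i, x ∈ source i A
  isOpen_overlap : ∀ i j A, IsOpen (coord i A '' (source i A ∩ source j A))
  transition : ∀ i j A, ∃ g : Pt A (model i) → Pt A (model j),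
    SuperSmoothOn A g (coord i A '' (source i A ∩ source j A)) ∧
    ∀ x ∈ source i A ∩ source j A, g (coord i A x) = coord j A x

namespace SuperManifold

variable (X : SuperManifold.{u}) {A : Gr} {Y Z : Type*}
  [NormedAddCommGroup Y] [NormedSpace ℝ Y] [Module A.Even Y]
  [NormedAddCommGroup Z] [NormedSpace ℝ Z] [Module A.Even Z]

/-- `S` is open in the manifold of `A`-points of `X`. -/
def IsOpenSet (S : Set (X.pts.obj A)) : Prop :=
  ∀ i, IsOpen (X.coord i A '' (X.source i A ∩ S))

/-- `S` is open, and `f` is supersmooth on `S`, when expressed in the charts of `X`. -/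
def SmoothOn (f : X.pts.obj A → Y) (S : Set (X.pts.obj A)) : Prop :=
  X.IsOpenSet S ∧ ∀ i, ∃ g : Pt A (X.model i) → Y,
    SuperSmoothOn A g (X.coord i A '' (X.source i A ∩ S)) ∧
    ∀ x ∈ X.source i A ∩ S, g (X.coord i A x) = f x

variable {X}

lemma isOpenSet_source (j : X.ι) : X.IsOpenSet (X.source j A) := fun i => X.isOpen_overlap i j A

lemma smoothOn_coord (j : X.ι) : X.SmoothOn (X.coord j A) (X.source j A) :=
  ⟨isOpenSet_source j, fun i => X.transition i j A⟩

lemma image_inter (i : X.ι) (S T : Set (X.pts.obj A)) :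
    X.coord i A '' (X.source i A ∩ (S ∩ T)) =
      X.coord i A '' (X.source i A ∩ S) ∩ X.coord i A '' (X.source i A ∩ T) := by
  rw [Set.inter_inter_distrib_left]
  exact (X.injOn i A).image_inter Set.inter_subset_left Set.inter_subset_left

lemma IsOpenSet.inter {S T : Set (X.pts.obj A)} (hS : X.IsOpenSet S) (hT : X.IsOpenSet T) :
    X.IsOpenSet (S ∩ T) := fun i => by
  rw [image_inter]; exact (hS i).inter (hT i)

lemma isOpenSet_univ : X.IsOpenSet (Set.univ : Set (X.pts.obj A)) := fun i => by
  simpa using X.isOpen_overlap i i A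

lemma SmoothOn.mono {f : X.pts.obj A → Y} {S T : Set (X.pts.obj A)} (h : X.SmoothOn f S)
    (hT : X.IsOpenSet T) (hs : T ⊆ S) : X.SmoothOn f T := by
  refine ⟨hT, fun i => ?_⟩
  obtain ⟨g, hg, hf⟩ := h.2 i
  exact ⟨g, hg.mono (Set.image_mono (Set.inter_subset_inter_right _ hs)),
    fun x hx => hf x ⟨hx.1, hs hx.2⟩⟩

/-- A function is supersmooth if it is so near each point, in one chart. -/
lemma SmoothOn.of_local {f : X.pts.obj A → Y} {S : Set (X.pts.obj A)}
    (H : ∀ x ∈ S, ∃ i, x ∈ X.source i A ∧ ∃ (D : Set (Pt A (X.model i))) (g : _ → Y),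
      IsOpen D ∧ X.coord i A x ∈ D ∧ D ⊆ X.coord i A '' (X.source i A ∩ S) ∧
      SuperSmoothOn A g D ∧ ∀ y ∈ X.source i A, X.coord i A y ∈ D → g (X.coord i A y) = f y) :
    X.SmoothOn f S := by
  classical
  -- the same statement in all charts
  have H' : ∀ i, ∀ x ∈ X.source i A ∩ S, ∃ (D : Set (Pt A (X.model i))) (g : _ → Y),
      IsOpen D ∧ X.coord i A x ∈ D ∧ D ⊆ X.coord i A '' (X.source i A ∩ S) ∧
      SuperSmoothOn A g D ∧ ∀ y ∈ X.source i A, X.coord i A y ∈ D → g (X.coord i A y) = f y := by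
    rintro j x ⟨hxj, hxS⟩
    obtain ⟨i, hxi, D, g, hD, hxD, hDS, hg, hf⟩ := H x hxS
    obtain ⟨t, ht, htc⟩ := X.transition j i A
    have ho := X.isOpen_overlap j i A
    have hopen : IsOpen (X.coord j A '' (X.source j A ∩ X.source i A) ∩ t ⁻¹' D) :=
      ht.1.continuousOn.isOpen_inter_preimage ho hD
    refine ⟨X.coord j A '' (X.source j A ∩ X.source i A) ∩ t ⁻¹' D, g ∘ t, hopen, ?_, ?_, ?_, ?_⟩
    · exact ⟨⟨x, ⟨hxj, hxi⟩, rfl⟩, by simpa [htc x ⟨hxj, hxi⟩] using hxD⟩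
    · rintro _ ⟨⟨y, ⟨hyj, hyi⟩, rfl⟩, hy⟩
      rw [Set.mem_preimage, htc y ⟨hyj, hyi⟩] at hy
      obtain ⟨z, ⟨hzi, hzS⟩, hz⟩ := hDS hy
      have := X.injOn i A hzi hyi hz
      subst this
      exact ⟨z, ⟨hyj, hzS⟩, rfl⟩
    · exact hg.comp (ht.mono Set.inter_subset_left) hopen hD fun _ h => h.2
    · rintro y hyj ⟨⟨z, ⟨hzj, hzi⟩, hz⟩, hy⟩
      have := X.injOn j A hzj hyj hz
      subst this
      rw [Set.mem_preimage, htc z ⟨hzj, hzi⟩] at hy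
      simp only [Function.comp_apply, htc z ⟨hzj, hzi⟩]
      exact hf z hzi hy
  refine ⟨fun i => ?_, fun i => ?_⟩
  · rw [isOpen_iff_forall_mem_open]
    rintro _ ⟨x, hx, rfl⟩
    obtain ⟨D, g, hD, hxD, hDS, -⟩ := H' i x hx
    exact ⟨D, hDS, hD, hxD⟩
  · let g : Pt A (X.model i) → Y := fun p =>
      if h : ∃ x, x ∈ X.source i A ∩ S ∧ X.coord i A x = p then f h.choose else 0
    have hg : ∀ x ∈ X.source i A ∩ S, g (X.coord i A x) = f x := by
      intro x hx
      have h : ∃ y, y ∈ X.source i A ∩ S ∧ X.coord i A y = X.coord i A x := ⟨x, hx, rfl⟩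
      simp only [g, dif_pos h]
      rw [X.injOn i A h.choose_spec.1.1 hx.1 h.choose_spec.2]
    refine ⟨g, SuperSmoothOn.of_local ?_, hg⟩
    rintro _ ⟨x, hx, rfl⟩
    obtain ⟨D, g', hD, hxD, hDS, hg', hf⟩ := H' i x hx
    refine ⟨D, g', hD, hxD, hg', ?_⟩
    intro p hp
    obtain ⟨y, hy, rfl⟩ := hDS hp
    rw [hg y hy, hf y hy.1 hp]

lemma SmoothOn.comp {f : X.pts.obj A → Y} {S : Set (X.pts.obj A)} {h : Y → Z} {D : Set Y}
    (hh : SuperSmoothOn A h D) (hD : IsOpen D) (hf : X.SmoothOn f S) (hm : Set.MapsTo f S D) :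
    X.SmoothOn (h ∘ f) S := by
  refine ⟨hf.1, fun i => ?_⟩
  obtain ⟨g, hg, hgf⟩ := hf.2 i
  refine ⟨h ∘ g, hh.comp hg (hf.1 i) hD ?_, fun x hx => by simp [hgf x hx]⟩
  rintro _ ⟨x, hx, rfl⟩
  rw [hgf x hx]; exact hm hx.2

lemma SmoothOn.prodMk {f : X.pts.obj A → Y} {h : X.pts.obj A → Z} {S : Set (X.pts.obj A)}
    (hf : X.SmoothOn f S) (hh : X.SmoothOn h S) : X.SmoothOn (fun x => (f x, h x)) S := by
  refine ⟨hf.1, fun i => ?_⟩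
  obtain ⟨g, hg, hgf⟩ := hf.2 i
  obtain ⟨k, hk, hkh⟩ := hh.2 i
  exact ⟨_, hg.prodMk hk (hf.1 i), fun x hx => by simp [hgf x hx, hkh x hx]⟩

/-- A morphism of functors between supermanifolds is supersmooth if it is so in charts. -/
def IsSuperSmooth {X : SuperManifold.{u}} {Y : SuperManifold.{v}}
    (f : ∀ A, X.pts.obj A → Y.pts.obj A) : Prop :=
  ∀ (A : Gr) (j : Y.ι), X.SmoothOn (fun x => Y.coord j A (f A x)) (f A ⁻¹' Y.source j A)

/-- The pullback of a supersmooth function along a supersmooth morphism. -/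
lemma IsSuperSmooth.smoothOn {W : SuperManifold.{v}} {F : ∀ A, X.pts.obj A → W.pts.obj A}
    (hF : IsSuperSmooth F) {h : W.pts.obj A → Y} {T : Set (W.pts.obj A)} (hh : W.SmoothOn h T) :
    X.SmoothOn (fun x => h (F A x)) (F A ⁻¹' T) := by
  apply SmoothOn.of_local
  intro x hx
  obtain ⟨i, hi⟩ := X.cover A x
  obtain ⟨j, hj⟩ := W.cover A (F A x)
  obtain ⟨g, hg, hgf⟩ := (hF A j).2 i
  obtain ⟨k, hk, hkh⟩ := hh.2 j
  have hD1 := (hF A j).1 i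
  have hD2 := hh.1 j
  have hopen := hg.1.continuousOn.isOpen_inter_preimage hD1 hD2
  refine ⟨i, hi, _, k ∘ g, hopen, ?_, ?_, ?_, ?_⟩
  · refine ⟨⟨x, ⟨hi, hj⟩, rfl⟩, ?_⟩
    rw [Set.mem_preimage, hgf x ⟨hi, hj⟩]
    exact ⟨F A x, ⟨hj, hx⟩, rfl⟩
  · rintro _ ⟨⟨y, hy, rfl⟩, hy'⟩
    rw [Set.mem_preimage, hgf y hy] at hy'
    obtain ⟨z, hz, hzy⟩ := hy'
    have := W.injOn j A hz.1 hy.2 hzy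
    subst this
    exact ⟨y, ⟨hy.1, hz.2⟩, rfl⟩
  · exact hk.comp (hg.mono Set.inter_subset_left) hopen hD2 fun _ h => h.2
  · rintro y hy ⟨⟨z, hz, hzy⟩, hy'⟩
    have := X.injOn i A hz.1 hy hzy
    subst this
    rw [Set.mem_preimage, hgf z hz] at hy'
    obtain ⟨w, hw, hwz⟩ := hy'
    have := W.injOn j A hw.1 hz.2 hwz
    simp only [Function.comp_apply, hgf z hz]
    exact hkh _ ⟨hz.2, this ▸ hw.2⟩

lemma IsSuperSmooth.comp {W : SuperManifold.{v}} {U : SuperManifold.{w}}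
    {G : ∀ A, W.pts.obj A → U.pts.obj A} {F : ∀ A, X.pts.obj A → W.pts.obj A}
    (hG : IsSuperSmooth G) (hF : IsSuperSmooth F) : IsSuperSmooth (fun A x => G A (F A x)) :=
  fun A j => hF.smoothOn (hG A j)

end SuperManifold

/-! ### Superpoints -/

namespace Gr

variable {A B : Gr}

lemma ι_mul (v : Fin A.rank → ℝ) (x : A.Alg) :
    ExteriorAlgebra.ι ℝ v * x =
      CliffordAlgebra.involute (Q := (0 : QuadraticForm ℝ (Fin A.rank → ℝ))) x *
        ExteriorAlgebra.ι ℝ v := by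
  induction x using CliffordAlgebra.induction with
  | algebraMap r => simpa using (Algebra.commutes r _).symm
  | ι w =>
    rw [CliffordAlgebra.involute_ι, neg_mul]
    exact eq_neg_of_add_eq_zero_left (ExteriorAlgebra.ι_add_mul_swap v w)
  | mul x y hx hy => rw [← mul_assoc, hx, mul_assoc, hy, map_mul, mul_assoc]
  | add x y hx hy => rw [mul_add, hx, hy, map_add, add_mul]

lemma mul_even (x a : A.Alg) (ha : a ∈ A.part 0) : x * a = a * x := by
  induction x using CliffordAlgebra.induction with
  | algebraMap r => exact Algebra.commutes r a
  | ι v =>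
    have h := ι_mul v a
    rwa [CliffordAlgebra.involute_eq_of_mem_even ha] at h
  | mul x y hx hy => rw [mul_assoc, hy, ← mul_assoc, hx, mul_assoc]
  | add x y hx hy => rw [add_mul, hx, hy, mul_add]

lemma odd_mul (x : A.Alg) (hx : x ∈ A.part 1) (y : A.Alg) :
    x * y = CliffordAlgebra.involute (Q := (0 : QuadraticForm ℝ (Fin A.rank → ℝ))) y * x := by
  induction x, hx using CliffordAlgebra.odd_induction with
  | ι v => exact ι_mul v y
  | add x z _ _ ihx ihz => rw [add_mul, ihx, ihz, mul_add]
  | ι_mul_ι_mul v w x _ ih =>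
    have h1 := ι_mul w (CliffordAlgebra.involute (Q := (0 : QuadraticForm ℝ (Fin A.rank → ℝ))) y)
    have h2 := ι_mul v y
    rw [CliffordAlgebra.involute_involute] at h1
    change ExteriorAlgebra.ι ℝ v * ExteriorAlgebra.ι ℝ w * x * y =
      _ * (ExteriorAlgebra.ι ℝ v * ExteriorAlgebra.ι ℝ w * x)
    rw [mul_assoc, ih, ← mul_assoc, mul_assoc (ExteriorAlgebra.ι ℝ v), h1, ← mul_assoc, h2]
    simp only [mul_assoc]

lemma odd_mul_self (x : A.Alg) (hx : x ∈ A.part 1) : x * x = 0 := by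
  have h := odd_mul x hx x
  rw [CliffordAlgebra.involute_eq_of_mem_odd hx, neg_mul, eq_neg_iff_add_eq_zero] at h
  have h2 : (2 : ℝ) • (x * x) = 0 := by rw [two_smul]; exact h
  exact (smul_eq_zero.mp h2).resolve_left two_ne_zero

/-- The morphism of Grassmann algebras with given odd values on the generators. -/
def homOfGen (y : Fin A.rank → B.part 1) : A ⟶ B where
  alg := ExteriorAlgebra.lift ℝ
    ⟨(Submodule.subtype _).comp (Fintype.linearCombination ℝ y),
      fun _ => odd_mul_self _ (Subtype.prop _)⟩
  parity i x hx := by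
    have hι : ∀ v, ExteriorAlgebra.lift ℝ
        ⟨(Submodule.subtype _).comp (Fintype.linearCombination ℝ y),
          fun _ => odd_mul_self _ (Subtype.prop _)⟩ (ExteriorAlgebra.ι ℝ v) ∈ B.part 1 := by
      intro v
      rw [ExteriorAlgebra.lift_ι_apply]
      exact Subtype.prop _
    have hmul : ∀ (i : ZMod 2) (v w : Fin A.rank → ℝ) (z : A.Alg), ExteriorAlgebra.lift ℝ
        ⟨(Submodule.subtype _).comp (Fintype.linearCombination ℝ y),
          fun _ => odd_mul_self _ (Subtype.prop _)⟩ z ∈ B.part i → ExteriorAlgebra.lift ℝ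
        ⟨(Submodule.subtype _).comp (Fintype.linearCombination ℝ y),
          fun _ => odd_mul_self _ (Subtype.prop _)⟩
          (ExteriorAlgebra.ι ℝ v * ExteriorAlgebra.ι ℝ w * z) ∈ B.part i := by
      intro i v w z hz
      rw [map_mul, map_mul]
      have h := SetLike.mul_mem_graded (A := B.part) (SetLike.mul_mem_graded (A := B.part)
        (hι v) (hι w)) hz
      rwa [show (1 : ZMod 2) + 1 + i = i by rw [show (1 : ZMod 2) + 1 = 0 by decide, zero_add]] at h
    rcases (by decide : ∀ i : ZMod 2, i = 0 ∨ i = 1) i with rfl | rfl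
    · induction x, hx using CliffordAlgebra.even_induction with
      | algebraMap r =>
        rw [AlgHom.commutes]
        exact SetLike.algebraMap_mem_graded B.part r
      | add x y _ _ hx hy => rw [map_add]; exact add_mem hx hy
      | ι_mul_ι_mul v w z _ hz => exact hmul 0 v w z hz
    · induction x, hx using CliffordAlgebra.odd_induction with
      | ι v => exact hι v
      | add x y _ _ hx hy => rw [map_add]; exact add_mem hx hy
      | ι_mul_ι_mul v w z _ hz => exact hmul 1 v w z hz

lemma homOfGen_gen (y : Fin A.rank → B.part 1) (i : Fin A.rank) :
    Hom.res (homOfGen y) 1 (A.gen i) = y i := by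
  apply Subtype.ext
  change ExteriorAlgebra.lift ℝ _ (ExteriorAlgebra.ι ℝ (Pi.single i 1)) = _
  rw [ExteriorAlgebra.lift_ι_apply]
  simp

lemma hom_ext {f g : A ⟶ B} (h : ∀ i, Hom.res f 1 (A.gen i) = Hom.res g 1 (A.gen i)) : f = g := by
  apply Hom.ext
  apply ExteriorAlgebra.hom_ext
  ext i
  exact congrArg Subtype.val (h i)

end Gr

namespace GTensor

variable {A : Gr}

/-- `id ⊗ T` as a continuous linear map. -/
def clmap (A : Gr) (i : ZMod 2) {V : Type u} {W : Type v} [NormedAddCommGroup V] [NormedSpace ℝ V]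
    [NormedAddCommGroup W] [NormedSpace ℝ W] (T : V →L[ℝ] W) :
    GTensor A i V →L[ℝ] GTensor A i W where
  toLinearMap := lmap LinearMap.id (T : V →ₗ[ℝ] W)
  cont := continuous_lmap _ T

lemma clmap_smul {i : ZMod 2} {V : Type u} {W : Type v} [NormedAddCommGroup V] [NormedSpace ℝ V]
    [NormedAddCommGroup W] [NormedSpace ℝ W] (T : V →L[ℝ] W) (a : A.Even) (x : GTensor A i V) :
    clmap A i T (a • x) = a • clmap A i T x := lmap_smul _ a x

lemma clmap_tmul {i : ZMod 2} {V : Type u} {W : Type v} [NormedAddCommGroup V] [NormedSpace ℝ V]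
    [NormedAddCommGroup W] [NormedSpace ℝ W] (T : V →L[ℝ] W) (p : A.part i) (v : V) :
    clmap A i T (tmul i p v) = tmul i p (T v) := rfl

/-- `Λ_i ⊗ ℝ = Λ_i`. -/
def toPart (i : ZMod 2) : GTensor A i ℝ ≃ₗ[ℝ] A.part i := TensorProduct.rid ℝ (A.part i)

lemma toPart_tmul (i : ZMod 2) (p : A.part i) (r : ℝ) : toPart i (tmul i p r) = r • p :=
  TensorProduct.rid_tmul _ _

lemma toPart_symm (i : ZMod 2) (p : A.part i) : (toPart i).symm p = tmul i p 1 := rfl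

lemma add_tmul (i : ZMod 2) (p q : A.part i) (r : ℝ) :
    tmul i (p + q) r = tmul i p r + tmul i q r := TensorProduct.add_tmul p q r

lemma toPart_smul (i : ZMod 2) (a : A.Even) (x : GTensor A i ℝ) :
    toPart i (a • x) = a • toPart i x := by
  induction x using GTensor.induction with
  | h0 => simp
  | ht p v => rw [smul_tmul, toPart_tmul, toPart_tmul, smul_comm]
  | ha x y hx hy => simp only [smul_add, map_add, hx, hy]

instance (i : ZMod 2) : FiniteDimensional ℝ (GTensor A i ℝ) :=
  Module.Finite.equiv (toPart i).symm

/-- Multiplication of homogeneous elements. -/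
def mul (i j k : ZMod 2) (h : i + j = k) :
    GTensor A i ℝ →ₗ[ℝ] GTensor A j ℝ →ₗ[ℝ] GTensor A k ℝ :=
  LinearMap.mk₂ ℝ (fun x y => (toPart k).symm (Gr.mulPart i j k h (toPart i x) (toPart j y)))
    (fun x y z => by
      rw [← map_add]; congr 1; exact Subtype.ext (by simp [Gr.mulPart, add_mul]))
    (fun r x y => by
      rw [← map_smul]; congr 1; exact Subtype.ext (by simp [Gr.mulPart]))
    (fun x y z => by simp)
    (fun r x y => by simp)

lemma mul_apply (i j k : ZMod 2) (h : i + j = k) (x : GTensor A i ℝ) (y : GTensor A j ℝ) :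
    mul i j k h x y = (toPart k).symm (Gr.mulPart i j k h (toPart i x) (toPart j y)) := rfl

lemma mul_smul_left (i j k : ZMod 2) (h : i + j = k) (a : A.Even) (x : GTensor A i ℝ)
    (y : GTensor A j ℝ) : mul i j k h (a • x) y = a • mul i j k h x y := by
  apply (toPart k).injective
  rw [toPart_smul, mul_apply, mul_apply, LinearEquiv.apply_symm_apply, LinearEquiv.apply_symm_apply,
    toPart_smul]
  exact Subtype.ext (mul_assoc (a : A.Alg) _ _)

lemma mul_smul_right (i j k : ZMod 2) (h : i + j = k) (a : A.Even) (x : GTensor A i ℝ)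
    (y : GTensor A j ℝ) : mul i j k h x (a • y) = a • mul i j k h x y := by
  apply (toPart k).injective
  rw [toPart_smul, mul_apply, mul_apply, LinearEquiv.apply_symm_apply, LinearEquiv.apply_symm_apply,
    toPart_smul]
  refine Subtype.ext ?_
  change (toPart i x : A.Alg) * ((a : A.Alg) * (toPart j y : A.Alg)) =
    (a : A.Alg) * ((toPart i x : A.Alg) * (toPart j y : A.Alg))
  rw [← mul_assoc, Gr.mul_even _ _ a.2, mul_assoc]

end GTensor

lemma SuperSmoothOn.comp_snd {A : Gr} {X Y Z : Type*}
    [NormedAddCommGroup X] [NormedSpace ℝ X] [Module A.Even X]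
    [NormedAddCommGroup Y] [NormedSpace ℝ Y] [Module A.Even Y]
    [NormedAddCommGroup Z] [NormedSpace ℝ Z] [Module A.Even Z] {D : Set X} {E : Set Y} {g : Y → Z}
    (hg : SuperSmoothOn A g E) (hD : IsOpen D) (hE : IsOpen E) :
    SuperSmoothOn A (fun p : X × Y => g p.2) (D ×ˢ E) :=
  hg.comp (SuperSmoothOn.of_linear (ContinuousLinearMap.snd ℝ X Y) (fun _ _ => rfl) _)
    (hD.prod hE) hE fun _ h => h.2

lemma SuperSmoothOn.comp_fst {A : Gr} {X Y Z : Type*}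
    [NormedAddCommGroup X] [NormedSpace ℝ X] [Module A.Even X]
    [NormedAddCommGroup Y] [NormedSpace ℝ Y] [Module A.Even Y]
    [NormedAddCommGroup Z] [NormedSpace ℝ Z] [Module A.Even Z] {D : Set X} {E : Set Y} {g : X → Z}
    (hg : SuperSmoothOn A g D) (hD : IsOpen D) (hE : IsOpen E) :
    SuperSmoothOn A (fun p : X × Y => g p.1) (D ×ˢ E) :=
  hg.comp (SuperSmoothOn.of_linear (ContinuousLinearMap.fst ℝ X Y) (fun _ _ => rfl) _)
    (hD.prod hE) hD fun _ h => h.1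

lemma join_symm_smul (A : Gr) (V : SBanach.{u}) (W : SBanach.{v}) (a : A.Even)
    (p : Pt A (V.prod W)) : (join A V W).symm (a • p) = a • (join A V W).symm p := by
  rw [ContinuousLinearEquiv.symm_apply_eq, join_smul, ContinuousLinearEquiv.apply_symm_apply]

lemma superSmoothOn_join {A : Gr} {V V' : SBanach.{u}} {W W' : SBanach.{v}} {D : Set (Pt A V)}
    {E : Set (Pt A W)} {g : Pt A V → Pt A V'} {h : Pt A V × Pt A W → Pt A W'}
    (hg : SuperSmoothOn A g D) (hh : SuperSmoothOn A h (D ×ˢ E)) (hD : IsOpen D) (hE : IsOpen E) :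
    SuperSmoothOn A (fun p => join A V' W' (g ((join A V W).symm p).1, h ((join A V W).symm p)))
      (join A V W '' (D ×ˢ E)) := by
  have ho : IsOpen (join A V W '' (D ×ˢ E)) :=
    (join A V W).toHomeomorph.isOpenMap _ (hD.prod hE)
  have h1 : SuperSmoothOn A (join A V W).symm (join A V W '' (D ×ˢ E)) :=
    SuperSmoothOn.of_linear (join A V W).symm.toContinuousLinearMap (join_symm_smul A V W) _
  have h2 : SuperSmoothOn A (join A V' W') Set.univ :=
    SuperSmoothOn.of_linear (join A V' W').toContinuousLinearMap (join_smul A V' W') _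
  refine h2.comp (((hg.comp_fst hD hE).prodMk hh (hD.prod hE)).comp h1 ho (hD.prod hE) ?_) ho
    isOpen_univ fun _ _ => trivial
  rintro _ ⟨p, hp, rfl⟩
  simpa using hp

namespace SuperManifold

/-- Coordinates of a superpoint: the images of the odd generators. -/
def superpointCoord (K A : Gr) (p : K ⟶ A) : Pt A (SBanach.oddSpace K.rank) :=
  (0, ∑ i, GTensor.tmul 1 (Gr.Hom.res p 1 (K.gen i)) (Pi.single i 1))

lemma superpointCoord_bijective (K A : Gr) : Function.Bijective (superpointCoord K A) := by
  classical
  let e := TensorProduct.equivFinsuppOfBasisRight (M := A.part 1) (Pi.basisFun ℝ (Fin K.rank))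
  have he : ∀ y : Fin K.rank → A.part 1,
      (∑ i, GTensor.tmul 1 (y i) (Pi.single i (1 : ℝ)) : GTensor A 1 (Fin K.rank → ℝ)) =
        e.symm (Finsupp.equivFunOnFinite.symm y) := by
    intro y
    simp only [e]
    rw [TensorProduct.equivFinsuppOfBasisRight_symm_apply, Finsupp.sum_fintype _ _ (by simp)]
    simp only [Pi.basisFun_apply, Finsupp.equivFunOnFinite_symm_apply_apply]
    rfl
  constructor
  · intro p q h
    have h2 := (Prod.ext_iff.mp h).2
    simp only [superpointCoord] at h2
    rw [he, he] at h2
    have h3 := Finsupp.equivFunOnFinite.symm.injective (e.symm.injective h2)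
    exact Gr.hom_ext fun i => congrFun h3 i
  · rintro ⟨z, y⟩
    refine ⟨Gr.homOfGen (fun i => e y i), Prod.ext ?_ ?_⟩
    · have hz : ∀ z : GTensor A 0 PUnit, z = 0 := by
        intro z
        induction z using GTensor.induction with
        | h0 => rfl
        | ht p v => rw [Subsingleton.elim v 0, map_zero]
        | ha x y hx hy => rw [hx, hy, add_zero]
      exact (hz z).symm
    · simp only [superpointCoord, Gr.homOfGen_gen]
      rw [he]
      have : Finsupp.equivFunOnFinite.symm (fun i => e y i) = e y := by ext; rfl
      rw [this]
      exact e.symm_apply_apply y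

/-- The superpoint `𝓟(Λ)`, with `𝓟(Λ)(Λ') = Hom(Λ, Λ')`; it is isomorphic to the functor of points
of `ℝ^{0|k}`, where `k` is the number of generators of `Λ`. -/
def superpoint (K : Gr) : SuperManifold.{0} where
  pts := { obj := fun A => K ⟶ A, map := fun φ => ↾fun p => p ≫ φ }
  ι := PUnit
  model _ := SBanach.oddSpace K.rank
  source _ _ := Set.univ
  coord _ A p := superpointCoord K A p
  injOn _ A := (superpointCoord_bijective K A).1.injOn
  source_map _ _ _ _ _ _ := trivial
  coord_map _ A B φ p _ := by
    change superpointCoord K B (p ≫ φ) = Bar.map φ (superpointCoord K A p)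
    ext1 <;> simp [superpointCoord, Bar.map, map_sum, GTensor.map_tmul]
  cover _ _ := ⟨PUnit.unit, trivial⟩
  isOpen_overlap _ _ A := by
    simp [(superpointCoord_bijective K A).2.range_eq]
  transition _ _ A := ⟨_, SuperSmoothOn.of_linear (ContinuousLinearMap.id ℝ _) (fun _ _ => rfl) _,
    fun _ _ => rfl⟩

/-- The product of two supermanifolds. -/
def prod (X : SuperManifold.{u}) (Y : SuperManifold.{v}) : SuperManifold.{max u v} where
  pts :=
    { obj := fun A => X.pts.obj A × Y.pts.obj A
      map := fun φ => ↾fun p => (X.pts.map φ p.1, Y.pts.map φ p.2) }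
  ι := X.ι × Y.ι
  model i := (X.model i.1).prod (Y.model i.2)
  source i A := X.source i.1 A ×ˢ Y.source i.2 A
  coord i A p := join A _ _ (X.coord i.1 A p.1, Y.coord i.2 A p.2)
  injOn i A := by
    intro p hp q hq h
    have h' := Prod.ext_iff.mp ((join A _ _).injective h)
    exact Prod.ext (X.injOn _ _ hp.1 hq.1 h'.1) (Y.injOn _ _ hp.2 hq.2 h'.2)
  source_map i A B φ p hp := ⟨X.source_map _ φ _ hp.1, Y.source_map _ φ _ hp.2⟩
  coord_map i A B φ p hp := by
    rw [← join_map, ← X.coord_map _ φ _ hp.1, ← Y.coord_map _ φ _ hp.2]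
    rfl
  cover A p := by
    obtain ⟨i, hi⟩ := X.cover A p.1
    obtain ⟨j, hj⟩ := Y.cover A p.2
    exact ⟨(i, j), hi, hj⟩
  isOpen_overlap i j A := by
    have h := (join A (X.model i.1) (Y.model i.2)).toHomeomorph.isOpenMap _
      ((X.isOpen_overlap i.1 j.1 A).prod (Y.isOpen_overlap i.2 j.2 A))
    convert h using 1
    rw [Set.prod_inter_prod, Set.prod_image_image_eq, Set.image_image]
    rfl
  transition i j A := by
    obtain ⟨g, hg, hgx⟩ := X.transition i.1 j.1 A
    obtain ⟨k, hk, hky⟩ := Y.transition i.2 j.2 A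
    refine ⟨_, (superSmoothOn_join hg (hk.comp_snd (D := X.coord i.1 A '' _) (X.isOpen_overlap _ _ _)
      (Y.isOpen_overlap i.2 j.2 A)) (X.isOpen_overlap _ _ _) (Y.isOpen_overlap i.2 j.2 A)).mono ?_,
      ?_⟩
    · rintro _ ⟨p, hp, rfl⟩
      exact ⟨_, ⟨⟨p.1, ⟨hp.1.1, hp.2.1⟩, rfl⟩, ⟨p.2, ⟨hp.1.2, hp.2.2⟩, rfl⟩⟩, rfl⟩
    · intro p hp
      simp [hgx p.1 ⟨hp.1.1, hp.2.1⟩, hky p.2 ⟨hp.1.2, hp.2.2⟩]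

/-- A supersmooth morphism of supermanifolds. -/
@[ext]
structure Hom (X : SuperManifold.{u}) (Y : SuperManifold.{v}) where
  toFun : ∀ A, X.pts.obj A → Y.pts.obj A
  naturality : ∀ {A B : Gr} (φ : A ⟶ B) (x : X.pts.obj A),
    toFun B (X.pts.map φ x) = Y.pts.map φ (toFun A x)
  smooth : IsSuperSmooth toFun

/-- Composition of supersmooth morphisms. -/
def Hom.comp {X : SuperManifold.{u}} {Y : SuperManifold.{v}} {Z : SuperManifold.{w}}
    (g : Hom Y Z) (f : Hom X Y) : Hom X Z where
  toFun A x := g.toFun A (f.toFun A x)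
  naturality φ x := by rw [f.naturality, g.naturality]
  smooth := g.smooth.comp f.smooth

lemma isSuperSmooth_id (X : SuperManifold.{u}) : IsSuperSmooth (X := X) (Y := X) fun _ x => x :=
  fun _ j => smoothOn_coord j

section Prod

variable {X : SuperManifold.{u}} {Y : SuperManifold.{v}} {Z : SuperManifold.{w}}

lemma isSuperSmooth_fst :
    IsSuperSmooth (X := X.prod Y) (Y := X) (fun _ p => p.1) := by
  intro A j
  apply SmoothOn.of_local
  intro p hp
  obtain ⟨i, hi⟩ := Y.cover A p.2
  refine ⟨(j, i), ⟨hp, hi⟩, _, fun q => ((join A _ _).symm q).1,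
    (X.prod Y).isOpen_overlap (j, i) (j, i) A, ⟨p, ⟨⟨hp, hi⟩, ⟨hp, hi⟩⟩, rfl⟩, ?_, ?_, ?_⟩
  · rintro _ ⟨q, hq, rfl⟩
    exact ⟨q, ⟨hq.1, hq.1.1⟩, rfl⟩
  · exact SuperSmoothOn.of_linear ((ContinuousLinearMap.fst ℝ _ _).comp
      (join A (X.model j) (Y.model i)).symm.toContinuousLinearMap)
      (fun a v => congrArg Prod.fst (join_symm_smul _ _ _ a v)) _
  · intro q _ _
    simp [prod]

lemma isSuperSmooth_snd :
    IsSuperSmooth (X := X.prod Y) (Y := Y) (fun _ p => p.2) := by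
  intro A j
  apply SmoothOn.of_local
  intro p hp
  obtain ⟨i, hi⟩ := X.cover A p.1
  refine ⟨(i, j), ⟨hi, hp⟩, _, fun q => ((join A _ _).symm q).2,
    (X.prod Y).isOpen_overlap (i, j) (i, j) A, ⟨p, ⟨⟨hi, hp⟩, ⟨hi, hp⟩⟩, rfl⟩, ?_, ?_, ?_⟩
  · rintro _ ⟨q, hq, rfl⟩
    exact ⟨q, ⟨hq.1, hq.1.2⟩, rfl⟩
  · exact SuperSmoothOn.of_linear ((ContinuousLinearMap.snd ℝ _ _).comp
      (join A (X.model i) (Y.model j)).symm.toContinuousLinearMap)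
      (fun a v => congrArg Prod.snd (join_symm_smul _ _ _ a v)) _
  · intro q _ _
    simp [prod]

/-- A morphism into a product is supersmooth if its components are. -/
lemma IsSuperSmooth.prodMk {f : ∀ A, Z.pts.obj A → X.pts.obj A} {g : ∀ A, Z.pts.obj A → Y.pts.obj A}
    (hf : IsSuperSmooth f) (hg : IsSuperSmooth g) :
    IsSuperSmooth (X := Z) (Y := X.prod Y) fun A z => (f A z, g A z) := by
  intro A j
  have ho : Z.IsOpenSet ((f A ⁻¹' X.source j.1 A) ∩ (g A ⁻¹' Y.source j.2 A)) :=
    (hf A j.1).1.inter (hg A j.2).1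
  have h := ((hf A j.1).mono ho Set.inter_subset_left).prodMk
    ((hg A j.2).mono ho Set.inter_subset_right)
  have h' := SmoothOn.comp (SuperSmoothOn.of_linear
    (join A (X.model j.1) (Y.model j.2)).toContinuousLinearMap
    (join_smul A _ _) Set.univ) isOpen_univ h fun _ _ => trivial
  exact h'

variable (X Y)

/-- The projection of a product to its second factor. -/
def sndHom : Hom (X.prod Y) Y where
  toFun _ p := p.2
  naturality _ _ := rfl
  smooth := isSuperSmooth_snd

end Prod

section Superpoint

variable {X : SuperManifold.{u}} {A : Gr} {Y : Type*}
  [NormedAddCommGroup Y] [NormedSpace ℝ Y] [Module A.Even Y]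

lemma smoothOn_const (c : Y) : X.SmoothOn (fun _ : X.pts.obj A => c) Set.univ :=
  ⟨isOpenSet_univ, fun _ => ⟨fun _ => c, ⟨contDiffOn_const, fun x _ a v => by simp⟩,
    fun _ _ => rfl⟩⟩

lemma SmoothOn.add {f g : X.pts.obj A → Y} {S : Set (X.pts.obj A)} (hf : X.SmoothOn f S)
    (hg : X.SmoothOn g S) : X.SmoothOn (fun x => f x + g x) S :=
  SmoothOn.comp (SuperSmoothOn.of_linear (ContinuousLinearMap.fst ℝ Y Y +
    ContinuousLinearMap.snd ℝ Y Y) (fun a v => by simp) Set.univ) isOpen_univ (hf.prodMk hg)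
    fun _ _ => trivial

lemma SmoothOn.sum {ι : Type*} (s : Finset ι) {f : ι → X.pts.obj A → Y}
    (hf : ∀ i ∈ s, X.SmoothOn (f i) Set.univ) :
    X.SmoothOn (fun x => ∑ i ∈ s, f i x) Set.univ := by
  classical
  induction s using Finset.induction_on with
  | empty => simpa using smoothOn_const 0
  | insert i s hi ih =>
    simp only [Finset.sum_insert hi]
    exact (hf i (Finset.mem_insert_self _ _)).add
      (ih fun j hj => hf j (Finset.mem_insert_of_mem hj))

lemma superSmoothOn_mul (i j k : ZMod 2) (h : i + j = k) (D : Set _) : SuperSmoothOn A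
    (fun p : GTensor A i ℝ × GTensor A j ℝ => GTensor.mul i j k h p.1 p.2) D := by
  have hb := (GTensor.mul (A := A) i j k h).toContinuousBilinearMap.isBoundedBilinearMap
  refine ⟨hb.contDiff.contDiffOn, fun x _ a v => ?_⟩
  have hd : fderiv ℝ (fun p : GTensor A i ℝ × GTensor A j ℝ => GTensor.mul i j k h p.1 p.2) x = _ :=
    hb.fderiv x
  rw [hd]
  change GTensor.mul i j k h x.1 (a • v.2) + GTensor.mul i j k h (a • v.1) x.2 =
    a • (GTensor.mul i j k h x.1 v.2 + GTensor.mul i j k h v.1 x.2)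
  rw [GTensor.mul_smul_left, GTensor.mul_smul_right, smul_add]

lemma smoothOn_superpoint_eval (L : Gr) (i : ZMod 2) (a : L.part i) :
    (superpoint L).SmoothOn (A := A)
      (fun p => GTensor.tmul i (Gr.Hom.res (A := L) p i a) (1 : ℝ)) Set.univ := by
  have hι : ∀ v : Fin L.rank → ℝ, (superpoint L).SmoothOn (A := A) (fun p =>
      GTensor.tmul 1 (Gr.Hom.res (A := L) p 1
        ⟨ExteriorAlgebra.ι ℝ v, CliffordAlgebra.ι_mem_evenOdd_one _ _⟩) (1 : ℝ)) Set.univ := by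
    intro v
    let d : (Fin L.rank → ℝ) →L[ℝ] ℝ := LinearMap.toContinuousLinearMap
      (Fintype.linearCombination ℝ v)
    have h0 : (superpoint L).SmoothOn (A := A) (superpointCoord L A) Set.univ :=
      smoothOn_coord (X := superpoint L) (A := A) PUnit.unit
    have h1 := SmoothOn.comp (SuperSmoothOn.of_linear
      (ContinuousLinearMap.snd ℝ (GTensor A 0 PUnit) (GTensor A 1 (Fin L.rank → ℝ)))
      (fun _ _ => rfl) Set.univ) isOpen_univ h0 fun _ _ => trivial
    have h := SmoothOn.comp (SuperSmoothOn.of_linear (GTensor.clmap A 1 d)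
      (GTensor.clmap_smul d) Set.univ) isOpen_univ h1 fun _ _ => trivial
    convert h using 1
    funext p
    change _ = GTensor.clmap A 1 d (∑ i, GTensor.tmul 1 (Gr.Hom.res (A := L) p 1 (L.gen i)) (Pi.single i 1))
    have hv : (⟨ExteriorAlgebra.ι ℝ v, CliffordAlgebra.ι_mem_evenOdd_one _ _⟩ : L.part 1) =
        ∑ i, v i • L.gen i := by
      apply Subtype.ext
      have : v = ∑ i, v i • (Pi.single i (1 : ℝ) : Fin L.rank → ℝ) := by
        simpa using (pi_eq_sum_univ' v)
      conv_lhs => rw [this]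
      simp [Gr.gen]
    rw [hv, map_sum, map_sum]
    apply (GTensor.toPart 1).injective
    simp [GTensor.toPart_tmul, GTensor.clmap_tmul, d, Fintype.linearCombination_apply,
      Pi.single_apply]
  have hmul : ∀ (j : ZMod 2) (v w : Fin L.rank → ℝ) (x : L.Alg) (hx : x ∈ L.part j)
      (hy : ExteriorAlgebra.ι ℝ v * ExteriorAlgebra.ι ℝ w * x ∈ L.part j),
      (superpoint L).SmoothOn (A := A)
        (fun p => GTensor.tmul j (Gr.Hom.res (A := L) p j ⟨x, hx⟩) (1 : ℝ)) Set.univ →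
      (superpoint L).SmoothOn (A := A)
        (fun p => GTensor.tmul j (Gr.Hom.res (A := L) p j
          ⟨ExteriorAlgebra.ι ℝ v * ExteriorAlgebra.ι ℝ w * x, hy⟩) (1 : ℝ)) Set.univ := by
    intro j v w x hx hy h
    have h1 := SmoothOn.comp (superSmoothOn_mul 1 1 0 (by decide) Set.univ) isOpen_univ
      ((hι v).prodMk (hι w)) fun _ _ => trivial
    have h2 := SmoothOn.comp (superSmoothOn_mul 0 j j (zero_add j) Set.univ) isOpen_univ
      (h1.prodMk h) fun _ _ => trivial
    convert h2 using 1
    funext p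
    apply (GTensor.toPart j).injective
    simp only [Function.comp_apply, GTensor.mul_apply, LinearEquiv.apply_symm_apply,
      GTensor.toPart_tmul, one_smul]
    apply Subtype.ext
    let q : L ⟶ A := p
    exact (map_mul q.alg _ _).trans (congrArg (· * _) (map_mul q.alg _ _))
  obtain ⟨a, ha⟩ := a
  rcases (by decide : ∀ i : ZMod 2, i = 0 ∨ i = 1) i with rfl | rfl
  · induction a, ha using CliffordAlgebra.even_induction with
    | algebraMap r =>
      convert smoothOn_const (X := superpoint L) (A := A) (GTensor.tmul 0
        (⟨algebraMap ℝ A.Alg r, SetLike.algebraMap_mem_graded A.part r⟩ : A.part 0) (1 : ℝ)) using 1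
      funext p
      congr 2
      exact Subtype.ext ((Gr.Hom.alg (A := L) p).commutes r)
    | add x y hx hy ihx ihy =>
      convert ihx.add ihy using 1
      funext p
      rw [← GTensor.add_tmul, ← map_add]
      rfl
    | ι_mul_ι_mul v w z hz ih => exact hmul 0 v w z hz _ ih
  · induction a, ha using CliffordAlgebra.odd_induction with
    | ι v => exact hι v
    | add x y hx hy ihx ihy =>
      convert ihx.add ihy using 1
      funext p
      rw [← GTensor.add_tmul, ← map_add]
      rfl
    | ι_mul_ι_mul v w z hz ih => exact hmul 1 v w z hz _ ih

end Superpoint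

/-- The morphism `𝓟(φ) : 𝓟(Λ') → 𝓟(Λ)` of superpoints given by `φ : Λ → Λ'`. -/
def superpointMap {K L : Gr} (φ : K ⟶ L) : Hom (superpoint L) (superpoint K) where
  toFun _ p := φ ≫ p
  naturality ψ p := (Category.assoc φ p ψ).symm
  smooth := by
    intro A j
    let d : Fin K.rank → ℝ →L[ℝ] (Fin K.rank → ℝ) := fun i =>
      ContinuousLinearMap.toSpanSingleton ℝ (Pi.single i 1)
    have h1 := SmoothOn.sum (X := superpoint L) (A := A) Finset.univ fun i _ =>
      SmoothOn.comp (SuperSmoothOn.of_linear (GTensor.clmap A 1 (d i))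
        (GTensor.clmap_smul (d i)) Set.univ) isOpen_univ
        (smoothOn_superpoint_eval L 1 (Gr.Hom.res φ 1 (K.gen i))) fun _ _ => trivial
    have h := (smoothOn_const (X := superpoint L) (A := A) (0 : GTensor A 0 PUnit)).prodMk h1
    refine (congrArg (fun f => (superpoint L).SmoothOn f Set.univ) ?_).mpr h
    funext p
    change superpointCoord K A (φ ≫ p) = _
    simp only [superpointCoord, GTensor.clmap_tmul, d, Function.comp_apply,
      ContinuousLinearMap.toSpanSingleton_apply, one_smul]
    rfl

/-- The morphism `𝓟(φ) × id`. -/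
def superpointMapProd {K L : Gr} (φ : K ⟶ L) (M : SuperManifold.{u}) :
    Hom ((superpoint L).prod M) ((superpoint K).prod M) where
  toFun A p := ((superpointMap φ).toFun A p.1, p.2)
  naturality ψ p := by
    exact Prod.ext ((superpointMap φ).naturality ψ p.1) rfl
  smooth := ((superpointMap φ).smooth.comp isSuperSmooth_fst).prodMk isSuperSmooth_snd

end SuperManifold

/-! ### Super vector bundles -/

/-- A super vector bundle over the supermanifold `M` with typical fibre the Banach super vector
space `V`: a functor `tot` with a projection to `M` and with `Λ_0`-module operations on the
fibres of `tot.obj Λ → M.pts.obj Λ`, and a bundle atlas.  The `i`-th chart of the bundle is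
given by an open subfunctor `base i` of `M` and by the fibre coordinate `fib i`; it identifies
`tot` over `base i`, naturally and linearly on the fibres, with the product of `base i` and the
functor of points of `V`.  The changes of trivializations `base i ∩ base j × V → V` are
supersmooth. -/
structure SuperVectorBundle (M : SuperManifold.{u}) (V : SBanach.{u}) : Type (u + 1) where
  tot : Gr ⥤ Type u
  proj : tot ⟶ M.pts
  add : ∀ (A : Gr) (a b : tot.obj A), proj.app A a = proj.app A b → tot.obj A
  smul : ∀ A : Gr, A.Even → tot.obj A → tot.obj A
  proj_add : ∀ A a b h, proj.app A (add A a b h) = proj.app A a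
  proj_smul : ∀ A c a, proj.app A (smul A c a) = proj.app A a
  ι : Type u
  base : ι → ∀ A : Gr, Set (M.pts.obj A)
  fib : ι → ∀ A : Gr, tot.obj A → Pt A V
  base_map : ∀ i {A B : Gr} (φ : A ⟶ B), ∀ x ∈ base i A, M.pts.map φ x ∈ base i B
  base_open : ∀ i A, M.IsOpenSet (base i A)
  cover : ∀ A x, ∃ i, x ∈ base i A
  fib_map : ∀ i {A B : Gr} (φ : A ⟶ B) (a : tot.obj A), proj.app A a ∈ base i A →
    fib i B (tot.map φ a) = Bar.map φ (fib i A a)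
  fib_bij : ∀ i A, ∀ x ∈ base i A, Set.BijOn (fib i A) {a | proj.app A a = x} Set.univ
  fib_add : ∀ i A a b h, proj.app A a ∈ base i A → fib i A (add A a b h) = fib i A a + fib i A b
  fib_smul : ∀ i A c a, proj.app A a ∈ base i A → fib i A (smul A c a) = c • fib i A a
  transition : ∀ i j A (α : M.ι), ∃ g : Pt A (M.model α) × Pt A V → Pt A V,
    SuperSmoothOn A g ((M.coord α A '' (M.source α A ∩ (base i A ∩ base j A))) ×ˢ Set.univ) ∧
    ∀ a, proj.app A a ∈ M.source α A ∩ (base i A ∩ base j A) →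
      g (M.coord α A (proj.app A a), fib i A a) = fib j A a

namespace SuperVectorBundle

open SuperManifold

variable {M : SuperManifold.{u}} {V : SBanach.{u}}

lemma proj_map (E : SuperVectorBundle M V) {A B : Gr} (φ : A ⟶ B) (a : E.tot.obj A) :
    E.proj.app B (E.tot.map φ a) = M.pts.map φ (E.proj.app A a) :=
  NatTrans.naturality_apply E.proj φ a

/-- The total space of a super vector bundle, as a supermanifold. -/
def total (E : SuperVectorBundle M V) : SuperManifold.{u} where
  pts := E.tot
  ι := M.ι × E.ι
  model i := (M.model i.1).prod V
  source i A := {a | E.proj.app A a ∈ M.source i.1 A ∩ E.base i.2 A}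
  coord i A a := join A _ _ (M.coord i.1 A (E.proj.app A a), E.fib i.2 A a)
  injOn i A := by
    intro a ha b hb h
    have h' := Prod.ext_iff.mp ((join A _ _).injective h)
    exact (E.fib_bij i.2 A _ ha.2).injOn rfl (M.injOn _ _ ha.1 hb.1 h'.1).symm h'.2
  source_map i A B φ a ha := by
    simp only [Set.mem_ofPred_eq, proj_map]
    exact ⟨M.source_map _ φ _ ha.1, E.base_map _ φ _ ha.2⟩
  coord_map i A B φ a ha := by
    rw [← join_map, proj_map, M.coord_map _ φ _ ha.1, E.fib_map _ φ _ ha.2]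
  cover A a := by
    obtain ⟨i, hi⟩ := M.cover A (E.proj.app A a)
    obtain ⟨j, hj⟩ := E.cover A (E.proj.app A a)
    exact ⟨(i, j), hi, hj⟩
  isOpen_overlap i j A := by
    have h1 : M.IsOpenSet (M.source j.1 A ∩ (E.base i.2 A ∩ E.base j.2 A)) :=
      (isOpenSet_source j.1).inter ((E.base_open i.2 A).inter (E.base_open j.2 A))
    have h := (join A (M.model i.1) V).toHomeomorph.isOpenMap _
      ((h1 i.1).prod (isOpen_univ (X := Pt A V)))
    convert h using 1
    ext q
    constructor
    · rintro ⟨a, ha, rfl⟩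
      exact ⟨_, ⟨⟨_, ⟨ha.1.1, ha.2.1, ha.1.2, ha.2.2⟩, rfl⟩, trivial⟩, rfl⟩
    · rintro ⟨⟨p, v⟩, ⟨⟨x, hx, rfl⟩, -⟩, rfl⟩
      obtain ⟨a, rfl, rfl⟩ := (E.fib_bij i.2 A x hx.2.2.1).surjOn (Set.mem_univ v)
      exact ⟨a, ⟨⟨hx.1, hx.2.2.1⟩, ⟨hx.2.1, hx.2.2.2⟩⟩, rfl⟩
  transition i j A := by
    have h1 : M.IsOpenSet (M.source j.1 A ∩ (E.base i.2 A ∩ E.base j.2 A)) :=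
      (isOpenSet_source j.1).inter ((E.base_open i.2 A).inter (E.base_open j.2 A))
    obtain ⟨g, hg, hgx⟩ := M.transition i.1 j.1 A
    obtain ⟨k, hk, hky⟩ := E.transition i.2 j.2 A i.1
    refine ⟨_, (superSmoothOn_join (D := M.coord i.1 A '' (M.source i.1 A ∩ (M.source j.1 A ∩
      (E.base i.2 A ∩ E.base j.2 A)))) (E := Set.univ) (hg.mono ?_) (hk.mono ?_) (h1 i.1)
      isOpen_univ).mono ?_, ?_⟩
    · exact Set.image_mono fun x hx => ⟨hx.1, hx.2.1⟩
    · exact Set.prod_mono (Set.image_mono fun x hx => ⟨hx.1, hx.2.2⟩) subset_rfl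
    · rintro _ ⟨a, ha, rfl⟩
      exact ⟨_, ⟨⟨_, ⟨ha.1.1, ha.2.1, ha.1.2, ha.2.2⟩, rfl⟩, trivial⟩, rfl⟩
    · intro a ha
      simp [hgx _ ⟨ha.1.1, ha.2.1⟩, hky a ⟨ha.1.1, ha.1.2, ha.2.2⟩]

section Smoothness

variable {X : SuperManifold.{v}} (E : SuperVectorBundle M V)

lemma isSuperSmooth_proj : IsSuperSmooth (X := E.total) (Y := M) fun A a => E.proj.app A a := by
  intro A α
  apply SmoothOn.of_local
  intro a ha
  obtain ⟨i, hi⟩ := E.cover A (E.proj.app A a)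
  refine ⟨(α, i), ⟨ha, hi⟩, _, fun q => ((join A _ _).symm q).1,
    E.total.isOpen_overlap (α, i) (α, i) A, ⟨a, ⟨⟨ha, hi⟩, ⟨ha, hi⟩⟩, rfl⟩, ?_, ?_, ?_⟩
  · rintro _ ⟨b, hb, rfl⟩
    exact ⟨b, ⟨hb.1, hb.1.1⟩, rfl⟩
  · exact SuperSmoothOn.of_linear ((ContinuousLinearMap.fst ℝ _ _).comp
      (join A (M.model α) V).symm.toContinuousLinearMap)
      (fun a v => congrArg Prod.fst (join_symm_smul _ _ _ a v)) _
  · intro b _ _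
    simp [total]

lemma smoothOn_fib (i : E.ι) (A : Gr) :
    E.total.SmoothOn (E.fib i A) {a | E.proj.app A a ∈ E.base i A} := by
  apply SmoothOn.of_local
  intro a ha
  obtain ⟨α, hα⟩ := M.cover A (E.proj.app A a)
  refine ⟨(α, i), ⟨hα, ha⟩, _, fun q => ((join A _ _).symm q).2,
    E.total.isOpen_overlap (α, i) (α, i) A, ⟨a, ⟨⟨hα, ha⟩, ⟨hα, ha⟩⟩, rfl⟩, ?_, ?_, ?_⟩
  · rintro _ ⟨b, hb, rfl⟩
    exact ⟨b, ⟨hb.1, hb.1.2⟩, rfl⟩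
  · exact SuperSmoothOn.of_linear ((ContinuousLinearMap.snd ℝ _ _).comp
      (join A (M.model α) V).symm.toContinuousLinearMap)
      (fun a v => congrArg Prod.snd (join_symm_smul _ _ _ a v)) _
  · intro b _ _
    simp [total]

/-- A morphism into the total space is supersmooth if its projection to the base and its fibre
coordinates are. -/
lemma isSuperSmooth_total {f : ∀ A, X.pts.obj A → E.tot.obj A}
    (h1 : IsSuperSmooth (X := X) (Y := M) fun A x => E.proj.app A (f A x))
    (h2 : ∀ i A, X.SmoothOn (fun x => E.fib i A (f A x)) {x | E.proj.app A (f A x) ∈ E.base i A}) :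
    IsSuperSmooth (X := X) (Y := E.total) f := by
  intro A j
  have ho : X.IsOpenSet ({x | E.proj.app A (f A x) ∈ M.source j.1 A} ∩
      {x | E.proj.app A (f A x) ∈ E.base j.2 A}) := (h1 A j.1).1.inter (h2 j.2 A).1
  have h := ((h1 A j.1).mono ho Set.inter_subset_left).prodMk
    ((h2 j.2 A).mono ho Set.inter_subset_right)
  have h' := SmoothOn.comp (SuperSmoothOn.of_linear
    (join A (M.model j.1) V).toContinuousLinearMap
    (join_smul A _ _) Set.univ) isOpen_univ h fun _ _ => trivial
  exact h'

end Smoothness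

/-- The projection of a super vector bundle, as a supersmooth morphism. -/
def projHom (E : SuperVectorBundle M V) : Hom E.total M where
  toFun A a := E.proj.app A a
  naturality φ a := E.proj_map φ a
  smooth := E.isSuperSmooth_proj

/-- The sections of a super vector bundle: the supersmooth morphisms `σ : M → E` with
`π ∘ σ = id`. -/
def Section (E : SuperVectorBundle M V) : Type u :=
  {σ : Hom M E.total // ∀ A x, E.proj.app A (σ.toFun A x) = x}

/-- The pullback of a super vector bundle along a supersmooth morphism: for every Grassmann algebra,
the fibre product of the points. -/
def pullback {N : SuperManifold.{u}} (f : Hom N M) (E : SuperVectorBundle M V) :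
    SuperVectorBundle N V where
  tot :=
    { obj := fun A => {p : N.pts.obj A × E.tot.obj A // f.toFun A p.1 = E.proj.app A p.2}
      map := fun φ => ↾fun p => ⟨(N.pts.map φ p.1.1, E.tot.map φ p.1.2), by
        rw [f.naturality, p.2, E.proj_map]⟩ }
  proj := { app := fun A => ↾fun p => p.1.1 }
  add A p q h := ⟨(p.1.1, E.add A p.1.2 q.1.2 (by
    have h' : p.1.1 = q.1.1 := h
    rw [← p.2, ← q.2, h'])), by rw [E.proj_add]; exact p.2⟩
  smul A c p := ⟨(p.1.1, E.smul A c p.1.2), by rw [E.proj_smul]; exact p.2⟩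
  proj_add A p q h := rfl
  proj_smul A c p := rfl
  ι := E.ι
  base i A := f.toFun A ⁻¹' E.base i A
  fib i A p := E.fib i A p.1.2
  base_map i A B φ x hx := by
    rw [Set.mem_preimage, f.naturality]
    exact E.base_map i φ _ hx
  base_open i A := (f.smooth.smoothOn ((smoothOn_const (0 : Pt A V)).mono (E.base_open i A)
    (Set.subset_univ _))).1
  cover A x := E.cover A (f.toFun A x)
  fib_map i A B φ p hp := E.fib_map i φ p.1.2 (p.2 ▸ hp)
  fib_bij i A x hx := by
    refine ⟨fun _ _ => trivial, ?_, ?_⟩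
    · rintro ⟨⟨y, a⟩, hp⟩ rfl ⟨⟨z, b⟩, hq⟩ h hab
      change z = y at h
      subst h
      have := (E.fib_bij i A _ hx).injOn hp.symm hq.symm hab
      change a = b at this
      subst this
      rfl
    · intro v _
      obtain ⟨a, ha, hv⟩ := (E.fib_bij i A _ hx).surjOn (Set.mem_univ v)
      exact ⟨⟨(x, a), Eq.symm ha⟩, rfl, hv⟩
  fib_add i A p q h hp := E.fib_add i A p.1.2 q.1.2 _ (p.2 ▸ hp)
  fib_smul i A c p hp := E.fib_smul i A c p.1.2 (p.2 ▸ hp)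
  transition i j A α := by
    classical
    let P : Pt A (N.model α) × Pt A V → N.pts.obj A × E.tot.obj A → Prop := fun q p =>
      p.1 ∈ N.source α A ∧ f.toFun A p.1 ∈ E.base i A ∧ f.toFun A p.1 = E.proj.app A p.2 ∧
        N.coord α A p.1 = q.1 ∧ E.fib i A p.2 = q.2
    let g : Pt A (N.model α) × Pt A V → Pt A V := fun q =>
      if h : ∃ p, P q p then E.fib j A h.choose.2 else 0
    have hg : ∀ q p, P q p → g q = E.fib j A p.2 := by
      intro q p hp
      have h : ∃ p, P q p := ⟨p, hp⟩
      simp only [g, dif_pos h]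
      obtain ⟨h1, h2, h3, h4, h5⟩ := h.choose_spec
      obtain ⟨k1, k2, k3, k4, k5⟩ := hp
      have e1 := N.injOn α A h1 k1 (h4.trans k4.symm)
      have e2 := (E.fib_bij i A _ k2).injOn (h3.symm.trans (congrArg (f.toFun A) e1)) k3.symm
        (h5.trans k5.symm)
      rw [e2]
    have hbase : M.IsOpenSet (E.base i A ∩ E.base j A) := (E.base_open i A).inter (E.base_open j A)
    refine ⟨g, SuperSmoothOn.of_local ?_, fun p hp =>
      hg _ p.1 ⟨hp.1, hp.2.1, p.2, rfl, rfl⟩⟩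
    rintro ⟨_, v⟩ ⟨⟨x, hx, rfl⟩, -⟩
    obtain ⟨β, hβ⟩ := M.cover A (f.toFun A x)
    obtain ⟨t, ht, htx⟩ := (f.smooth A β).2 α
    obtain ⟨k, hk, hka⟩ := E.transition i j A β
    have hT : M.IsOpenSet (M.source β A ∩ (E.base i A ∩ E.base j A)) :=
      (isOpenSet_source β).inter hbase
    have hD := (f.smooth.smoothOn ((smoothOn_const (0 : Pt A V)).mono hT
      (Set.subset_univ _))).1 α
    have hD' := hD.prod (isOpen_univ (X := Pt A V))
    refine ⟨_, fun q => k (t q.1, q.2), hD', ⟨⟨x, ⟨hx.1, hβ, hx.2⟩, rfl⟩, trivial⟩, ?_, ?_⟩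
    · have h1 := (ht.mono (Set.image_mono fun y (hy : y ∈ N.source α A ∩ (f.toFun A ⁻¹'
        (M.source β A ∩ (E.base i A ∩ E.base j A)))) => ⟨hy.1, hy.2.1⟩)).comp
        (SuperSmoothOn.of_linear (ContinuousLinearMap.fst ℝ (Pt A (N.model α)) (Pt A V))
        (fun _ _ => rfl) _) hD' hD fun q hq => hq.1
      have h2 := h1.prodMk (SuperSmoothOn.of_linear
        (ContinuousLinearMap.snd ℝ (Pt A (N.model α)) (Pt A V)) (fun _ _ => rfl) _) hD'
      refine hk.comp h2 hD' ((hbase β).prod isOpen_univ) ?_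
      rintro ⟨_, w⟩ ⟨⟨y, hy, rfl⟩, -⟩
      exact ⟨⟨f.toFun A y, hy.2, (htx y ⟨hy.1, hy.2.1⟩).symm⟩, trivial⟩
    · rintro ⟨_, w⟩ ⟨⟨y, hy, rfl⟩, -⟩
      obtain ⟨a, ha, rfl⟩ := (E.fib_bij i A _ hy.2.2.1).surjOn (Set.mem_univ w)
      have ha' : E.proj.app A a = f.toFun A y := ha
      have h := hka a (ha' ▸ hy.2)
      have ht' : t (N.coord α A y) = M.coord β A (E.proj.app A a) := by
        rw [htx y ⟨hy.1, hy.2.1⟩, ha']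
      change g _ = k (t (N.coord α A y), E.fib i A a)
      rw [ht', h]
      exact hg _ (y, a) ⟨hy.1, hy.2.2.1, ha'.symm, rfl, rfl⟩

end SuperVectorBundle

/-! ### Modules over the line in the category of functors on Grassmann algebras -/

/-- The structure of a module over the ring object `Λ ↦ Λ_0` on the set-valued functor `F`. -/
structure RbarModule (F : Gr ⥤ Type u) : Type u where
  addCommGroup : ∀ A, AddCommGroup (F.obj A)
  module : ∀ A, Module A.Even (F.obj A)
  map_add : ∀ {A B : Gr} (φ : A ⟶ B) (x y : F.obj A), F.map φ (x + y) = F.map φ x + F.map φ y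
  map_smul : ∀ {A B : Gr} (φ : A ⟶ B) (a : A.Even) (x : F.obj A),
    F.map φ (a • x) = Gr.Hom.resEven φ a • F.map φ x

namespace RbarModule

/-- Isomorphism of modules over `Λ ↦ Λ_0`: a natural family of `Λ_0`-linear isomorphisms. -/
def IsIso {F : Gr ⥤ Type u} {G : Gr ⥤ Type v} (S : RbarModule F) (T : RbarModule G) : Prop :=
  letI := S.addCommGroup
  letI := S.module
  letI := T.addCommGroup
  letI := T.module
  ∃ e : ∀ A, F.obj A ≃ G.obj A,
    (∀ A x y, e A (x + y) = e A x + e A y) ∧ (∀ A (a : A.Even) x, e A (a • x) = a • e A x) ∧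
    ∀ (A B : Gr) (φ : A ⟶ B) (x : F.obj A), e B (F.map φ x) = G.map φ (e A x)

end RbarModule

/-- The functor `Λ ↦ (Λ ⊗ E)_0` of points of the real super vector space `E = E₀ ⊕ E₁`. -/
def barFunctor (E₀ E₁ : Type u) [AddCommGroup E₀] [Module ℝ E₀] [AddCommGroup E₁] [Module ℝ E₁] :
    Gr ⥤ Type u where
  obj A := Bar A E₀ E₁
  map φ := ↾fun x => Bar.map φ x
  map_id A := by
    ext x : 3
    exact Bar.map_id x
  map_comp φ ψ := by
    ext x : 3
    exact Bar.map_comp φ ψ x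

/-- The module structure of `Λ ↦ (Λ ⊗ E)_0`. -/
def barModule (E₀ E₁ : Type u) [AddCommGroup E₀] [Module ℝ E₀] [AddCommGroup E₁] [Module ℝ E₁] :
    RbarModule (barFunctor E₀ E₁) where
  addCommGroup A := inferInstanceAs (AddCommGroup (Bar A E₀ E₁))
  module A := inferInstanceAs (Module A.Even (Bar A E₀ E₁))
  map_add φ x y := LinearMap.map_add (Bar.map φ) x y
  map_smul φ a x := Bar.map_smul_even φ a x

/-- A module over `Λ ↦ Λ_0` is superrepresentable if it is isomorphic to `Λ ↦ (Λ ⊗ E)_0` for some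
real super vector space `E`. -/
def RbarModule.IsSuperrepresentable {F : Gr ⥤ Type u} (S : RbarModule F) : Prop :=
  ∃ (E₀ E₁ : Type u) (_ : AddCommGroup E₀) (_ : Module ℝ E₀) (_ : AddCommGroup E₁)
    (_ : Module ℝ E₁), S.IsIso (barModule E₀ E₁)

namespace SuperVectorBundle

open SuperManifold

variable {M : SuperManifold.{u}} {V : SBanach.{u}} (E : SuperVectorBundle M V)

/-! ### The functor of sections -/

/-- The pullback of the bundle to the product of a superpoint with `M`. -/
abbrev family (K : Gr) : SuperVectorBundle ((superpoint K).prod M) V :=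
  E.pullback (sndHom (superpoint K) M)

variable {E} in
/-- The value in `E` of a section of the pullback of `E` to `𝓟(Λ) × M`, at a point of
`𝓟(Λ) × M`. -/
def val {K : Gr} (σ : (E.family K).Section) (A : Gr) (p : K ⟶ A) (m : M.pts.obj A) : E.tot.obj A :=
  (σ.1.toFun A (p, m)).1.2

variable {E} in
lemma proj_val {K : Gr} (σ : (E.family K).Section) (A : Gr) (p : K ⟶ A) (m : M.pts.obj A) :
    E.proj.app A (val σ A p m) = m := by
  have h : (σ.1.toFun A (p, m)).1.1 = (p, m) := σ.2 A (p, m)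
  have h' : (σ.1.toFun A (p, m)).1.1.2 = E.proj.app A (val σ A p m) := (σ.1.toFun A (p, m)).2
  rw [← h', h]

variable {E} in
lemma section_ext {K : Gr} {σ τ : (E.family K).Section}
    (h : ∀ A p m, val σ A p m = val τ A p m) : σ = τ := by
  apply Subtype.ext
  have h' : σ.1.toFun = τ.1.toFun := by
    funext A x
    exact Subtype.ext (Prod.ext ((σ.2 A x).trans (τ.2 A x).symm) (h A x.1 x.2))
  cases hs : σ.1
  cases ht : τ.1
  rw [hs, ht] at h'
  subst h'
  rfl

/-- The section `σ ∘ (𝓟(φ) × id)`. -/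
def sectionMap {K L : Gr} (φ : K ⟶ L) (σ : (E.family K).Section) : (E.family L).Section :=
  ⟨{ toFun := fun A x => ⟨(x, val σ A (φ ≫ x.1) x.2), (proj_val σ A _ _).symm⟩
     naturality := fun {A B} ψ x => by
       have h := σ.1.naturality ψ (φ ≫ x.1, x.2)
       exact Subtype.ext (Prod.ext rfl (congrArg (fun y => y.1.2) h))
     smooth := (E.family L).isSuperSmooth_total (isSuperSmooth_id _) fun i A => by
       have h := (superpointMapProd φ M).smooth.smoothOn
         (σ.1.smooth.smoothOn ((E.family K).smoothOn_fib i A))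
       refine (congrArg (((superpoint L).prod M).SmoothOn _) ?_).mpr h
       ext x
       have h1 : (σ.1.toFun A (φ ≫ x.1, x.2)).1.1 = (φ ≫ x.1, x.2) := σ.2 A _
       change x.2 ∈ E.base i A ↔ (σ.1.toFun A (φ ≫ x.1, x.2)).1.1.2 ∈ E.base i A
       rw [h1] },
   fun _ _ => rfl⟩

lemma val_sectionMap {K L : Gr} (φ : K ⟶ L) (σ : (E.family K).Section) (A : Gr) (p : L ⟶ A)
    (m : M.pts.obj A) : val (E.sectionMap φ σ) A p m = val σ A (φ ≫ p) m := rfl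

/-- The functor that sends a Grassmann algebra `Λ` to the set of sections of the pullback of the
bundle to `𝓟(Λ) × M`, and a morphism `φ` to the composition with `𝓟(φ) × id`. -/
def gammaHat : Gr ⥤ Type u where
  obj K := (E.family K).Section
  map φ := ↾(E.sectionMap φ)
  map_id K := by
    ext σ
    exact section_ext fun A p m => by
      change val (E.sectionMap (𝟙 K) σ) A p m = val σ A p m
      rw [val_sectionMap, Category.id_comp]
  map_comp φ ψ := by
    ext σ
    exact section_ext fun A p m => by
      change val (E.sectionMap (φ ≫ ψ) σ) A p m = val (E.sectionMap ψ (E.sectionMap φ σ)) A p m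
      rw [val_sectionMap, val_sectionMap, val_sectionMap, Category.assoc]

/-- The module operations on the functor of sections are the pointwise ones: at a point `(p, m)` of
`𝓟(Λ) × M`, where `p` is a morphism of Grassmann algebras on `Λ`, the sum of two sections is the
sum of their values, and the product with `a ∈ Λ_0` is the product of the value with `p(a)`. -/
def IsPointwise (S : RbarModule E.gammaHat) : Prop :=
  letI := S.addCommGroup
  letI := S.module
  ∀ (K : Gr) (σ τ : E.gammaHat.obj K) (a : K.Even) (A : Gr) (p : K ⟶ A) (m : M.pts.obj A),
    val (σ + τ : E.gammaHat.obj K) A p m =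
      E.add A (val σ A p m) (val τ A p m) ((proj_val _ _ _ _).trans (proj_val _ _ _ _).symm) ∧
    val (a • σ : E.gammaHat.obj K) A p m = E.smul A (Gr.Hom.resEven p a) (val σ A p m)

/-- The vector space operations on the sections of a bundle are the pointwise ones. -/
def IsPointwiseSpace [AddCommGroup E.Section] [Module ℝ E.Section] : Prop :=
  ∀ (s t : E.Section) (r : ℝ) (A : Gr) (m : M.pts.obj A),
    (s + t).1.toFun A m = E.add A (s.1.toFun A m) (t.1.toFun A m) (by rw [s.2, t.2]) ∧
    (r • s).1.toFun A m = E.smul A (algebraMap ℝ A.Even r) (s.1.toFun A m)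

/-- `E'` is the bundle `ΠE`, the bundle `E` with reversed parity in the fibres: it has bundle charts
over the same open sets, and its changes of trivializations correspond to those of `E` by means of
multiplication by odd elements `c`.  That is, whether a point of `E` is `c` times a point of `E'` does
not depend on the trivialization. (For a fixed Grassmann algebra the multiplication by `c` is not
injective, but it is so on the points that come from a smaller Grassmann algebra, if `c` is a new
generator.  Thus the changes of trivializations of `E'` are determined by those of `E`.) -/
def IsParityReversal (E' : SuperVectorBundle M V.flip) : Prop :=
  ∃ ε : E.ι ≃ E'.ι, (∀ i A, E'.base (ε i) A = E.base i A) ∧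
    ∀ (i j : E.ι) (A : Gr) (a : E.tot.obj A) (b : E'.tot.obj A) (c : A.part 1),
      E.proj.app A a = E'.proj.app A b → E.proj.app A a ∈ E.base i A ∩ E.base j A →
      E.fib i A a = Bar.oddMul c (E'.fib (ε i) A b) →
      E.fib j A a = Bar.oddMul c (E'.fib (ε j) A b)

end SuperVectorBundle

end

end SuperGeom

/-!
Evaluate at the generic point. A section `σ` over `𝒫(K) × M` has a value at the point
`inl : K ⟶ K ⊗ A` of `𝒫(K)` and the image of `m ∈ M(A)` under `inr : A ⟶ K ⊗ A`; all other values
are images of these. In a trivialization this value lies in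
`(K ⊗ A ⊗ V)_0 = K_0 ⊗ (A ⊗ V)_0 ⊕ K_1 ⊗ (A ⊗ ΠV)_0`, so that linear forms on `K_0` and `K_1`
contract it to elements of `(A ⊗ V)_0` and `(A ⊗ ΠV)_0`. The changes of trivialization are natural
and `Λ_0`-linear, hence commute with contractions: the results are the coordinates of sections of
`E` and of `ΠE`, which are the coefficients of `σ` with respect to bases of `K_0` and `K_1`.

The bundle `ΠE` is built from the same decomposition for the Grassmann algebra `K` with one
generator `η`: its points over `m ∈ M(A)` are the points of `E(K ⊗ A)` over the image of `m` that
become zero for `η = 0`, which are the `η w` with `w ∈ (A ⊗ ΠV)_0`.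
-/

namespace SuperGeom

noncomputable section

namespace Gr

variable {K A B C : Gr}

@[simp] lemma coe_res (φ : A ⟶ B) (i : ZMod 2) (x : A.part i) :
    (Hom.res φ i x : B.Alg) = Hom.alg φ x := rfl

@[simp] lemma coe_mulPart (i j k : ZMod 2) (h : i + j = k) (a : A.part i) (x : A.part j) :
    (mulPart i j k h a x : A.Alg) = a * x := rfl

lemma alg_comp (φ : A ⟶ B) (ψ : B ⟶ C) : Hom.alg (φ ≫ ψ) = (Hom.alg ψ).comp (Hom.alg φ) := rfl

/-- The coproduct `K ⊗ A` of two Grassmann algebras in `Gr`. Its first `K.rank` generators come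
from `K`, the remaining ones from `A`. -/
def tens (K A : Gr) : Gr := ⟨K.rank + A.rank⟩

/-- The first coprojection of `tens K A`. -/
def inl (K A : Gr) : K ⟶ tens K A := homOfGen fun i => (tens K A).gen (Fin.castAdd A.rank i)

/-- The second coprojection of `tens K A`. -/
def inr (K A : Gr) : A ⟶ tens K A := homOfGen fun i => (tens K A).gen (Fin.natAdd K.rank i)

/-- The morphism out of the coproduct with given restrictions to the factors. -/
def desc (p : K ⟶ B) (q : A ⟶ B) : tens K A ⟶ B :=
  homOfGen (A := tens K A)
    (Fin.append (fun i => Hom.res p 1 (K.gen i)) fun i => Hom.res q 1 (A.gen i))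

lemma inl_desc (p : K ⟶ B) (q : A ⟶ B) : inl K A ≫ desc p q = p :=
  hom_ext fun i => by
    change Hom.res (desc p q) 1 (Hom.res (inl K A) 1 (K.gen i)) = _
    rw [inl, homOfGen_gen, desc]
    exact (homOfGen_gen _ _).trans (Fin.append_left _ _ i)

lemma inr_desc (p : K ⟶ B) (q : A ⟶ B) : inr K A ≫ desc p q = q :=
  hom_ext fun i => by
    change Hom.res (desc p q) 1 (Hom.res (inr K A) 1 (A.gen i)) = _
    rw [inr, homOfGen_gen, desc]
    exact (homOfGen_gen _ _).trans (Fin.append_right _ _ i)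

lemma tens_hom_ext {f g : tens K A ⟶ B} (h₁ : inl K A ≫ f = inl K A ≫ g)
    (h₂ : inr K A ≫ f = inr K A ≫ g) : f = g := by
  refine hom_ext (Fin.addCases (fun i => ?_) fun i => ?_)
  · simpa [inl, homOfGen_gen] using congrArg (fun q => Hom.res q 1 (K.gen i)) h₁
  · simpa [inr, homOfGen_gen] using congrArg (fun q => Hom.res q 1 (A.gen i)) h₂

lemma alg_desc_inl (p : K ⟶ B) (q : A ⟶ B) (k : K.Alg) :
    Hom.alg (desc p q) (Hom.alg (inl K A) k) = Hom.alg p k :=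
  congrArg (fun f => Hom.alg f k) (inl_desc p q)

lemma alg_desc_inr (p : K ⟶ B) (q : A ⟶ B) (a : A.Alg) :
    Hom.alg (desc p q) (Hom.alg (inr K A) a) = Hom.alg q a :=
  congrArg (fun f => Hom.alg f a) (inr_desc p q)

lemma desc_comp (p : K ⟶ B) (q : A ⟶ B) (φ : B ⟶ C) : desc p q ≫ φ = desc (p ≫ φ) (q ≫ φ) :=
  tens_hom_ext (by simp only [← Category.assoc, inl_desc])
    (by simp only [← Category.assoc, inr_desc])

/-- The morphism `id ⊗ φ` of coproducts. -/
def whiskerLeft (K : Gr) (φ : A ⟶ B) : tens K A ⟶ tens K B := desc (inl K B) (φ ≫ inr K B)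

lemma inr_whiskerLeft (φ : A ⟶ B) : inr K A ≫ whiskerLeft K φ = φ ≫ inr K B := inr_desc _ _

lemma whiskerLeft_desc (φ : A ⟶ B) (p : K ⟶ C) (q : B ⟶ C) :
    whiskerLeft K φ ≫ desc p q = desc p (φ ≫ q) := by
  rw [whiskerLeft, desc_comp, inl_desc, Category.assoc, inr_desc]

@[simp] lemma whiskerLeft_id : whiskerLeft K (𝟙 A) = 𝟙 (tens K A) :=
  tens_hom_ext (inl_desc _ _) (inr_desc _ _)

lemma whiskerLeft_comp (φ : A ⟶ B) (ψ : B ⟶ C) :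
    whiskerLeft K (φ ≫ ψ) = whiskerLeft K φ ≫ whiskerLeft K ψ := by
  rw [whiskerLeft, whiskerLeft, desc_comp, whiskerLeft, inl_desc, Category.assoc, Category.assoc,
    inr_desc]

lemma algHom_ext {R : Type*} [Semiring R] [Algebra ℝ R] {f g : A.Alg →ₐ[ℝ] R}
    (h : ∀ i, f (A.gen i) = g (A.gen i)) : f = g :=
  ExteriorAlgebra.hom_ext (LinearMap.pi_ext' fun i => LinearMap.ext_ring (h i))

/-- The isometry of zero quadratic forms `ℝ^m × ℝ^n ≃ ℝ^(m + n)`. -/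
def appendIsometry (m n : ℕ) :
    ((0 : QuadraticForm ℝ (Fin m → ℝ)).prod (0 : QuadraticForm ℝ (Fin n → ℝ))).IsometryEquiv
      (0 : QuadraticForm ℝ (Fin (m + n) → ℝ)) where
  __ := Fin.appendEquiv m n
  map_add' v w := by ext i; cases i using Fin.addCases <;> simp
  map_smul' r v := by ext i; cases i using Fin.addCases <;> simp
  map_app' _ := by simp

lemma appendIsometry_single_left {m : ℕ} (n : ℕ) (i : Fin m) :
    appendIsometry m n (Pi.single i 1, 0) = Pi.single (Fin.castAdd n i) 1 := by
  change Fin.append (Pi.single i 1) 0 = _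
  ext x
  cases x using Fin.addCases with
  | left x => simp [Pi.single_apply]
  | right x => simp [Fin.ext_iff, (i.isLt.trans_le (Nat.le_add_right m x)).ne']

lemma appendIsometry_single_right (m : ℕ) {n : ℕ} (i : Fin n) :
    appendIsometry m n (0, Pi.single i 1) = Pi.single (Fin.natAdd m i) 1 := by
  change Fin.append 0 (Pi.single i 1) = _
  ext x
  cases x using Fin.addCases with
  | left x => simp [Fin.ext_iff, (x.isLt.trans_le (Nat.le_add_right m i)).ne]
  | right x => simp [Pi.single_apply]

lemma alg_inl : Hom.alg (inl K A) =
    (CliffordAlgebra.map (appendIsometry K.rank A.rank).toIsometry).comp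
      (CliffordAlgebra.map (.inl 0 0)) :=
  algHom_ext fun i => by
    rw [← coe_res, inl, homOfGen_gen]
    change ExteriorAlgebra.ι ℝ _ =
      CliffordAlgebra.map _ (CliffordAlgebra.map _ (CliffordAlgebra.ι _ (Pi.single i 1)))
    rw [CliffordAlgebra.map_apply_ι]
    refine .trans ?_ (CliffordAlgebra.map_apply_ι _ _).symm
    exact congrArg _ (appendIsometry_single_left _ i).symm

lemma alg_inr : Hom.alg (inr K A) =
    (CliffordAlgebra.map (appendIsometry K.rank A.rank).toIsometry).comp
      (CliffordAlgebra.map (.inr 0 0)) :=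
  algHom_ext fun i => by
    rw [← coe_res, inr, homOfGen_gen]
    change ExteriorAlgebra.ι ℝ _ =
      CliffordAlgebra.map _ (CliffordAlgebra.map _ (CliffordAlgebra.ι _ (Pi.single i 1)))
    rw [CliffordAlgebra.map_apply_ι]
    refine .trans ?_ (CliffordAlgebra.map_apply_ι _ _).symm
    exact congrArg _ (appendIsometry_single_right _ i).symm

/-- The underlying linear isomorphism of `tens K A` with the tensor product of algebras: a Grassmann
algebra is the Clifford algebra of the zero form, so Mathlib's description of the Clifford algebra
of an orthogonal sum applies. -/
def tensEquiv (K A : Gr) : K.Alg ⊗[ℝ] A.Alg ≃ₗ[ℝ] (tens K A).Alg :=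
  (GradedTensorProduct.of ℝ K.part A.part).trans <|
    (CliffordAlgebra.prodEquiv 0 0).symm.toLinearEquiv.trans
      (CliffordAlgebra.equivOfIsometry (appendIsometry K.rank A.rank)).toLinearEquiv

lemma tensEquiv_tmul (k : K.Alg) (a : A.Alg) :
    tensEquiv K A (k ⊗ₜ a) = Hom.alg (inl K A) k * Hom.alg (inr K A) a := by
  rw [alg_inl, alg_inr]
  change CliffordAlgebra.map _ (CliffordAlgebra.toProd 0 0 (GradedTensorProduct.tmul ℝ k a)) = _
  rw [CliffordAlgebra.toProd, GradedTensorProduct.lift_tmul, map_mul]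
  rfl

/-- The projection of a Grassmann algebra to its part of parity `i`. -/
def proj (A : Gr) (i : ZMod 2) : A.Alg →ₗ[ℝ] A.part i :=
  (DirectSum.component ℝ (ZMod 2) (fun i => A.part i) i).comp
    (DirectSum.decomposeLinearEquiv A.part).toLinearMap

lemma proj_coe {i : ZMod 2} (x : A.part i) : A.proj i x = x :=
  Subtype.ext (DirectSum.decompose_of_mem_same A.part x.2)

lemma proj_coe_of_ne {i j : ZMod 2} (h : i ≠ j) (x : A.part i) : A.proj j x = 0 :=
  Subtype.ext (DirectSum.decompose_of_mem_ne A.part x.2 h)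

/-- The product `K_j × A_l → (K ⊗ A)_i` of homogeneous elements. -/
def tensMul (j l i : ZMod 2) (h : j + l = i) : K.part j →ₗ[ℝ] A.part l →ₗ[ℝ] (tens K A).part i :=
  LinearMap.mk₂ ℝ (fun k a => mulPart j l i h (Hom.res (inl K A) j k) (Hom.res (inr K A) l a))
    (fun _ _ _ => Subtype.ext (by simp [add_mul])) (fun _ _ _ => Subtype.ext (by simp))
    (fun _ _ _ => by simp) (fun _ _ _ => by simp)

lemma coe_tensMul {j l i : ZMod 2} (h : j + l = i) (k : K.part j) (a : A.part l) :
    (tensMul j l i h k a : (tens K A).Alg) = Hom.alg (inl K A) k * Hom.alg (inr K A) a := rfl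

lemma tensMul_eq_tensEquiv {j l i : ZMod 2} (h : j + l = i) (k : K.part j) (a : A.part l) :
    (tensMul j l i h k a : (tens K A).Alg) = tensEquiv K A (k ⊗ₜ a) :=
  (tensEquiv_tmul _ _).symm

lemma part_tens_hom_ext {i : ZMod 2} {W : Type*} [AddCommGroup W] [Module ℝ W]
    {f g : (tens K A).part i →ₗ[ℝ] W}
    (h : ∀ (j l : ZMod 2) (hi : j + l = i) (k : K.part j) (a : A.part l),
      f (tensMul j l i hi k a) = g (tensMul j l i hi k a)) : f = g := by
  suffices hp : (f.comp ((tens K A).proj i)).comp (tensEquiv K A).toLinearMap =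
      (g.comp ((tens K A).proj i)).comp (tensEquiv K A).toLinearMap by
    ext x
    obtain ⟨t, ht⟩ := (tensEquiv K A).surjective x
    simpa [ht, proj_coe] using congr($hp t)
  refine TensorProduct.ext (DirectSum.decompose_lhom_ext K.part fun j => LinearMap.ext fun k =>
    DirectSum.decompose_lhom_ext A.part fun l => LinearMap.ext fun a => ?_)
  change f ((tens K A).proj i (tensEquiv K A (k ⊗ₜ a))) =
    g ((tens K A).proj i (tensEquiv K A (k ⊗ₜ a)))
  rw [← tensMul_eq_tensEquiv rfl]
  obtain rfl | hi := eq_or_ne (j + l) i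
  · rw [proj_coe, h]
  · rw [proj_coe_of_ne hi, map_zero, map_zero]

/-- The contraction `(K ⊗ A)_i → A_l` with a functional on `K_j`, extended by zero to the other
parity. Only `i = j + l` is of interest; the map is zero otherwise. -/
def contract {j : ZMod 2} (f : K.part j →ₗ[ℝ] ℝ) (i l : ZMod 2) :
    (tens K A).part i →ₗ[ℝ] A.part l :=
  (A.proj l).comp <| (TensorProduct.lid ℝ A.Alg).toLinearMap.comp <|
    (LinearMap.rTensor A.Alg (f.comp (K.proj j))).comp <|
      (tensEquiv K A).symm.toLinearMap.comp (Submodule.subtype _)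

lemma contract_tensMul {j j' l l' i : ZMod 2} (f : K.part j →ₗ[ℝ] ℝ) (h : j' + l' = i)
    (k : K.part j') (a : A.part l') :
    contract f i l (tensMul j' l' i h k a) = f (K.proj j k) • A.proj l a := by
  change A.proj l (TensorProduct.lid ℝ A.Alg (LinearMap.rTensor A.Alg (f.comp (K.proj j))
    ((tensEquiv K A).symm (tensMul j' l' i h k a : (tens K A).Alg)))) = _
  rw [tensMul_eq_tensEquiv, LinearEquiv.symm_apply_apply, LinearMap.rTensor_tmul,
    TensorProduct.lid_tmul, map_smul, LinearMap.comp_apply]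

lemma contract_comp_tensMul {j l i : ZMod 2} (f : K.part j →ₗ[ℝ] ℝ) (h : j + l = i)
    (k : K.part j) : (contract (A := A) f i l).comp (tensMul j l i h k) = f k • LinearMap.id :=
  LinearMap.ext fun a => by simp [contract_tensMul, proj_coe]

lemma contract_comp_tensMul_of_ne {j j' l l' i : ZMod 2} (f : K.part j →ₗ[ℝ] ℝ)
    (h : j' + l' = i) (hj : j' ≠ j) (k : K.part j') :
    (contract (A := A) f i l).comp (tensMul j' l' i h k) = 0 :=
  LinearMap.ext fun a => by simp [contract_tensMul, proj_coe_of_ne hj]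

lemma proj_alg (φ : A ⟶ B) (i : ZMod 2) (x : A.Alg) :
    B.proj i (Hom.alg φ x) = Hom.res φ i (A.proj i x) := by
  suffices h : (B.proj i).comp (Hom.alg φ).toLinearMap = (Hom.res φ i).comp (A.proj i) from
    congr($h x)
  refine DirectSum.decompose_lhom_ext A.part fun j => LinearMap.ext fun x => ?_
  change B.proj i (Hom.res φ j x) = Hom.res φ i (A.proj i x)
  obtain rfl | hj := eq_or_ne j i
  · rw [proj_coe, proj_coe]
  · rw [proj_coe_of_ne hj, proj_coe_of_ne hj, map_zero]

lemma proj_mulPart_zero (c : A.part 0) (l l' : ZMod 2) (a : A.part l') :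
    A.proj l (mulPart 0 l' l' (zero_add l') c a) = mulPart 0 l l (zero_add l) c (A.proj l a) := by
  obtain rfl | hl := eq_or_ne l' l
  · rw [proj_coe, proj_coe]
  · rw [proj_coe_of_ne hl, proj_coe_of_ne hl, map_zero]

lemma contract_comp_res_whiskerLeft {j : ZMod 2} (f : K.part j →ₗ[ℝ] ℝ) (i l : ZMod 2)
    (φ : A ⟶ B) :
    (contract f i l).comp (Hom.res (whiskerLeft K φ) i) = (Hom.res φ l).comp (contract f i l) := by
  refine part_tens_hom_ext fun j' l' hi k a => ?_
  have h : Hom.res (whiskerLeft K φ) i (tensMul j' l' i hi k a) =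
      tensMul j' l' i hi k (Hom.res φ l' a) := Subtype.ext <| by
    simp [coe_tensMul, whiskerLeft, alg_desc_inl, alg_desc_inr, alg_comp]
  rw [LinearMap.comp_apply, LinearMap.comp_apply, h, contract_tensMul, contract_tensMul, map_smul,
    coe_res, proj_alg]

lemma contract_comp_mulPart_inr {j : ZMod 2} (f : K.part j →ₗ[ℝ] ℝ) (i l : ZMod 2)
    (c : A.part 0) :
    (contract f i l).comp (mulPart 0 i i (zero_add i) (Hom.res (inr K A) 0 c)) =
      (mulPart 0 l l (zero_add l) c).comp (contract f i l) := by
  refine part_tens_hom_ext fun j' l' hi k a => ?_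
  have h : mulPart 0 i i (zero_add i) (Hom.res (inr K A) 0 c) (tensMul j' l' i hi k a) =
      tensMul j' l' i hi k (mulPart 0 l' l' (zero_add l') c a) := Subtype.ext <| by
    simp only [coe_mulPart, coe_tensMul, coe_res, map_mul, ← mul_assoc,
      mul_even _ _ (Hom.parity (inr K A) 0 _ c.2)]
  rw [LinearMap.comp_apply, LinearMap.comp_apply, h, contract_tensMul, contract_tensMul, map_smul,
    proj_mulPart_zero]

lemma sum_tensMul_contract_tensMul {ι : Type*} [Fintype ι] {j l i : ZMod 2}
    (b : Module.Basis ι ℝ (K.part j)) (h : j + l = i) (k : K.part j) (a : A.part l) :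
    ∑ n, tensMul j l i h (b n) (contract (b.coord n) i l (tensMul j l i h k a)) =
      tensMul j l i h k a := by
  conv_rhs => rw [← b.sum_repr k]
  simp only [contract_tensMul, proj_coe, map_smul, map_sum, LinearMap.sum_apply,
    LinearMap.smul_apply, Module.Basis.coord_apply]

lemma sum_tensMul_contract_tensMul_of_ne {ι : Type*} [Fintype ι] {j l j' l' i : ZMod 2}
    (b : Module.Basis ι ℝ (K.part j)) (h : j + l = i) (h' : j' + l' = i) (hj : j' ≠ j)
    (k : K.part j') (a : A.part l') :
    ∑ n, tensMul j l i h (b n) (contract (b.coord n) i l (tensMul j' l' i h' k a)) = 0 := by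
  simp [contract_tensMul, proj_coe_of_ne hj]

lemma sum_tensMul_comp_contract {ι₀ ι₁ : Type*} [Fintype ι₀] [Fintype ι₁]
    (b₀ : Module.Basis ι₀ ℝ (K.part 0)) (b₁ : Module.Basis ι₁ ℝ (K.part 1)) {i l : ZMod 2}
    (h : 1 + l = i) :
    ∑ n, (tensMul 0 i i (zero_add i) (b₀ n)).comp (contract (A := A) (b₀.coord n) i i) +
      ∑ n, (tensMul 1 l i h (b₁ n)).comp (contract (b₁.coord n) i l) = LinearMap.id := by
  refine part_tens_hom_ext fun j' l' hi k a => ?_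
  simp only [LinearMap.add_apply, LinearMap.sum_apply, LinearMap.comp_apply, LinearMap.id_apply]
  obtain rfl | rfl := (by decide : ∀ j : ZMod 2, j = 0 ∨ j = 1) j'
  · obtain rfl : l' = i := by rw [← hi, zero_add]
    rw [sum_tensMul_contract_tensMul, sum_tensMul_contract_tensMul_of_ne _ _ _ (by decide),
      add_zero]
  · obtain rfl : l' = l := add_left_cancel (hi.trans h.symm)
    rw [sum_tensMul_contract_tensMul, sum_tensMul_contract_tensMul_of_ne _ _ _ (by decide),
      zero_add]

/-- The identification of the part of parity `0` with the even subalgebra. -/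
def toEven : A.part 0 →ₗ[ℝ] A.Even := LinearMap.id

lemma resEven_toEven (φ : A ⟶ B) (a : A.part 0) :
    Hom.resEven φ (toEven a) = toEven (Hom.res φ 0 a) := rfl

lemma res_comp_mulPart (φ : A ⟶ B) (i j k : ZMod 2) (h : i + j = k) (a : A.part i) :
    (Hom.res φ k).comp (mulPart i j k h a) =
      (mulPart i j k h (Hom.res φ i a)).comp (Hom.res φ j) :=
  LinearMap.ext fun _ => Subtype.ext (map_mul (Hom.alg φ) _ _)

lemma mulPart_comp_mulPart_zero (i j k : ZMod 2) (h : i + j = k) (a : A.part i) (c : A.part 0) :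
    (mulPart i j k h a).comp (mulPart 0 j j (zero_add j) c) =
      (mulPart 0 k k (zero_add k) c).comp (mulPart i j k h a) :=
  LinearMap.ext fun x => Subtype.ext <| by
    simp only [LinearMap.comp_apply, coe_mulPart, ← mul_assoc, mul_even _ _ c.2]

lemma mulPart_even_smul (i j k : ZMod 2) (h : i + j = k) (c : A.Even) (a : A.part i) :
    mulPart i j k h (c • a) = (mulPart 0 k k (zero_add k) ⟨c, c.2⟩).comp (mulPart i j k h a) :=
  LinearMap.ext fun _ => Subtype.ext (mul_assoc _ _ _)

lemma mulPart_add (i j k : ZMod 2) (h : i + j = k) (a b : A.part i) :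
    mulPart i j k h (a + b) = mulPart i j k h a + mulPart i j k h b :=
  LinearMap.ext fun _ => Subtype.ext (add_mul _ _ _)

lemma mulPart_smul (i j k : ZMod 2) (h : i + j = k) (r : ℝ) (a : A.part i) :
    mulPart i j k h (r • a) = r • mulPart i j k h a :=
  LinearMap.ext fun _ => Subtype.ext (smul_mul_assoc _ _ _)

instance (i : ZMod 2) : IsScalarTower ℝ A.Even (A.part i) :=
  ⟨fun r c x => Subtype.ext (smul_mul_assoc r (c : A.Alg) (x : A.Alg))⟩

end Gr

namespace GTensor

variable {A B C : Gr} {i j k : ZMod 2} {V : Type u} [AddCommGroup V] [Module ℝ V]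

instance : IsScalarTower ℝ A.Even (GTensor A i V) :=
  inferInstanceAs (IsScalarTower ℝ A.Even (A.part i ⊗[ℝ] V))

lemma even_smul_eq_lmap (a : A.Even) (x : GTensor A i V) :
    a • x = lmap (Gr.mulPart 0 i i (zero_add i) ⟨a, a.2⟩) LinearMap.id x := by
  induction x using GTensor.induction with
  | h0 => simp
  | ht p v => rfl
  | ha x y hx hy => rw [smul_add, map_add, hx, hy]

lemma lmap_add_left (L L' : A.part i →ₗ[ℝ] B.part j) :
    lmap (L + L') (LinearMap.id : V →ₗ[ℝ] V) = lmap L LinearMap.id + lmap L' LinearMap.id :=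
  TensorProduct.map_add_left _ _ _

lemma lmap_smul_left (r : ℝ) (L : A.part i →ₗ[ℝ] B.part j) :
    lmap (r • L) (LinearMap.id : V →ₗ[ℝ] V) = r • lmap L LinearMap.id :=
  TensorProduct.map_smul_left _ _ _

lemma lmap_id_comp_lmap_id (M : B.part j →ₗ[ℝ] C.part k) (L : A.part i →ₗ[ℝ] B.part j) :
    (lmap M (LinearMap.id : V →ₗ[ℝ] V)).comp (lmap L LinearMap.id) = lmap (M.comp L) LinearMap.id :=
  LinearMap.ext fun x => by rw [LinearMap.comp_apply, lmap_lmap, LinearMap.id_comp]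

end GTensor

namespace Bar

variable {K A B C : Gr} {V₀ V₁ : Type u}

section Algebraic

variable [AddCommGroup V₀] [Module ℝ V₀] [AddCommGroup V₁] [Module ℝ V₁]

variable (V₀ V₁) in
/-- The map of points induced by a parity-preserving linear map `A → B`, given by its restrictions
to the homogeneous parts. -/
def evenMap : (A.part 0 →ₗ[ℝ] B.part 0) × (A.part 1 →ₗ[ℝ] B.part 1) →ₗ[ℝ]
    Bar A V₀ V₁ →ₗ[ℝ] Bar B V₀ V₁ where
  toFun L := (GTensor.lmap L.1 LinearMap.id).prodMap (GTensor.lmap L.2 LinearMap.id)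
  map_add' L M := by
    simp only [Prod.fst_add, Prod.snd_add, GTensor.lmap_add_left, LinearMap.prodMap_add]
  map_smul' r L := by
    simp only [Prod.smul_fst, Prod.smul_snd, GTensor.lmap_smul_left, LinearMap.prodMap_smul,
      RingHom.id_apply]

variable (V₀ V₁) in
/-- The map of points induced by a parity-reversing linear map `A → B`, given by its restrictions
to the homogeneous parts. The coefficients change parity as well. -/
def oddMap : (A.part 1 →ₗ[ℝ] B.part 0) × (A.part 0 →ₗ[ℝ] B.part 1) →ₗ[ℝ]
    Bar A V₁ V₀ →ₗ[ℝ] Bar B V₀ V₁ where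
  toFun L := ((GTensor.lmap L.1 LinearMap.id).comp (LinearMap.snd ℝ _ _)).prod
    ((GTensor.lmap L.2 LinearMap.id).comp (LinearMap.fst ℝ _ _))
  map_add' L M := by
    simp only [Prod.fst_add, Prod.snd_add, GTensor.lmap_add_left, LinearMap.add_comp]
    rfl
  map_smul' r L := by
    simp only [Prod.smul_fst, Prod.smul_snd, GTensor.lmap_smul_left, LinearMap.smul_comp]
    rfl

lemma evenMap_evenMap (M : (B.part 0 →ₗ[ℝ] C.part 0) × (B.part 1 →ₗ[ℝ] C.part 1))
    (L : (A.part 0 →ₗ[ℝ] B.part 0) × (A.part 1 →ₗ[ℝ] B.part 1)) (x : Bar A V₀ V₁) :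
    evenMap V₀ V₁ M (evenMap V₀ V₁ L x) = evenMap V₀ V₁ (M.1.comp L.1, M.2.comp L.2) x :=
  Prod.ext congr($(GTensor.lmap_id_comp_lmap_id M.1 L.1) x.1)
    congr($(GTensor.lmap_id_comp_lmap_id M.2 L.2) x.2)

lemma evenMap_oddMap (M : (B.part 0 →ₗ[ℝ] C.part 0) × (B.part 1 →ₗ[ℝ] C.part 1))
    (L : (A.part 1 →ₗ[ℝ] B.part 0) × (A.part 0 →ₗ[ℝ] B.part 1)) (x : Bar A V₁ V₀) :
    evenMap V₀ V₁ M (oddMap V₀ V₁ L x) = oddMap V₀ V₁ (M.1.comp L.1, M.2.comp L.2) x :=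
  Prod.ext congr($(GTensor.lmap_id_comp_lmap_id M.1 L.1) x.2)
    congr($(GTensor.lmap_id_comp_lmap_id M.2 L.2) x.1)

lemma oddMap_evenMap (M : (B.part 1 →ₗ[ℝ] C.part 0) × (B.part 0 →ₗ[ℝ] C.part 1))
    (L : (A.part 0 →ₗ[ℝ] B.part 0) × (A.part 1 →ₗ[ℝ] B.part 1)) (x : Bar A V₁ V₀) :
    oddMap V₀ V₁ M (evenMap V₁ V₀ L x) = oddMap V₀ V₁ (M.1.comp L.2, M.2.comp L.1) x :=
  Prod.ext congr($(GTensor.lmap_id_comp_lmap_id M.1 L.2) x.2)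
    congr($(GTensor.lmap_id_comp_lmap_id M.2 L.1) x.1)

lemma oddMap_oddMap (M : (B.part 1 →ₗ[ℝ] C.part 0) × (B.part 0 →ₗ[ℝ] C.part 1))
    (L : (A.part 1 →ₗ[ℝ] B.part 0) × (A.part 0 →ₗ[ℝ] B.part 1)) (x : Bar A V₀ V₁) :
    oddMap V₀ V₁ M (oddMap V₁ V₀ L x) = evenMap V₀ V₁ (M.1.comp L.2, M.2.comp L.1) x :=
  Prod.ext congr($(GTensor.lmap_id_comp_lmap_id M.1 L.2) x.1)
    congr($(GTensor.lmap_id_comp_lmap_id M.2 L.1) x.2)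

lemma evenMap_id (x : Bar A V₀ V₁) : evenMap V₀ V₁ (LinearMap.id, LinearMap.id) x = x :=
  Prod.ext (GTensor.lmap_id _) (GTensor.lmap_id _)

lemma map_eq_evenMap (φ : A ⟶ B) (x : Bar A V₀ V₁) :
    map φ x = evenMap V₀ V₁ (Gr.Hom.res φ 0, Gr.Hom.res φ 1) x := rfl

lemma even_smul_eq_evenMap (c : A.Even) (x : Bar A V₀ V₁) :
    c • x = evenMap V₀ V₁ (Gr.mulPart 0 0 0 (zero_add 0) ⟨c, c.2⟩,
      Gr.mulPart 0 1 1 (zero_add 1) ⟨c, c.2⟩) x :=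
  Prod.ext (GTensor.even_smul_eq_lmap _ _) (GTensor.even_smul_eq_lmap _ _)

lemma oddMul_eq_oddMap (a : A.part 1) (x : Bar A V₁ V₀) :
    oddMul a x = oddMap V₀ V₁ (Gr.mulPart 1 1 0 (by decide) a, Gr.mulPart 1 0 1 (by decide) a) x :=
  rfl

lemma map_oddMul (φ : A ⟶ B) (a : A.part 1) (x : Bar A V₁ V₀) :
    map φ (oddMul a x) = oddMul (Gr.Hom.res φ 1 a) (map φ x) := by
  simp only [map_eq_evenMap, oddMul_eq_oddMap, evenMap_oddMap, oddMap_evenMap, Gr.res_comp_mulPart]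

lemma oddMul_add_left (a b : A.part 1) (x : Bar A V₁ V₀) :
    oddMul (a + b) x = oddMul a x + oddMul b x := by
  simp only [oddMul_eq_oddMap, Gr.mulPart_add, ← Prod.mk_add_mk, map_add, LinearMap.add_apply]

lemma oddMul_smul_left (r : ℝ) (a : A.part 1) (x : Bar A V₁ V₀) :
    oddMul (r • a) x = r • oddMul a x := by
  simp only [oddMul_eq_oddMap, Gr.mulPart_smul, ← Prod.smul_mk, map_smul, LinearMap.smul_apply]

lemma oddMul_zero_left (x : Bar A V₁ V₀) : oddMul (0 : A.part 1) x = 0 := by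
  simpa only [zero_smul] using oddMul_smul_left (0 : ℝ) (0 : A.part 1) x

lemma oddMul_even_smul_left (c : A.Even) (a : A.part 1) (x : Bar A V₁ V₀) :
    oddMul (c • a) x = c • oddMul a x := by
  simp only [even_smul_eq_evenMap, oddMul_eq_oddMap, evenMap_oddMap, Gr.mulPart_even_smul]

lemma oddMul_even_smul (c : A.Even) (a : A.part 1) (x : Bar A V₁ V₀) :
    oddMul a (c • x) = c • oddMul a x := by
  simp only [even_smul_eq_evenMap, oddMul_eq_oddMap, evenMap_oddMap, oddMap_evenMap,
    Gr.mulPart_comp_mulPart_zero]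

/-- Contraction of the coefficients in `K` with an even functional. -/
def contractEven (f : K.part 0 →ₗ[ℝ] ℝ) : Bar (Gr.tens K A) V₀ V₁ →ₗ[ℝ] Bar A V₀ V₁ :=
  evenMap V₀ V₁ (Gr.contract f 0 0, Gr.contract f 1 1)

/-- Contraction of the coefficients in `K` with an odd functional. -/
def contractOdd (f : K.part 1 →ₗ[ℝ] ℝ) : Bar (Gr.tens K A) V₀ V₁ →ₗ[ℝ] Bar A V₁ V₀ :=
  oddMap V₁ V₀ (Gr.contract f 1 0, Gr.contract f 0 1)

lemma contractEven_map (f : K.part 0 →ₗ[ℝ] ℝ) (φ : A ⟶ B) (x : Bar (Gr.tens K A) V₀ V₁) :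
    contractEven f (map (Gr.whiskerLeft K φ) x) = map φ (contractEven f x) := by
  simp only [contractEven, map_eq_evenMap, evenMap_evenMap, Gr.contract_comp_res_whiskerLeft]

lemma contractOdd_map (f : K.part 1 →ₗ[ℝ] ℝ) (φ : A ⟶ B) (x : Bar (Gr.tens K A) V₀ V₁) :
    contractOdd f (map (Gr.whiskerLeft K φ) x) = map φ (contractOdd f x) := by
  simp only [contractOdd, map_eq_evenMap, evenMap_oddMap, oddMap_evenMap,
    Gr.contract_comp_res_whiskerLeft]

lemma contractEven_smul (f : K.part 0 →ₗ[ℝ] ℝ) (c : A.Even) (x : Bar (Gr.tens K A) V₀ V₁) :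
    contractEven f (Gr.Hom.resEven (Gr.inr K A) c • x) = c • contractEven f x := by
  have h (i : ZMod 2) := Gr.contract_comp_mulPart_inr f i i (⟨c, c.2⟩ : A.part 0)
  rw [contractEven, even_smul_eq_evenMap, even_smul_eq_evenMap, evenMap_evenMap, evenMap_evenMap]
  exact congr(evenMap V₀ V₁ ($(h 0), $(h 1)) x)

lemma contractOdd_smul (f : K.part 1 →ₗ[ℝ] ℝ) (c : A.Even) (x : Bar (Gr.tens K A) V₀ V₁) :
    contractOdd f (Gr.Hom.resEven (Gr.inr K A) c • x) = c • contractOdd f x := by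
  have h (i l : ZMod 2) := Gr.contract_comp_mulPart_inr f i l (⟨c, c.2⟩ : A.part 0)
  rw [contractOdd, even_smul_eq_evenMap, even_smul_eq_evenMap, oddMap_evenMap, evenMap_oddMap]
  exact congr(oddMap V₁ V₀ ($(h 1 0), $(h 0 1)) x)

/-- The product of an even element of `K` and a point over `A`. -/
def tensEvenMul (k : K.part 0) : Bar A V₀ V₁ →ₗ[ℝ] Bar (Gr.tens K A) V₀ V₁ :=
  evenMap V₀ V₁ (Gr.tensMul 0 0 0 (by decide) k, Gr.tensMul 0 1 1 (by decide) k)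

/-- The product of an odd element of `K` and a point over `A`. -/
def tensOddMul (k : K.part 1) : Bar A V₁ V₀ →ₗ[ℝ] Bar (Gr.tens K A) V₀ V₁ :=
  oddMap V₀ V₁ (Gr.tensMul 1 1 0 (by decide) k, Gr.tensMul 1 0 1 (by decide) k)

lemma tensEvenMul_eq_smul (k : K.part 0) (x : Bar A V₀ V₁) :
    tensEvenMul k x = Gr.toEven (Gr.Hom.res (Gr.inl K A) 0 k) • map (Gr.inr K A) x := by
  rw [even_smul_eq_evenMap, map_eq_evenMap, evenMap_evenMap]
  rfl

lemma tensOddMul_eq_oddMul (k : K.part 1) (x : Bar A V₁ V₀) :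
    tensOddMul k x = oddMul (Gr.Hom.res (Gr.inl K A) 1 k) (map (Gr.inr K A) x) := by
  rw [oddMul_eq_oddMap, map_eq_evenMap, oddMap_evenMap]
  rfl

lemma contractEven_tensEvenMul (f : K.part 0 →ₗ[ℝ] ℝ) (k : K.part 0) (x : Bar A V₀ V₁) :
    contractEven f (tensEvenMul k x) = f k • x := by
  simp only [contractEven, tensEvenMul, evenMap_evenMap, Gr.contract_comp_tensMul, ← Prod.smul_mk,
    map_smul, LinearMap.smul_apply, evenMap_id]

lemma contractEven_tensOddMul (f : K.part 0 →ₗ[ℝ] ℝ) (k : K.part 1) (x : Bar A V₁ V₀) :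
    contractEven f (tensOddMul k x) = 0 := by
  simp only [contractEven, tensOddMul, evenMap_oddMap,
    Gr.contract_comp_tensMul_of_ne f _ one_ne_zero, Prod.mk_zero_zero, map_zero,
    LinearMap.zero_apply]

lemma contractOdd_tensEvenMul (f : K.part 1 →ₗ[ℝ] ℝ) (k : K.part 0) (x : Bar A V₀ V₁) :
    contractOdd f (tensEvenMul k x) = 0 := by
  simp only [contractOdd, tensEvenMul, oddMap_evenMap,
    Gr.contract_comp_tensMul_of_ne f _ zero_ne_one, Prod.mk_zero_zero, map_zero,
    LinearMap.zero_apply]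

lemma contractOdd_tensOddMul (f : K.part 1 →ₗ[ℝ] ℝ) (k : K.part 1) (x : Bar A V₁ V₀) :
    contractOdd f (tensOddMul k x) = f k • x := by
  simp only [contractOdd, tensOddMul, oddMap_oddMap, Gr.contract_comp_tensMul, ← Prod.smul_mk,
    map_smul, LinearMap.smul_apply, evenMap_id]

lemma sum_tensMul_contract {ι₀ ι₁ : Type*} [Fintype ι₀] [Fintype ι₁]
    (b₀ : Module.Basis ι₀ ℝ (K.part 0)) (b₁ : Module.Basis ι₁ ℝ (K.part 1))
    (x : Bar (Gr.tens K A) V₀ V₁) :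
    ∑ n, tensEvenMul (b₀ n) (contractEven (b₀.coord n) x) +
      ∑ n, tensOddMul (b₁ n) (contractOdd (b₁.coord n) x) = x := by
  simp only [tensEvenMul, contractEven, tensOddMul, contractOdd, evenMap_evenMap, oddMap_oddMap,
    ← LinearMap.sum_apply, ← map_sum, ← LinearMap.add_apply, ← map_add]
  refine .trans ?_ (evenMap_id x)
  refine congrArg (evenMap V₀ V₁ · x) (Prod.ext ?_ ?_)
  · simpa only [Prod.fst_add, Prod.fst_sum] using Gr.sum_tensMul_comp_contract b₀ b₁ (by decide)
  · simpa only [Prod.snd_add, Prod.snd_sum] using Gr.sum_tensMul_comp_contract b₀ b₁ (by decide)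

lemma map_desc_tensEvenMul (p : K ⟶ B) (q : A ⟶ B) (k : K.part 0) (x : Bar A V₀ V₁) :
    map (Gr.desc p q) (tensEvenMul k x) = Gr.toEven (Gr.Hom.res p 0 k) • map q x := by
  rw [tensEvenMul_eq_smul, map_smul_even, ← map_comp, Gr.inr_desc, Gr.resEven_toEven]
  exact congr(Gr.toEven $(Subtype.ext (Gr.alg_desc_inl p q k)) • map q x)

lemma map_desc_tensOddMul (p : K ⟶ B) (q : A ⟶ B) (k : K.part 1) (x : Bar A V₁ V₀) :
    map (Gr.desc p q) (tensOddMul k x) = oddMul (Gr.Hom.res p 1 k) (map q x) := by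
  rw [tensOddMul_eq_oddMul, map_oddMul, ← map_comp, Gr.inr_desc]
  exact congr(oddMul $(Subtype.ext (Gr.alg_desc_inl p q k)) (map q x))

end Algebraic

section Normed

variable [NormedAddCommGroup V₀] [NormedSpace ℝ V₀] [NormedAddCommGroup V₁] [NormedSpace ℝ V₁]

lemma continuous_evenMap (L : (A.part 0 →ₗ[ℝ] B.part 0) × (A.part 1 →ₗ[ℝ] B.part 1)) :
    Continuous (evenMap V₀ V₁ L) :=
  (GTensor.continuous_lmap L.1 (.id ℝ V₀)).prodMap (GTensor.continuous_lmap L.2 (.id ℝ V₁))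

lemma continuous_oddMap (L : (A.part 1 →ₗ[ℝ] B.part 0) × (A.part 0 →ₗ[ℝ] B.part 1)) :
    Continuous (oddMap V₀ V₁ L) :=
  ((GTensor.continuous_lmap L.1 (.id ℝ V₀)).comp continuous_snd).prodMk
    ((GTensor.continuous_lmap L.2 (.id ℝ V₁)).comp continuous_fst)

lemma continuous_map (φ : A ⟶ B) : Continuous (map φ : Bar A V₀ V₁ → Bar B V₀ V₁) :=
  continuous_evenMap (Gr.Hom.res φ 0, Gr.Hom.res φ 1)

lemma continuous_even_smul (c : A.Even) : Continuous fun x : Bar A V₀ V₁ => c • x :=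
  (continuous_evenMap _).congr fun x => (even_smul_eq_evenMap c x).symm

lemma continuous_oddMul (a : A.part 1) : Continuous (oddMul a : Bar A V₁ V₀ → Bar A V₀ V₁) :=
  continuous_oddMap (Gr.mulPart 1 1 0 (by decide) a, Gr.mulPart 1 0 1 (by decide) a)

end Normed

end Bar

section SuperSmooth

variable {A : Gr} {X Y : Type*} [NormedAddCommGroup X] [NormedSpace ℝ X] [Module A.Even X]
  [NormedAddCommGroup Y] [NormedSpace ℝ Y] [Module A.Even Y]

lemma superSmoothOn_bilinear {Z : Type*} [FiniteDimensional ℝ X]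
    [NormedAddCommGroup Z] [NormedSpace ℝ Z] [Module A.Even Z]
    (L : X →ₗ[ℝ] Y →ₗ[ℝ] Z) (hL : ∀ x, Continuous (L x))
    (h₁ : ∀ (a : A.Even) x y, L (a • x) y = a • L x y)
    (h₂ : ∀ (a : A.Even) x y, L x (a • y) = a • L x y) (D : Set (X × Y)) :
    SuperSmoothOn A (fun p : X × Y => L p.1 p.2) D := by
  let L' : X →ₗ[ℝ] Y →L[ℝ] Z :=
    { toFun := fun x => ⟨L x, hL x⟩
      map_add' := fun x y => by ext; simp
      map_smul' := fun r x => by ext; simp }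
  have hb := (LinearMap.toContinuousLinearMap L').isBoundedBilinearMap
  refine ⟨hb.contDiff.contDiffOn, fun x _ a v => ?_⟩
  have hd : fderiv ℝ (fun p : X × Y => L p.1 p.2) x = _ := hb.fderiv x
  rw [hd]
  change L x.1 (a • v.2) + L (a • v.1) x.2 = a • (L x.1 v.2 + L v.1 x.2)
  rw [h₁, h₂, smul_add]

lemma SuperSmoothOn.baseChange {G : Gr} (ψ : A ⟶ G) {X' Y' : Type*}
    [NormedAddCommGroup X'] [NormedSpace ℝ X'] [Module G.Even X']
    [NormedAddCommGroup Y'] [NormedSpace ℝ Y'] [Module G.Even Y']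
    (P : X →L[ℝ] X') (hP : ∀ (a : A.Even) v, P (a • v) = Gr.Hom.resEven ψ a • P v)
    (L : Y' →L[ℝ] Y) (hL : ∀ (a : A.Even) y, L (Gr.Hom.resEven ψ a • y) = a • L y)
    {g : X' → Y'} {D : Set X'} (hD : IsOpen D) (hg : SuperSmoothOn G g D) :
    SuperSmoothOn A (fun x => L (g (P x))) (P ⁻¹' D) := by
  refine ⟨L.contDiff.comp_contDiffOn (hg.1.comp P.contDiff.contDiffOn fun _ h => h),
    fun x hx a v => ?_⟩
  have hd : HasFDerivAt (fun x => L (g (P x))) (L.comp ((fderiv ℝ g (P x)).comp P)) x :=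
    L.hasFDerivAt.comp x ((hg.differentiableAt hD hx).hasFDerivAt.comp x P.hasFDerivAt)
  rw [hd.fderiv]
  simp only [ContinuousLinearMap.comp_apply, hP, hg.2 _ hx, hL]

end SuperSmooth

namespace SuperManifold

variable {X : SuperManifold.{u}} {A G : Gr}

lemma image_coord_preimage (i : X.ι) (ψ : A ⟶ G) (S : Set (X.pts.obj G)) :
    X.coord i A '' (X.source i A ∩ X.pts.map ψ ⁻¹' S) =
      X.coord i A '' X.source i A ∩ Bar.map ψ ⁻¹' (X.coord i G '' (X.source i G ∩ S)) := by
  ext q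
  constructor
  · rintro ⟨x, ⟨hx, hxS⟩, rfl⟩
    exact ⟨⟨x, hx, rfl⟩, _, ⟨X.source_map i ψ x hx, hxS⟩, X.coord_map i ψ x hx⟩
  · rintro ⟨⟨x, hx, rfl⟩, y, ⟨hy, hyS⟩, h⟩
    rw [← X.coord_map i ψ x hx] at h
    obtain rfl := X.injOn i G hy (X.source_map i ψ x hx) h
    exact ⟨x, ⟨hx, hyS⟩, rfl⟩

lemma IsOpenSet.preimage_map (ψ : A ⟶ G) {S : Set (X.pts.obj G)} (hS : X.IsOpenSet S) :
    X.IsOpenSet (X.pts.map ψ ⁻¹' S) := fun i => by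
  rw [image_coord_preimage]
  exact IsOpen.inter (by simpa using X.isOpen_overlap i i A)
    ((hS i).preimage (Bar.continuous_map ψ))

variable {Y : Type*} [NormedAddCommGroup Y] [NormedSpace ℝ Y] [Module A.Even Y]

lemma SmoothOn.baseChange (ψ : A ⟶ G) {Y' : Type*}
    [NormedAddCommGroup Y'] [NormedSpace ℝ Y'] [Module G.Even Y']
    (L : Y' →L[ℝ] Y) (hL : ∀ (a : A.Even) y, L (Gr.Hom.resEven ψ a • y) = a • L y)
    {h : X.pts.obj G → Y'} {S : Set (X.pts.obj G)} (hh : X.SmoothOn h S) :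
    X.SmoothOn (fun x => L (h (X.pts.map ψ x))) (X.pts.map ψ ⁻¹' S) := by
  refine ⟨hh.1.preimage_map ψ, fun i => ?_⟩
  obtain ⟨g, hg, hgh⟩ := hh.2 i
  let P : Pt A (X.model i) →L[ℝ] Pt G (X.model i) := ⟨Bar.map ψ, Bar.continuous_map ψ⟩
  refine ⟨fun x => L (g (P x)), (hg.baseChange ψ P (Bar.map_smul_even ψ) L hL (hh.1 i)).mono ?_,
    fun x hx => ?_⟩
  · rw [image_coord_preimage]
    exact Set.inter_subset_right
  · change L (g (Bar.map ψ (X.coord i A x))) = _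
    rw [← X.coord_map i ψ x hx.1, hgh _ ⟨X.source_map i ψ x hx.1, hx.2⟩]

lemma SmoothOn.bilinear {Y₁ Y₂ : Type*}
    [NormedAddCommGroup Y₁] [NormedSpace ℝ Y₁] [Module A.Even Y₁] [FiniteDimensional ℝ Y₁]
    [NormedAddCommGroup Y₂] [NormedSpace ℝ Y₂] [Module A.Even Y₂]
    (L : Y₁ →ₗ[ℝ] Y₂ →ₗ[ℝ] Y) (hL : ∀ x, Continuous (L x))
    (h₁ : ∀ (a : A.Even) x y, L (a • x) y = a • L x y)
    (h₂ : ∀ (a : A.Even) x y, L x (a • y) = a • L x y)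
    {f : X.pts.obj A → Y₁} {g : X.pts.obj A → Y₂} {S : Set (X.pts.obj A)}
    (hf : X.SmoothOn f S) (hg : X.SmoothOn g S) : X.SmoothOn (fun x => L (f x) (g x)) S :=
  SmoothOn.comp (superSmoothOn_bilinear L hL h₁ h₂ Set.univ) isOpen_univ (hf.prodMk hg)
    fun _ _ => trivial

variable {V : SBanach.{v}} {S : Set (X.pts.obj A)}

lemma SmoothOn.even_smul {c : X.pts.obj A → A.part 0} {h : X.pts.obj A → Pt A V}
    (hc : X.SmoothOn (fun x => GTensor.tmul 0 (c x) (1 : ℝ)) S) (hh : X.SmoothOn h S) :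
    X.SmoothOn (fun x => Gr.toEven (c x) • h x) S := by
  let L : GTensor A 0 ℝ →ₗ[ℝ] Pt A V →ₗ[ℝ] Pt A V :=
    LinearMap.mk₂ ℝ (fun a x => Gr.toEven (GTensor.toPart 0 a) • x)
      (fun a b x => by rw [map_add, map_add, add_smul])
      (fun r a x => by
        rw [map_smul, map_smul]
        exact smul_assoc r _ x)
      (fun a x y => smul_add _ x y)
      (fun r a x => smul_algebra_smul_comm r (Gr.toEven (GTensor.toPart 0 a)) x)
  have hL := hc.bilinear L (fun a => Bar.continuous_even_smul _)
    (fun a x y => by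
      change Gr.toEven (GTensor.toPart 0 (a • x)) • y = _
      rw [GTensor.toPart_smul]
      exact mul_smul a (Gr.toEven (GTensor.toPart 0 x)) y)
    (fun a x y => by
      change Gr.toEven (GTensor.toPart 0 x) • a • y = a • Gr.toEven (GTensor.toPart 0 x) • y
      rw [smul_smul, smul_smul]
      exact congrArg (· • y) (Subtype.ext (Gr.mul_even _ _ a.2))) hh
  simpa only [L, LinearMap.mk₂_apply, GTensor.toPart_tmul, one_smul] using hL

lemma SmoothOn.oddMul {c : X.pts.obj A → A.part 1} {h : X.pts.obj A → Pt A V.flip}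
    (hc : X.SmoothOn (fun x => GTensor.tmul 1 (c x) (1 : ℝ)) S) (hh : X.SmoothOn h S) :
    X.SmoothOn (fun x => (Bar.oddMul (c x) (h x) : Pt A V)) S := by
  let L : GTensor A 1 ℝ →ₗ[ℝ] Pt A V.flip →ₗ[ℝ] Pt A V :=
    LinearMap.mk₂ ℝ (fun a x => Bar.oddMul (GTensor.toPart 1 a) x)
      (fun a b x => by rw [map_add, Bar.oddMul_add_left])
      (fun r a x => by rw [map_smul, Bar.oddMul_smul_left])
      (fun a x y => map_add _ x y) (fun r a x => map_smul _ r x)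
  have hL := hc.bilinear L (fun a => Bar.continuous_oddMul _)
    (fun a x y => by
      change Bar.oddMul (GTensor.toPart 1 (a • x)) y = _
      rw [GTensor.toPart_smul, Bar.oddMul_even_smul_left]
      rfl)
    (fun a x y => Bar.oddMul_even_smul a _ y) hh
  simpa only [L, LinearMap.mk₂_apply, GTensor.toPart_tmul, one_smul] using hL

end SuperManifold

lemma SuperManifold.SmoothOn.congr {M : SuperManifold.{u}} {A : Gr} {Y : Type*}
    [NormedAddCommGroup Y] [NormedSpace ℝ Y] [Module A.Even Y] {f g : M.pts.obj A → Y}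
    {S : Set (M.pts.obj A)} (hf : M.SmoothOn f S) (h : ∀ x ∈ S, f x = g x) : M.SmoothOn g S := by
  refine ⟨hf.1, fun j => ?_⟩
  obtain ⟨k, hk, he⟩ := hf.2 j
  exact ⟨k, hk, fun x hx => (he x hx).trans (h x hx.2)⟩

namespace SuperVectorBundle

open SuperManifold

variable {M : SuperManifold.{u}} {V : SBanach.{u}} (E : SuperVectorBundle M V) {A B : Gr}

variable {E} in
lemma eq_of_fib {a b : E.tot.obj A} (i : E.ι) (h : E.proj.app A a = E.proj.app A b)
    (hi : E.proj.app A a ∈ E.base i A) (hf : E.fib i A a = E.fib i A b) : a = b :=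
  (E.fib_bij i A _ hi).injOn rfl h.symm hf

lemma exists_fib (i : E.ι) {x : M.pts.obj A} (hx : x ∈ E.base i A) (v : Pt A V) :
    ∃ a, E.proj.app A a = x ∧ E.fib i A a = v :=
  (E.fib_bij i A x hx).surjOn (Set.mem_univ v)

lemma exists_zero (x : M.pts.obj A) : ∃ a, E.proj.app A a = x ∧
    ∀ i, x ∈ E.base i A → E.fib i A a = 0 := by
  obtain ⟨j, hj⟩ := E.cover A x
  obtain ⟨a, rfl, -⟩ := E.exists_fib j hj 0
  exact ⟨E.smul A 0 a, E.proj_smul A 0 a, fun i hi => by rw [E.fib_smul _ _ _ _ hi, zero_smul]⟩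

/-- The zero of the fibre over a point. -/
def zero (A : Gr) (x : M.pts.obj A) : E.tot.obj A := (E.exists_zero x).choose

lemma proj_zero (x : M.pts.obj A) : E.proj.app A (E.zero A x) = x := (E.exists_zero x).choose_spec.1

lemma fib_zero {i : E.ι} {x : M.pts.obj A} (hx : x ∈ E.base i A) : E.fib i A (E.zero A x) = 0 :=
  (E.exists_zero x).choose_spec.2 i hx

namespace Section

variable {E}

/-- The value of a section at a point. -/
def eval (s : E.Section) (A : Gr) (x : M.pts.obj A) : E.tot.obj A := s.1.toFun A x

@[simp] lemma proj_eval (s : E.Section) (x : M.pts.obj A) : E.proj.app A (s.eval A x) = x := s.2 A x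

lemma eval_map (s : E.Section) (φ : A ⟶ B) (x : M.pts.obj A) :
    s.eval B (M.pts.map φ x) = E.tot.map φ (s.eval A x) := s.1.naturality φ x

lemma proj_eval_mem (s : E.Section) {i : E.ι} {x : M.pts.obj A} (hx : x ∈ E.base i A) :
    E.proj.app A (s.eval A x) ∈ E.base i A := by rwa [proj_eval]

lemma fib_eval_map (s : E.Section) (φ : A ⟶ B) {i : E.ι} {x : M.pts.obj A}
    (hx : x ∈ E.base i A) :
    E.fib i B (s.eval B (M.pts.map φ x)) = Bar.map φ (E.fib i A (s.eval A x)) := by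
  rw [eval_map, E.fib_map _ _ _ (s.proj_eval_mem hx)]

lemma ext_eval {s t : E.Section} (h : ∀ A x, s.eval A x = t.eval A x) : s = t :=
  Subtype.ext (Hom.ext (funext fun A => funext fun x => h A x))

lemma ext_fib {s t : E.Section}
    (h : ∀ A i x, x ∈ E.base i A → E.fib i A (s.eval A x) = E.fib i A (t.eval A x)) : s = t :=
  ext_eval fun A x => by
    obtain ⟨i, hi⟩ := E.cover A x
    exact eq_of_fib i (by simp) (s.proj_eval_mem hi) (h A i x hi)

lemma smoothOn_fib_eval (s : E.Section) (i : E.ι) (A : Gr) :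
    M.SmoothOn (fun x => E.fib i A (s.eval A x)) (E.base i A) := by
  have h := s.1.smooth.smoothOn (E.smoothOn_fib i A)
  simp only [Set.preimage_ofPred_eq, s.2, Set.ofPred_mem_eq] at h
  exact h

/-- The section with given values, whose fibre coordinates are natural and supersmooth. -/
def ofFib (f : ∀ A, M.pts.obj A → E.tot.obj A) (hp : ∀ A x, E.proj.app A (f A x) = x)
    (hn : ∀ {A B : Gr} (φ : A ⟶ B) (i : E.ι) (x : M.pts.obj A), x ∈ E.base i A →
      E.fib i B (f B (M.pts.map φ x)) = Bar.map φ (E.fib i A (f A x)))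
    (hs : ∀ i A, M.SmoothOn (fun x => E.fib i A (f A x)) (E.base i A)) : E.Section :=
  ⟨{ toFun := f
     naturality := fun {A B} φ x => by
       obtain ⟨i, hi⟩ := E.cover A x
       refine eq_of_fib i ?_ (by rw [hp]; exact E.base_map i φ x hi) ?_
       · exact ((hp _ _).trans (congrArg (M.pts.map φ) (hp A x).symm)).trans (E.proj_map φ _).symm
       · exact (hn φ i x hi).trans (E.fib_map _ _ _ (by rwa [hp])).symm
     smooth := E.isSuperSmooth_total
       (by simpa only [hp] using isSuperSmooth_id M)
       (fun i A => by simpa only [hp, Set.ofPred_mem_eq] using hs i A) }, hp⟩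

instance : Zero E.Section where
  zero := ofFib E.zero (fun _ x => E.proj_zero x)
    (fun φ i x hx => by rw [E.fib_zero hx, E.fib_zero (E.base_map i φ x hx), map_zero])
    (fun i A => ((smoothOn_const (X := M) (A := A) (0 : Pt A V)).mono (E.base_open i A)
      (Set.subset_univ _)).congr fun _ hx => (E.fib_zero hx).symm)

instance : Add E.Section where
  add s t := ofFib (fun A x => E.add A (s.eval A x) (t.eval A x) (by simp))
    (fun A x => by rw [E.proj_add, proj_eval])
    (fun φ i x hx => by
      rw [E.fib_add _ _ _ _ _ (s.proj_eval_mem hx),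
        E.fib_add _ _ _ _ _ (s.proj_eval_mem (E.base_map i φ x hx)), s.fib_eval_map φ hx,
        t.fib_eval_map φ hx, map_add])
    (fun i A => ((s.smoothOn_fib_eval i A).add (t.smoothOn_fib_eval i A)).congr
      fun x hx => (E.fib_add _ _ _ _ _ (s.proj_eval_mem hx)).symm)

/-- The product of a section with an even function. -/
def evenMul (c : ∀ A, M.pts.obj A → A.part 0)
    (hn : ∀ {A B : Gr} (φ : A ⟶ B) x, c B (M.pts.map φ x) = Gr.Hom.res φ 0 (c A x))
    (hs : ∀ A, M.SmoothOn (fun x => GTensor.tmul 0 (c A x) (1 : ℝ)) Set.univ)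
    (s : E.Section) : E.Section :=
  ofFib (fun A x => E.smul A (Gr.toEven (c A x)) (s.eval A x))
    (fun A x => by rw [E.proj_smul, proj_eval])
    (fun φ i x hx => by
      rw [E.fib_smul _ _ _ _ (s.proj_eval_mem hx),
        E.fib_smul _ _ _ _ (s.proj_eval_mem (E.base_map i φ x hx)), s.fib_eval_map φ hx, hn,
        Bar.map_smul_even, Gr.resEven_toEven])
    (fun i A => (((hs A).mono (E.base_open i A) (Set.subset_univ _)).even_smul
      (s.smoothOn_fib_eval i A)).congr fun x hx => (E.fib_smul _ _ _ _ (s.proj_eval_mem hx)).symm)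

instance : SMul ℝ E.Section where
  smul r s := s.evenMul (fun A _ => ⟨algebraMap ℝ A.Even r, (algebraMap ℝ A.Even r).2⟩)
    (fun φ _ => Subtype.ext ((Gr.Hom.alg φ).commutes r).symm)
    (fun _ => smoothOn_const _)

lemma fib_eval_add (s t : E.Section) {i : E.ι} {x : M.pts.obj A} (hx : x ∈ E.base i A) :
    E.fib i A ((s + t).eval A x) = E.fib i A (s.eval A x) + E.fib i A (t.eval A x) :=
  E.fib_add _ _ _ _ _ (s.proj_eval_mem hx)

lemma fib_eval_zero {i : E.ι} {x : M.pts.obj A} (hx : x ∈ E.base i A) :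
    E.fib i A ((0 : E.Section).eval A x) = 0 := E.fib_zero hx

lemma fib_eval_smul (r : ℝ) (s : E.Section) {i : E.ι} {x : M.pts.obj A} (hx : x ∈ E.base i A) :
    E.fib i A ((r • s).eval A x) = r • E.fib i A (s.eval A x) :=
  (E.fib_smul i A (algebraMap ℝ A.Even r) _ (s.proj_eval_mem hx)).trans (algebraMap_smul _ _ _)

instance : Neg E.Section := ⟨fun s => (-1 : ℝ) • s⟩

lemma fib_eval_neg (s : E.Section) {i : E.ι} {x : M.pts.obj A} (hx : x ∈ E.base i A) :
    E.fib i A ((-s).eval A x) = - E.fib i A (s.eval A x) :=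
  (fib_eval_smul (-1) s hx).trans (neg_one_smul ℝ _)

instance : AddCommGroup E.Section where
  add_assoc r s t := ext_fib fun A i x hx => by simp only [fib_eval_add _ _ hx, add_assoc]
  zero_add s := ext_fib fun _ i x hx => by rw [fib_eval_add _ _ hx, fib_eval_zero hx, zero_add]
  add_zero s := ext_fib fun A i x hx => by rw [fib_eval_add _ _ hx, fib_eval_zero hx, add_zero]
  add_comm s t := ext_fib fun A i x hx => by simp only [fib_eval_add _ _ hx, add_comm]
  neg_add_cancel s := ext_fib fun A i x hx => by
    rw [fib_eval_add _ _ hx, fib_eval_neg _ hx, fib_eval_zero hx, neg_add_cancel]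
  nsmul := nsmulRec
  zsmul := zsmulRec

instance : Module ℝ E.Section where
  one_smul s := ext_fib fun A i x hx => by rw [fib_eval_smul _ _ hx, one_smul]
  mul_smul a b s := ext_fib fun A i x hx => by simp only [fib_eval_smul _ _ hx, mul_smul]
  smul_zero a := ext_fib fun A i x hx => by
    rw [fib_eval_smul _ _ hx, fib_eval_zero hx, smul_zero]
  zero_smul s := ext_fib fun A i x hx => by
    rw [fib_eval_smul _ _ hx, fib_eval_zero hx, zero_smul]
  smul_add a s t := ext_fib fun A i x hx => by
    simp only [fib_eval_smul _ _ hx, fib_eval_add _ _ hx, smul_add]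
  add_smul a b s := ext_fib fun A i x hx => by
    simp only [fib_eval_smul _ _ hx, fib_eval_add _ _ hx, add_smul]

lemma fib_eval_sum {ι : Type*} (S : Finset ι) (s : ι → E.Section) {i : E.ι} {x : M.pts.obj A}
    (hx : x ∈ E.base i A) :
    E.fib i A ((∑ n ∈ S, s n).eval A x) = ∑ n ∈ S, E.fib i A ((s n).eval A x) :=
  map_sum (AddMonoidHom.mk' (fun s : E.Section => E.fib i A (s.eval A x))
    fun s t => fib_eval_add s t hx) s S

end Section

lemma isPointwiseSpace : E.IsPointwiseSpace := fun _ _ _ _ _ => ⟨rfl, rfl⟩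

end SuperVectorBundle

namespace Gr

variable {A B : Gr}

lemma resEven_one (φ : A ⟶ B) : Hom.resEven φ 1 = 1 := Subtype.ext (map_one (Hom.alg φ))

lemma resEven_zero (φ : A ⟶ B) : Hom.resEven φ 0 = 0 := Subtype.ext (map_zero (Hom.alg φ))

lemma resEven_mul (φ : A ⟶ B) (a b : A.Even) :
    Hom.resEven φ (a * b) = Hom.resEven φ a * Hom.resEven φ b :=
  Subtype.ext (map_mul (Hom.alg φ) _ _)

lemma resEven_add (φ : A ⟶ B) (a b : A.Even) :
    Hom.resEven φ (a + b) = Hom.resEven φ a + Hom.resEven φ b :=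
  Subtype.ext (map_add (Hom.alg φ) _ _)

end Gr

namespace SuperVectorBundle

open SuperManifold

variable {M : SuperManifold.{u}} {V : SBanach.{u}} {E : SuperVectorBundle M V} {A K L : Gr}

lemma smoothOn_family_eval (M : SuperManifold.{u}) (i : ZMod 2) (a : K.part i) :
    ((superpoint K).prod M).SmoothOn (A := A)
      (fun x => GTensor.tmul i (Gr.Hom.res (A := K) x.1 i a) (1 : ℝ)) Set.univ :=
  isSuperSmooth_fst.smoothOn (smoothOn_superpoint_eval K i a)

instance familySMul : SMul K.Even (E.family K).Section where
  smul a σ := σ.evenMul (fun _ x => Gr.Hom.res (A := K) x.1 0 ⟨a, a.2⟩) (fun _ _ => rfl)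
    fun _ => smoothOn_family_eval M 0 _

lemma val_family_smul (a : K.Even) (σ : (E.family K).Section) (p : K ⟶ A) (m : M.pts.obj A) :
    val (a • σ) A p m = E.smul A (Gr.Hom.resEven p a) (val σ A p m) := rfl

lemma val_family_add (σ τ : (E.family K).Section) (p : K ⟶ A) (m : M.pts.obj A) :
    val (σ + τ) A p m = E.add A (val σ A p m) (val τ A p m)
      ((proj_val _ _ _ _).trans (proj_val _ _ _ _).symm) := rfl

lemma family_ext_fib {σ τ : (E.family K).Section} (h : ∀ A i (p : K ⟶ A) m, m ∈ E.base i A →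
    E.fib i A (val σ A p m) = E.fib i A (val τ A p m)) : σ = τ :=
  Section.ext_fib fun A i x hx => h A i x.1 x.2 hx

lemma proj_val_mem (σ : (E.family K).Section) (p : K ⟶ A) {m : M.pts.obj A} {i : E.ι}
    (hm : m ∈ E.base i A) : E.proj.app A (val σ A p m) ∈ E.base i A := by rwa [proj_val]

lemma fib_val_smul (a : K.Even) (σ : (E.family K).Section) (p : K ⟶ A) {m : M.pts.obj A} {i : E.ι}
    (hm : m ∈ E.base i A) :
    E.fib i A (val (a • σ) A p m) = Gr.Hom.resEven p a • E.fib i A (val σ A p m) := by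
  rw [val_family_smul, E.fib_smul _ _ _ _ (proj_val_mem σ p hm)]

lemma fib_val_add (σ τ : (E.family K).Section) (p : K ⟶ A) {m : M.pts.obj A} {i : E.ι}
    (hm : m ∈ E.base i A) :
    E.fib i A (val (σ + τ) A p m) = E.fib i A (val σ A p m) + E.fib i A (val τ A p m) := by
  rw [val_family_add, E.fib_add _ _ _ _ _ (proj_val_mem σ p hm)]

lemma fib_val_zero (p : K ⟶ A) {m : M.pts.obj A} {i : E.ι} (hm : m ∈ E.base i A) :
    E.fib i A (val (0 : (E.family K).Section) A p m) = 0 :=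
  Section.fib_eval_zero (E := E.family K) (x := (p, m)) hm

instance familyModule : Module K.Even (E.family K).Section where
  one_smul s := family_ext_fib fun A i p m hm => by
    rw [fib_val_smul _ _ _ hm, Gr.resEven_one, one_smul]
  mul_smul a b s := family_ext_fib fun A i p m hm => by
    simp only [fib_val_smul _ _ _ hm, Gr.resEven_mul, mul_smul]
  smul_zero a := family_ext_fib fun A i p m hm => by
    rw [fib_val_smul _ _ _ hm, fib_val_zero _ hm, smul_zero]
  zero_smul s := family_ext_fib fun A i p m hm => by
    rw [fib_val_smul _ _ _ hm, fib_val_zero _ hm, Gr.resEven_zero, zero_smul]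
  smul_add a s t := family_ext_fib fun A i p m hm => by
    simp only [fib_val_smul _ _ _ hm, fib_val_add _ _ _ hm, smul_add]
  add_smul a b s := family_ext_fib fun A i p m hm => by
    simp only [fib_val_smul _ _ _ hm, fib_val_add _ _ _ hm, Gr.resEven_add, add_smul]

variable (E)

lemma sectionMap_add (φ : K ⟶ L) (σ τ : (E.family K).Section) :
    E.sectionMap φ (σ + τ) = E.sectionMap φ σ + E.sectionMap φ τ :=
  section_ext fun _ _ _ => rfl

lemma sectionMap_smul (φ : K ⟶ L) (a : K.Even) (σ : (E.family K).Section) :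
    E.sectionMap φ (a • σ) = Gr.Hom.resEven φ a • E.sectionMap φ σ :=
  section_ext fun _ _ _ => rfl

/-- The pointwise module structure on the functor of families of sections. -/
def gammaHatModule : RbarModule E.gammaHat where
  addCommGroup K := inferInstanceAs (AddCommGroup (E.family K).Section)
  module _ := familyModule (E := E)
  map_add := E.sectionMap_add
  map_smul := E.sectionMap_smul

lemma isPointwise_gammaHatModule : E.IsPointwise E.gammaHatModule :=
  fun _ _ _ _ _ _ _ => ⟨rfl, rfl⟩

end SuperVectorBundle

/-! ### Reversal of parity -/

namespace Gr

variable {A B : Gr}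

/-- The Grassmann algebra with one generator. -/
def line : Gr := ⟨1⟩

instance : Unique (Fin line.rank) := inferInstanceAs (Unique (Fin 1))

/-- The generator of `Gr.line`. -/
def eta : line.part 1 := line.gen default

lemma line_ι (v : Fin line.rank → ℝ) :
    (ExteriorAlgebra.ι ℝ v : line.Alg) = v default • (eta : line.Alg) := by
  have h : v = v default • (Pi.single default 1 : Fin line.rank → ℝ) := by
    ext i
    simp [Unique.eq_default i]
  conv_lhs => rw [h, map_smul]
  rfl

lemma exists_eq_smul_one_add_smul_eta (x : line.Alg) :
    ∃ r s : ℝ, x = r • 1 + s • (eta : line.Alg) := by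
  induction x using ExteriorAlgebra.induction with
  | algebraMap r => exact ⟨r, 0, by rw [zero_smul, add_zero, Algebra.algebraMap_eq_smul_one]⟩
  | ι v => exact ⟨0, v default, by rw [line_ι, zero_smul, zero_add]⟩
  | mul x y hx hy =>
    obtain ⟨r, s, rfl⟩ := hx
    obtain ⟨r', s', rfl⟩ := hy
    refine ⟨r * r', r * s' + s * r', ?_⟩
    simp only [add_mul, mul_add, smul_mul_smul_comm, one_mul, mul_one, odd_mul_self _ eta.2,
      smul_zero, add_zero, add_smul]
    abel
  | add x y hx hy =>
    obtain ⟨r, s, rfl⟩ := hx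
    obtain ⟨r', s', rfl⟩ := hy
    exact ⟨r + r', s + s', by simp only [add_smul]; abel⟩

/-- The unit as an element of the even part. -/
def one (A : Gr) : A.part 0 := ⟨1, SetLike.GradedOne.one_mem⟩

lemma exists_smul_one (k : line.part 0) : ∃ r : ℝ, r • line.one = k := by
  obtain ⟨r, s, h⟩ := exists_eq_smul_one_add_smul_eta k
  refine ⟨r, ?_⟩
  have h := congrArg (line.proj 0) h
  rw [map_add, map_smul, map_smul, proj_coe, proj_coe_of_ne one_ne_zero, smul_zero, add_zero] at h
  rw [h]
  exact congrArg (r • ·) (proj_coe line.one).symm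

lemma exists_smul_eta (k : line.part 1) : ∃ r : ℝ, r • eta = k := by
  obtain ⟨r, s, h⟩ := exists_eq_smul_one_add_smul_eta k
  have h := congrArg (line.proj 1) h
  have h₁ : line.proj 1 1 = 0 := proj_coe_of_ne zero_ne_one line.one
  rw [map_add, map_smul, map_smul, proj_coe, proj_coe, h₁, smul_zero, zero_add] at h
  exact ⟨s, h.symm⟩

lemma eta_ne_zero : eta ≠ 0 := fun h => by
  have h : (ExteriorAlgebra.ι ℝ (Pi.single default 1 : Fin line.rank → ℝ)) = 0 :=
    congrArg Subtype.val h
  simpa using congrFun (ExteriorAlgebra.ι_eq_zero_iff _ |>.mp h) default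

/-- The basis of the even part of `Gr.line` that consists of the unit. -/
def oneBasis : Module.Basis Unit ℝ (line.part 0) :=
  .mk (v := fun _ => line.one)
    (linearIndependent_unique_iff.2 fun h => one_ne_zero (congrArg Subtype.val h))
    fun k _ => by
      rw [Set.range_const]
      exact Submodule.mem_span_singleton.2 (exists_smul_one k)

/-- The basis of the odd part of `Gr.line` that consists of the generator. -/
def etaBasis : Module.Basis Unit ℝ (line.part 1) :=
  .mk (v := fun _ => eta) (linearIndependent_unique_iff.2 eta_ne_zero)
    fun k _ => by
      rw [Set.range_const]
      exact Submodule.mem_span_singleton.2 (exists_smul_eta k)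

/-- The linear form on the odd part of `Gr.line` that takes the value `1` at the generator. -/
def etaDual : line.part 1 →ₗ[ℝ] ℝ := etaBasis.coord ()

lemma etaDual_eta : etaDual eta = 1 := by
  have h : etaBasis () = eta := Module.Basis.mk_apply ..
  rw [etaDual, ← h, etaBasis.coord_apply, etaBasis.repr_self_apply, if_pos rfl]

/-- The morphism `line ⟶ A` with given value at the generator. -/
def ofOdd (c : A.part 1) : line ⟶ A := homOfGen fun _ => c

lemma ofOdd_eta (c : A.part 1) : Hom.res (ofOdd c) 1 eta = c := homOfGen_gen _ _

lemma ofOdd_comp (c : A.part 1) (φ : A ⟶ B) : ofOdd c ≫ φ = ofOdd (Hom.res φ 1 c) :=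
  hom_ext fun i => by
    rw [Unique.eq_default i]
    change _ = Hom.res (ofOdd _) 1 eta
    rw [ofOdd_eta, Hom.res_comp, LinearMap.comp_apply]
    exact congrArg _ (ofOdd_eta c)

/-- The morphism `line.tens A ⟶ A` that is the identity on `A` and has a given value at the
generator. -/
def evalLine (c : A.part 1) : line.tens A ⟶ A := desc (ofOdd c) (𝟙 A)

lemma inr_evalLine (c : A.part 1) : inr line A ≫ evalLine c = 𝟙 A := inr_desc _ _

lemma whiskerLeft_evalLine (φ : A ⟶ B) (c : A.part 1) :
    whiskerLeft line φ ≫ evalLine (Hom.res φ 1 c) = evalLine c ≫ φ := by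
  rw [evalLine, evalLine, whiskerLeft_desc, desc_comp, ofOdd_comp, Category.id_comp,
    Category.comp_id]

end Gr

namespace Bar

variable {A : Gr} {V₀ V₁ : Type u} [AddCommGroup V₀] [Module ℝ V₀] [AddCommGroup V₁] [Module ℝ V₁]

lemma map_evalLine (c : A.part 1) (w : Bar A V₁ V₀) :
    map (Gr.evalLine c) (tensOddMul Gr.eta w : Bar (Gr.line.tens A) V₀ V₁) = oddMul c w := by
  rw [Gr.evalLine, map_desc_tensOddMul, Gr.ofOdd_eta, map_id]

lemma contractOdd_etaDual (w : Bar A V₁ V₀) :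
    contractOdd Gr.etaDual (tensOddMul Gr.eta w : Bar (Gr.line.tens A) V₀ V₁) = w := by
  rw [contractOdd_tensOddMul, Gr.etaDual_eta, one_smul]

lemma eq_tensOddMul_eta (x : Bar (Gr.line.tens A) V₀ V₁) (hx : map (Gr.evalLine 0) x = 0) :
    x = tensOddMul Gr.eta (contractOdd Gr.etaDual x) := by
  have hsum := sum_tensMul_contract Gr.oneBasis Gr.etaBasis x
  have hone : Gr.oneBasis () = Gr.line.one := Module.Basis.mk_apply ..
  have heta : Gr.etaBasis () = Gr.eta := Module.Basis.mk_apply ..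
  rw [Fintype.sum_unique, Fintype.sum_unique, PUnit.default_eq_unit, hone, heta] at hsum
  have heven : contractEven (Gr.oneBasis.coord ()) x = 0 := by
    have hres (φ : Gr.line ⟶ A) : Gr.toEven (Gr.Hom.res φ 0 Gr.line.one) = 1 :=
      Subtype.ext (map_one (Gr.Hom.alg φ))
    rw [← hsum, map_add, map_evalLine, oddMul_zero_left, add_zero, Gr.evalLine,
      map_desc_tensEvenMul, hres, one_smul, map_id] at hx
    exact hx
  rw [heven, map_zero, zero_add] at hsum
  exact hsum.symm

lemma tensOddMul_even_smul {K : Gr} (k : K.part 1) (a : A.Even) (w : Bar A V₁ V₀) :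
    tensOddMul k (a • w) = Gr.Hom.resEven (K.inr A) a • tensOddMul k w := by
  rw [tensOddMul_eq_oddMul, tensOddMul_eq_oddMul, map_smul_even, oddMul_even_smul]

end Bar

namespace SuperVectorBundle

open SuperManifold

variable {M : SuperManifold.{u}} {V : SBanach.{u}} (E : SuperVectorBundle M V) {A B : Gr}

lemma tot_map_zero (φ : A ⟶ B) (x : M.pts.obj A) :
    E.tot.map φ (E.zero A x) = E.zero B (M.pts.map φ x) :=
  ((0 : E.Section).eval_map φ x).symm

/-- The points of the bundle with reversed parity over `pt`: the points of the bundle over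
`line.tens A` that lie over the image of `pt` and vanish where the generator of `line` does. In
fibre coordinates they are the products `η w` of the generator with points `w` of `ΠV`. -/
@[ext]
structure FlipPt (A : Gr) : Type u where
  pt : M.pts.obj A
  lift : E.tot.obj (Gr.line.tens A)
  proj_lift : E.proj.app _ lift = M.pts.map (Gr.inr Gr.line A) pt
  map_lift : E.tot.map (Gr.evalLine 0) lift = E.zero A pt

variable {E}

lemma proj_map_evalLine {x : M.pts.obj A} {a : E.tot.obj (Gr.line.tens A)}
    (ha : E.proj.app _ a = M.pts.map (Gr.inr Gr.line A) x) (c : A.part 1) :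
    E.proj.app A (E.tot.map (Gr.evalLine c) a) = x := by
  rw [E.proj_map, ha, ← Functor.map_comp_apply, Gr.inr_evalLine, Functor.map_id_apply]

lemma fib_map_evalLine {i : E.ι} {x : M.pts.obj A} (hx : x ∈ E.base i A)
    {a : E.tot.obj (Gr.line.tens A)} (ha : E.proj.app _ a = M.pts.map (Gr.inr Gr.line A) x)
    {w : Pt A V.flip} (hw : E.fib i _ a = Bar.tensOddMul Gr.eta w) (c : A.part 1) :
    E.fib i A (E.tot.map (Gr.evalLine c) a) = Bar.oddMul c w := by
  rw [E.fib_map _ _ _ (ha ▸ E.base_map i _ x hx), hw, Bar.map_evalLine]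

namespace FlipPt

lemma proj_lift_mem (b : E.FlipPt A) {i : E.ι} (hi : b.pt ∈ E.base i A) :
    E.proj.app _ b.lift ∈ E.base i (Gr.line.tens A) := by
  rw [proj_lift]
  exact E.base_map i _ _ hi

/-- The fibre coordinate of a point of the bundle with reversed parity: the coefficient of the
generator of `line`. -/
def coord (b : E.FlipPt A) (i : E.ι) : Pt A V.flip :=
  Bar.contractOdd Gr.etaDual (E.fib i _ b.lift)

lemma fib_lift (b : E.FlipPt A) {i : E.ι} (hi : b.pt ∈ E.base i A) :
    E.fib i _ b.lift = Bar.tensOddMul Gr.eta (b.coord i) :=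
  Bar.eq_tensOddMul_eta _ (by
    rw [← E.fib_map _ _ _ (b.proj_lift_mem hi), b.map_lift]
    exact E.fib_zero hi)

lemma ext_coord {b b' : E.FlipPt A} (i : E.ι) (h : b.pt = b'.pt) (hi : b.pt ∈ E.base i A)
    (hc : b.coord i = b'.coord i) : b = b' :=
  FlipPt.ext h (eq_of_fib i (by rw [proj_lift, proj_lift, h]) (b.proj_lift_mem hi)
    (by rw [b.fib_lift hi, b'.fib_lift (h ▸ hi), hc]))

/-- The point of the bundle with reversed parity whose lift has a fibre coordinate `η w`. -/
def ofFib (x : M.pts.obj A) (a : E.tot.obj (Gr.line.tens A))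
    (ha : E.proj.app _ a = M.pts.map (Gr.inr Gr.line A) x)
    (hw : ∃ i, x ∈ E.base i A ∧ ∃ w : Pt A V.flip, E.fib i _ a = Bar.tensOddMul Gr.eta w) :
    E.FlipPt A where
  pt := x
  lift := a
  proj_lift := ha
  map_lift := by
    obtain ⟨i, hx, w, hw⟩ := hw
    have hp := proj_map_evalLine ha 0
    refine eq_of_fib i (by rw [hp, E.proj_zero]) (by rwa [hp]) ?_
    rw [fib_map_evalLine hx ha hw, Bar.oddMul_zero_left, E.fib_zero hx]

lemma exists_coord (i : E.ι) {x : M.pts.obj A} (hx : x ∈ E.base i A) (w : Pt A V.flip) :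
    ∃ b : E.FlipPt A, b.pt = x ∧ b.coord i = w := by
  obtain ⟨a, ha, hw⟩ := E.exists_fib i (E.base_map i (Gr.inr Gr.line A) x hx)
    (Bar.tensOddMul Gr.eta w)
  refine ⟨ofFib x a ha ⟨i, hx, w, hw⟩, rfl, ?_⟩
  exact (congrArg _ hw).trans (Bar.contractOdd_etaDual w)

lemma bijOn_coord (i : E.ι) {x : M.pts.obj A} (hx : x ∈ E.base i A) :
    Set.BijOn (fun b : E.FlipPt A => b.coord i) {b | b.pt = x} Set.univ := by
  refine ⟨Set.mapsTo_univ _ _, ?_, fun w _ => exists_coord i hx w⟩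
  rintro b rfl b' hb' h
  exact ext_coord i (Eq.symm hb') hx h

/-- The image of a point under a morphism of Grassmann algebras. -/
def map (φ : A ⟶ B) (b : E.FlipPt A) : E.FlipPt B where
  pt := M.pts.map φ b.pt
  lift := E.tot.map (Gr.whiskerLeft Gr.line φ) b.lift
  proj_lift := by
    rw [E.proj_map, proj_lift, ← Functor.map_comp_apply, ← Functor.map_comp_apply,
      Gr.inr_whiskerLeft]
  map_lift := by
    have h := Gr.whiskerLeft_evalLine φ 0
    rw [map_zero] at h
    rw [← E.tot_map_zero, ← b.map_lift, ← Functor.map_comp_apply, ← Functor.map_comp_apply, h]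

lemma map_id (b : E.FlipPt A) : b.map (𝟙 A) = b :=
  FlipPt.ext (Functor.map_id_apply ..) (by
    change E.tot.map (Gr.whiskerLeft Gr.line (𝟙 A)) b.lift = b.lift
    rw [Gr.whiskerLeft_id, Functor.map_id_apply])

lemma map_comp {C : Gr} (φ : A ⟶ B) (ψ : B ⟶ C) (b : E.FlipPt A) :
    b.map (φ ≫ ψ) = (b.map φ).map ψ :=
  FlipPt.ext (Functor.map_comp_apply ..) (by
    change E.tot.map (Gr.whiskerLeft Gr.line (φ ≫ ψ)) b.lift =
      E.tot.map (Gr.whiskerLeft Gr.line ψ) (E.tot.map (Gr.whiskerLeft Gr.line φ) b.lift)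
    rw [Gr.whiskerLeft_comp, Functor.map_comp_apply])

lemma coord_map (φ : A ⟶ B) (b : E.FlipPt A) {i : E.ι} (hi : b.pt ∈ E.base i A) :
    (b.map φ).coord i = Bar.map φ (b.coord i) := by
  rw [coord, map, E.fib_map i _ _ (b.proj_lift_mem hi)]
  exact Bar.contractOdd_map _ _ _

/-- The sum of two points of the same fibre. -/
def add (b b' : E.FlipPt A) (h : b.pt = b'.pt) : E.FlipPt A :=
  ofFib b.pt (E.add _ b.lift b'.lift (by rw [proj_lift, proj_lift, h]))
    ((E.proj_add _ _ _ _).trans b.proj_lift) (by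
      obtain ⟨i, hi⟩ := E.cover A b.pt
      refine ⟨i, hi, b.coord i + b'.coord i, ?_⟩
      rw [E.fib_add _ _ _ _ _ (b.proj_lift_mem hi), b.fib_lift hi, b'.fib_lift (h ▸ hi), map_add])

lemma coord_add (b b' : E.FlipPt A) (h : b.pt = b'.pt) {i : E.ι} (hi : b.pt ∈ E.base i A) :
    (b.add b' h).coord i = b.coord i + b'.coord i := by
  change Bar.contractOdd _ (E.fib i _ (E.add _ _ _ _)) = _
  rw [E.fib_add _ _ _ _ _ (b.proj_lift_mem hi), map_add]
  rfl

/-- The product of a point with an even element. -/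
def smul (c : A.Even) (b : E.FlipPt A) : E.FlipPt A :=
  ofFib b.pt (E.smul _ (Gr.Hom.resEven (Gr.inr Gr.line A) c) b.lift)
    ((E.proj_smul _ _ _).trans b.proj_lift) (by
      obtain ⟨i, hi⟩ := E.cover A b.pt
      refine ⟨i, hi, c • b.coord i, ?_⟩
      rw [E.fib_smul _ _ _ _ (b.proj_lift_mem hi), b.fib_lift hi, Bar.tensOddMul_even_smul])

lemma coord_smul (c : A.Even) (b : E.FlipPt A) {i : E.ι} (hi : b.pt ∈ E.base i A) :
    (b.smul c).coord i = c • b.coord i := by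
  change Bar.contractOdd _ (E.fib i _ (E.smul _ _ _)) = _
  rw [E.fib_smul _ _ _ _ (b.proj_lift_mem hi), Bar.contractOdd_smul]
  rfl

/-- The product of a point of the bundle with reversed parity with an odd element. -/
def oddSmul (c : A.part 1) (b : E.FlipPt A) : E.tot.obj A := E.tot.map (Gr.evalLine c) b.lift

lemma proj_oddSmul (c : A.part 1) (b : E.FlipPt A) : E.proj.app A (b.oddSmul c) = b.pt :=
  proj_map_evalLine b.proj_lift c

lemma fib_oddSmul (c : A.part 1) (b : E.FlipPt A) {i : E.ι} (hi : b.pt ∈ E.base i A) :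
    E.fib i A (b.oddSmul c) = Bar.oddMul c (b.coord i) :=
  fib_map_evalLine hi b.proj_lift (b.fib_lift hi) c

end FlipPt

variable (E)

/-- The functor of points of the bundle with reversed parity. -/
def flipTot : Gr ⥤ Type u where
  obj A := E.FlipPt A
  map φ := ↾fun b => b.map φ
  map_id _ := ConcreteCategory.hom_ext _ _ fun b => FlipPt.map_id b
  map_comp φ ψ := ConcreteCategory.hom_ext _ _ fun b => FlipPt.map_comp φ ψ b

/-- If `g` is the change of trivializations of the bundle over `line.tens A`, that of the bundle
with reversed parity is the coefficient of the generator `η` in `g (x, η w)`. -/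
lemma exists_flip_transition (i j : E.ι) (A : Gr) (α : M.ι) :
    ∃ g : Pt A (M.model α) × Pt A V.flip → Pt A V.flip,
      SuperSmoothOn A g ((M.coord α A '' (M.source α A ∩ (E.base i A ∩ E.base j A))) ×ˢ Set.univ) ∧
      ∀ b : E.FlipPt A, b.pt ∈ M.source α A ∩ (E.base i A ∩ E.base j A) →
        g (M.coord α A b.pt, b.coord i) = b.coord j := by
  obtain ⟨g, hg, hga⟩ := E.transition i j (Gr.line.tens A) α
  let P₁ : Pt A (M.model α) →L[ℝ] Pt (Gr.line.tens A) (M.model α) :=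
    ⟨Bar.map (Gr.inr Gr.line A), Bar.continuous_map _⟩
  let P₂ : Pt A V.flip →L[ℝ] Pt (Gr.line.tens A) V :=
    ⟨Bar.tensOddMul Gr.eta, Bar.continuous_oddMap _⟩
  let L : Pt (Gr.line.tens A) V →L[ℝ] Pt A V.flip :=
    ⟨Bar.contractOdd Gr.etaDual, Bar.continuous_oddMap _⟩
  have hopen := (((E.base_open i (Gr.line.tens A)).inter (E.base_open j _)) α).prod
    (isOpen_univ (X := Pt (Gr.line.tens A) V))
  have hmem {m : M.pts.obj A} (hm : m ∈ M.source α A ∩ (E.base i A ∩ E.base j A)) :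
      M.pts.map (Gr.inr Gr.line A) m ∈
        M.source α (Gr.line.tens A) ∩ (E.base i (Gr.line.tens A) ∩ E.base j _) :=
    ⟨M.source_map α _ m hm.1, E.base_map i _ m hm.2.1, E.base_map j _ m hm.2.2⟩
  refine ⟨_, (SuperSmoothOn.baseChange (Gr.inr Gr.line A) (P₁.prodMap P₂) (fun a v =>
    Prod.ext (Bar.map_smul_even _ a v.1) (Bar.tensOddMul_even_smul _ a v.2)) L
    (Bar.contractOdd_smul _) hopen hg).mono ?_, fun b hb => ?_⟩
  · rintro ⟨_, w⟩ ⟨⟨m, hm, rfl⟩, -⟩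
    exact ⟨⟨_, hmem hm, M.coord_map α _ m hm.1⟩, trivial⟩
  · change Bar.contractOdd _ (g (Bar.map (Gr.inr Gr.line A) (M.coord α A b.pt),
      Bar.tensOddMul Gr.eta (b.coord i))) = Bar.contractOdd _ (E.fib j _ b.lift)
    rw [← b.fib_lift hb.2.1, ← M.coord_map α _ _ hb.1, ← b.proj_lift, hga _ (b.proj_lift ▸ hmem hb)]

/-- The bundle with reversed parity. -/
def parityFlip : SuperVectorBundle M V.flip where
  tot := E.flipTot
  proj := { app := fun _ => ↾FlipPt.pt }
  add _ b b' h := FlipPt.add b b' h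
  smul _ c b := FlipPt.smul c b
  proj_add _ _ _ _ := rfl
  proj_smul _ _ _ := rfl
  ι := E.ι
  base := E.base
  fib i _ b := FlipPt.coord b i
  base_map := E.base_map
  base_open := E.base_open
  cover := E.cover
  fib_map _ _ _ φ b hb := FlipPt.coord_map φ b hb
  fib_bij i _ _ hx := FlipPt.bijOn_coord i hx
  fib_add _ _ b b' h hb := FlipPt.coord_add b b' h hb
  fib_smul _ _ c b hb := FlipPt.coord_smul c b hb
  transition := E.exists_flip_transition

lemma isParityReversal_parityFlip : E.IsParityReversal E.parityFlip := by
  refine ⟨Equiv.refl _, fun _ _ => rfl, fun i j A a b c hab hm h => ?_⟩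
  change E.proj.app A a = FlipPt.pt b at hab
  rw [hab] at hm
  obtain rfl : a = FlipPt.oddSmul c b :=
    eq_of_fib i (hab.trans (FlipPt.proj_oddSmul c b).symm) (hab ▸ hm.1)
      (h.trans (FlipPt.fib_oddSmul c b hm.1).symm)
  exact FlipPt.fib_oddSmul c b hm.2

end SuperVectorBundle

/-! ### Contraction and the changes of trivializations -/

namespace Bar

variable {K A : Gr} {V₀ V₁ : Type u} [AddCommGroup V₀] [Module ℝ V₀] [AddCommGroup V₁] [Module ℝ V₁]
  {g : Bar (K.tens A) V₀ V₁ →ₗ[ℝ] Bar (K.tens A) V₀ V₁} {g₀ : Bar A V₀ V₁ →ₗ[ℝ] Bar A V₀ V₁}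
  {g₁ : Bar A V₁ V₀ →ₗ[ℝ] Bar A V₁ V₀}

lemma contractEven_comm (h₀ : ∀ k w, g (tensEvenMul k w) = tensEvenMul k (g₀ w))
    (h₁ : ∀ k w, g (tensOddMul k w) = tensOddMul k (g₁ w)) (f : K.part 0 →ₗ[ℝ] ℝ)
    (x : Bar (K.tens A) V₀ V₁) : contractEven f (g x) = g₀ (contractEven f x) := by
  rw [← sum_tensMul_contract (Module.finBasis ℝ _) (Module.finBasis ℝ _) x]
  simp only [map_add, map_sum, h₀, h₁, contractEven_tensEvenMul, contractEven_tensOddMul, map_smul,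
    map_zero]

lemma contractOdd_comm (h₀ : ∀ k w, g (tensEvenMul k w) = tensEvenMul k (g₀ w))
    (h₁ : ∀ k w, g (tensOddMul k w) = tensOddMul k (g₁ w)) (f : K.part 1 →ₗ[ℝ] ℝ)
    (x : Bar (K.tens A) V₀ V₁) : contractOdd f (g x) = g₁ (contractOdd f x) := by
  rw [← sum_tensMul_contract (Module.finBasis ℝ _) (Module.finBasis ℝ _) x]
  simp only [map_add, map_sum, h₀, h₁, contractOdd_tensEvenMul, contractOdd_tensOddMul, map_smul,
    map_zero]

end Bar

namespace SuperVectorBundle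

variable {M : SuperManifold.{u}} {V : SBanach.{u}} (E : SuperVectorBundle M V) {A K : Gr}

/-- The linear map `g` is the change from the trivialization `i` to the trivialization `j` in the
fibre over `x`. -/
def IsTransition (i j : E.ι) (x : M.pts.obj A) (g : Pt A V →ₗ[ℝ] Pt A V) : Prop :=
  ∀ a, E.proj.app A a = x → E.fib j A a = g (E.fib i A a)

variable {E} {i j : E.ι} {x : M.pts.obj A}

lemma exists_isTransition (hi : x ∈ E.base i A) (hj : x ∈ E.base j A) :
    ∃ g, E.IsTransition i j x g := by
  choose s hs hf using fun v => E.exists_fib i hi v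
  have hsi (v) : E.proj.app A (s v) ∈ E.base i A := by rwa [hs]
  have hsj (v) : E.proj.app A (s v) ∈ E.base j A := by rwa [hs]
  have fib_eq (a) (ha : E.proj.app A a = x) : E.fib j A a = E.fib j A (s (E.fib i A a)) :=
    congrArg _ (eq_of_fib i (ha.trans (hs _).symm) (ha ▸ hi) (hf _).symm)
  refine ⟨{ toFun v := E.fib j A (s v), map_add' v w := ?_, map_smul' r v := ?_ }, fib_eq⟩
  · have h := fib_eq (E.add A (s v) (s w) ((hs v).trans (hs w).symm)) (by rw [E.proj_add, hs])
    rw [E.fib_add _ _ _ _ _ (hsi v), E.fib_add _ _ _ _ _ (hsj v), hf, hf] at h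
    exact h.symm
  · have h := fib_eq (E.smul A (algebraMap ℝ A.Even r) (s v)) (by rw [E.proj_smul, hs])
    rw [E.fib_smul _ _ _ _ (hsi v), E.fib_smul _ _ _ _ (hsj v), hf, algebraMap_smul,
      algebraMap_smul] at h
    exact h.symm

namespace IsTransition

variable {g : Pt (K.tens A) V →ₗ[ℝ] Pt (K.tens A) V} {g₀ : Pt A V →ₗ[ℝ] Pt A V}
  {g₁ : Pt A V.flip →ₗ[ℝ] Pt A V.flip}

lemma map_tensEvenMul (hg : E.IsTransition i j (M.pts.map (K.inr A) x) g)
    (hg₀ : E.IsTransition i j x g₀) (hi : x ∈ E.base i A) (hj : x ∈ E.base j A) (k : K.part 0)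
    (w : Pt A V) : g (Bar.tensEvenMul k w) = Bar.tensEvenMul k (g₀ w) := by
  obtain ⟨a, rfl, rfl⟩ := E.exists_fib i hi w
  have hp := E.proj_map (K.inr A) a
  have h := hg (E.smul _ (Gr.toEven (Gr.Hom.res (K.inl A) 0 k)) (E.tot.map (K.inr A) a))
    (by rw [E.proj_smul, hp])
  rw [E.fib_smul _ _ _ _ (hp ▸ E.base_map j _ _ hj),
    E.fib_smul _ _ _ _ (hp ▸ E.base_map i _ _ hi), E.fib_map _ _ _ hj, E.fib_map _ _ _ hi,
    hg₀ a rfl, ← Bar.tensEvenMul_eq_smul, ← Bar.tensEvenMul_eq_smul] at h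
  exact h.symm

lemma map_tensOddMul (hg : E.IsTransition i j (M.pts.map (K.inr A) x) g)
    (hg₁ : E.parityFlip.IsTransition i j x g₁) (hi : x ∈ E.base i A) (hj : x ∈ E.base j A)
    (k : K.part 1) (w : Pt A V.flip) : g (Bar.tensOddMul k w) = Bar.tensOddMul k (g₁ w) := by
  obtain ⟨b, rfl, rfl⟩ := FlipPt.exists_coord i hi w
  have h := hg ((b.map (K.inr A)).oddSmul (Gr.Hom.res (K.inl A) 1 k)) (FlipPt.proj_oddSmul _ _)
  have hb : b.coord j = g₁ (b.coord i) := hg₁ b rfl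
  rw [FlipPt.fib_oddSmul _ (b.map _) (E.base_map i _ _ hi),
    FlipPt.fib_oddSmul _ (b.map _) (E.base_map j _ _ hj), b.coord_map _ hi, b.coord_map _ hj, hb,
    ← Bar.tensOddMul_eq_oddMul, ← Bar.tensOddMul_eq_oddMul] at h
  exact h.symm

end IsTransition

variable {u : E.tot.obj (K.tens A)}

lemma fib_eq_contractEven (hu : E.proj.app _ u = M.pts.map (K.inr A) x) (f : K.part 0 →ₗ[ℝ] ℝ)
    {a : E.tot.obj A} (ha : E.proj.app A a = x) (hi : x ∈ E.base i A) (hj : x ∈ E.base j A)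
    (h : E.fib i A a = Bar.contractEven f (E.fib i _ u)) :
    E.fib j A a = Bar.contractEven f (E.fib j _ u) := by
  obtain ⟨g₀, hg₀⟩ := exists_isTransition hi hj
  obtain ⟨g₁, hg₁⟩ := exists_isTransition (E := E.parityFlip) (i := i) (j := j) hi hj
  obtain ⟨g, hg⟩ := exists_isTransition (E.base_map i (K.inr A) x hi) (E.base_map j _ x hj)
  rw [hg₀ a ha, h, hg u hu, Bar.contractEven_comm (hg.map_tensEvenMul hg₀ hi hj)
    (hg.map_tensOddMul hg₁ hi hj)]

lemma parityFlip_fib_eq_contractOdd (hu : E.proj.app _ u = M.pts.map (K.inr A) x)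
    (f : K.part 1 →ₗ[ℝ] ℝ) {b : E.parityFlip.tot.obj A} (hb : E.parityFlip.proj.app A b = x)
    (hi : x ∈ E.base i A) (hj : x ∈ E.base j A)
    (h : E.parityFlip.fib i A b = Bar.contractOdd f (E.fib i _ u)) :
    E.parityFlip.fib j A b = Bar.contractOdd f (E.fib j _ u) := by
  obtain ⟨g₀, hg₀⟩ := exists_isTransition hi hj
  obtain ⟨g₁, hg₁⟩ := exists_isTransition (E := E.parityFlip) (i := i) (j := j) hi hj
  obtain ⟨g, hg⟩ := exists_isTransition (E.base_map i (K.inr A) x hi) (E.base_map j _ x hj)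
  rw [hg₁ b hb, h, hg u hu]
  exact (Bar.contractOdd_comm (hg.map_tensEvenMul hg₀ hi hj)
    (hg.map_tensOddMul hg₁ hi hj) f _).symm

end SuperVectorBundle

/-! ### Coefficients of families of sections -/

namespace SuperVectorBundle

open SuperManifold

variable {M : SuperManifold.{u}} {V : SBanach.{u}} {E : SuperVectorBundle M V} {A B K : Gr}

lemma exists_section_fib (E : SuperVectorBundle M V) (v : ∀ A, E.ι → M.pts.obj A → Pt A V)
    (hv : ∀ {A i j x a}, E.proj.app A a = x → x ∈ E.base i A → x ∈ E.base j A →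
      E.fib i A a = v A i x → E.fib j A a = v A j x)
    (hn : ∀ {A B : Gr} (φ : A ⟶ B) i x, x ∈ E.base i A →
      v B i (M.pts.map φ x) = Bar.map φ (v A i x))
    (hs : ∀ i A, M.SmoothOn (v A i) (E.base i A)) :
    ∃ s : E.Section, ∀ A i x, x ∈ E.base i A → E.fib i A (s.eval A x) = v A i x := by
  have exists_point (A) (x : M.pts.obj A) :
      ∃ a, E.proj.app A a = x ∧ ∀ i, x ∈ E.base i A → E.fib i A a = v A i x := by
    obtain ⟨i, hi⟩ := E.cover A x
    obtain ⟨a, ha, h⟩ := E.exists_fib i hi (v A i x)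
    exact ⟨a, ha, fun j hj => hv ha hi hj h⟩
  choose s hs_proj hs_fib using exists_point
  refine ⟨Section.ofFib s hs_proj (fun φ i x hx => ?_) (fun i A => ?_),
    fun A i x => hs_fib A x i⟩
  · rw [hs_fib _ _ _ hx, hs_fib _ _ _ (E.base_map i φ x hx), hn φ i x hx]
  · exact (hs i A).congr fun x hx => (hs_fib A x i hx).symm

lemma val_map (σ : (E.family K).Section) (ψ : A ⟶ B) (p : K ⟶ A) (m : M.pts.obj A) :
    val σ B (p ≫ ψ) (M.pts.map ψ m) = E.tot.map ψ (val σ A p m) :=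
  congrArg (fun y => y.1.2) (σ.1.naturality ψ (p, m))

lemma smoothOn_fib_val (σ : (E.family K).Section) (p : K ⟶ A) (i : E.ι) :
    M.SmoothOn (fun m => E.fib i A (val σ A p m)) (E.base i A) := by
  classical
  -- `IsSuperSmooth` is about all Grassmann algebras at once, so the point `p` over `A` is extended
  -- by arbitrary points over the other ones.
  let q (B : Gr) : K ⟶ B := if h : A = B then h ▸ p else Gr.homOfGen 0
  have hq : q A = p := dif_pos rfl
  have hc : IsSuperSmooth (X := M) (Y := superpoint K) fun B _ => q B := fun B _ => smoothOn_const _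
  have h : M.SmoothOn (fun m => E.fib i A (val σ A (q A) m)) (E.base i A) :=
    (hc.prodMk (isSuperSmooth_id M)).smoothOn (σ.smoothOn_fib_eval i A)
  rwa [hq] at h

/-- The value of a family of sections at the generic point `inl` of the superpoint. -/
def generic (σ : (E.family K).Section) (A : Gr) (m : M.pts.obj A) : E.tot.obj (K.tens A) :=
  val σ (K.tens A) (K.inl A) (M.pts.map (K.inr A) m)

lemma proj_generic (σ : (E.family K).Section) (m : M.pts.obj A) :
    E.proj.app _ (generic σ A m) = M.pts.map (K.inr A) m := proj_val _ _ _ _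

lemma proj_generic_mem (σ : (E.family K).Section) {m : M.pts.obj A} {i : E.ι}
    (hm : m ∈ E.base i A) : E.proj.app _ (generic σ A m) ∈ E.base i (K.tens A) := by
  rw [proj_generic]
  exact E.base_map i _ m hm

lemma generic_map (σ : (E.family K).Section) (φ : A ⟶ B) (m : M.pts.obj A) :
    generic σ B (M.pts.map φ m) = E.tot.map (Gr.whiskerLeft K φ) (generic σ A m) := by
  rw [generic, generic, ← val_map, Gr.whiskerLeft, Gr.inl_desc, ← Functor.map_comp_apply,
    ← Functor.map_comp_apply, Gr.inr_desc]

lemma map_desc_generic (σ : (E.family K).Section) (p : K ⟶ A) (m : M.pts.obj A) :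
    E.tot.map (Gr.desc p (𝟙 A)) (generic σ A m) = val σ A p m := by
  rw [generic, ← val_map, Gr.inl_desc, ← Functor.map_comp_apply, Gr.inr_desc,
    Functor.map_id_apply]

lemma smoothOn_clm_fib_generic {Y : Type*} [NormedAddCommGroup Y] [NormedSpace ℝ Y]
    [Module A.Even Y] (σ : (E.family K).Section) (i : E.ι) (C : Pt (K.tens A) V →L[ℝ] Y)
    (hC : ∀ (a : A.Even) x, C (Gr.Hom.resEven (K.inr A) a • x) = a • C x) :
    M.SmoothOn (fun m => C (E.fib i _ (generic σ A m))) (E.base i A) :=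
  ((smoothOn_fib_val σ (K.inl A) i).baseChange (K.inr A) C hC).mono (E.base_open i A)
    (E.base_map i _)

lemma exists_coeffEven (σ : (E.family K).Section) (f : K.part 0 →ₗ[ℝ] ℝ) :
    ∃ s : E.Section, ∀ A i (m : M.pts.obj A), m ∈ E.base i A →
      E.fib i A (s.eval A m) = Bar.contractEven f (E.fib i _ (generic σ A m)) :=
  E.exists_section_fib (fun A i m => Bar.contractEven f (E.fib i _ (generic σ A m)))
    (fun ha hi hj => fib_eq_contractEven (proj_generic σ _) f ha hi hj)
    (fun φ i m hm => by
      rw [generic_map, E.fib_map _ _ _ (proj_generic_mem σ hm), Bar.contractEven_map])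
    (fun i _ => smoothOn_clm_fib_generic σ i ⟨Bar.contractEven f, Bar.continuous_evenMap _⟩
      (Bar.contractEven_smul f))

lemma exists_coeffOdd (σ : (E.family K).Section) (f : K.part 1 →ₗ[ℝ] ℝ) :
    ∃ t : E.parityFlip.Section, ∀ A i (m : M.pts.obj A), m ∈ E.base i A →
      E.parityFlip.fib i A (t.eval A m) = Bar.contractOdd f (E.fib i _ (generic σ A m)) :=
  E.parityFlip.exists_section_fib (fun A i m => Bar.contractOdd f (E.fib i _ (generic σ A m)))
    (fun hb hi hj => parityFlip_fib_eq_contractOdd (proj_generic σ _) f hb hi hj)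
    (fun φ i m hm => by
      rw [generic_map, E.fib_map _ _ _ (proj_generic_mem σ hm)]
      exact Bar.contractOdd_map f φ _)
    (fun i _ => smoothOn_clm_fib_generic σ i ⟨Bar.contractOdd f, Bar.continuous_oddMap _⟩
      (Bar.contractOdd_smul f))

/-! ### Families of sections with given coefficients -/

lemma Section.smoothOn_snd_fib_eval {W : SBanach.{u}} {F : SuperVectorBundle M W} (s : F.Section)
    (i : F.ι) : ((superpoint K).prod M).SmoothOn (A := A)
      (fun x => F.fib i A (s.eval A x.2)) {x | x.2 ∈ F.base i A} :=
  isSuperSmooth_snd.smoothOn (s.smoothOn_fib_eval i A)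

/-- The family of sections with given values, whose fibre coordinates are natural and
supersmooth. -/
def familyOfFib (f : ∀ A, (K ⟶ A) → M.pts.obj A → E.tot.obj A)
    (hp : ∀ A p m, E.proj.app A (f A p m) = m)
    (hn : ∀ {A B : Gr} (φ : A ⟶ B) (i : E.ι) (p : K ⟶ A) (m : M.pts.obj A), m ∈ E.base i A →
      E.fib i B (f B (p ≫ φ) (M.pts.map φ m)) = Bar.map φ (E.fib i A (f A p m)))
    (hs : ∀ i A, ((superpoint K).prod M).SmoothOn (A := A)
      (fun x => E.fib i A (f A x.1 x.2)) {x | x.2 ∈ E.base i A}) : (E.family K).Section :=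
  Section.ofFib (E := E.family K) (fun A x => ⟨(x, f A x.1 x.2), (hp A x.1 x.2).symm⟩)
    (fun _ _ => rfl) (fun φ i x hx => hn φ i x.1 x.2 hx) hs

/-- The family of sections `(p, m) ↦ p(k) s(m)`, for an even element `k`. -/
def evenFamily (k : K.part 0) (s : E.Section) : (E.family K).Section :=
  familyOfFib (fun A p m => E.smul A (Gr.toEven (Gr.Hom.res p 0 k)) (s.eval A m))
    (fun A p m => by rw [E.proj_smul, Section.proj_eval])
    (fun φ i p m hm => by
      rw [E.fib_smul _ _ _ _ (s.proj_eval_mem hm),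
        E.fib_smul _ _ _ _ (s.proj_eval_mem (E.base_map i φ m hm)), s.fib_eval_map φ hm,
        Bar.map_smul_even]
      rfl)
    (fun i A => (((smoothOn_family_eval M 0 k).mono (s.smoothOn_snd_fib_eval i).1
      (Set.subset_univ _)).even_smul (s.smoothOn_snd_fib_eval i)).congr fun x hx =>
        (E.fib_smul _ _ _ _ (s.proj_eval_mem hx)).symm)

lemma fib_evenFamily (k : K.part 0) (s : E.Section) (p : K ⟶ A) {m : M.pts.obj A} {i : E.ι}
    (hm : m ∈ E.base i A) : E.fib i A (val (evenFamily k s) A p m) =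
      Gr.toEven (Gr.Hom.res p 0 k) • E.fib i A (s.eval A m) :=
  E.fib_smul _ _ _ _ (s.proj_eval_mem hm)

lemma pt_eval (t : E.parityFlip.Section) (m : M.pts.obj A) : FlipPt.pt (t.eval A m) = m :=
  t.proj_eval m

lemma pt_eval_mem (t : E.parityFlip.Section) {m : M.pts.obj A} {i : E.ι} (hm : m ∈ E.base i A) :
    FlipPt.pt (t.eval A m) ∈ E.base i A := by rwa [pt_eval]

/-- The family of sections `(p, m) ↦ p(k) t(m)`, for an odd element `k`. -/
def oddFamily (k : K.part 1) (t : E.parityFlip.Section) : (E.family K).Section :=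
  familyOfFib (fun A p m => FlipPt.oddSmul (Gr.Hom.res p 1 k) (t.eval A m))
    (fun A p m => (FlipPt.proj_oddSmul _ _).trans (pt_eval t m))
    (fun φ i p m hm => by
      rw [FlipPt.fib_oddSmul _ _ (pt_eval_mem t hm),
        FlipPt.fib_oddSmul _ _ (pt_eval_mem t (E.base_map i φ m hm)), Bar.map_oddMul]
      exact congrArg (Bar.oddMul _) (t.fib_eval_map φ (i := i) hm))
    (fun i A => (((smoothOn_family_eval M 1 k).mono (t.smoothOn_snd_fib_eval i).1
      (Set.subset_univ _)).oddMul (t.smoothOn_snd_fib_eval i)).congr fun x hx =>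
        (FlipPt.fib_oddSmul _ _ (pt_eval_mem t hx)).symm)

lemma fib_oddFamily (k : K.part 1) (t : E.parityFlip.Section) (p : K ⟶ A) {m : M.pts.obj A}
    {i : E.ι} (hm : m ∈ E.base i A) : E.fib i A (val (oddFamily k t) A p m) =
      Bar.oddMul (Gr.Hom.res p 1 k) (E.parityFlip.fib i A (t.eval A m)) :=
  FlipPt.fib_oddSmul _ _ (pt_eval_mem t hm)

lemma fib_val_real_smul (r : ℝ) (σ : (E.family K).Section) (p : K ⟶ A) {m : M.pts.obj A} {i : E.ι}
    (hm : m ∈ E.base i A) : E.fib i A (val (r • σ) A p m) = r • E.fib i A (val σ A p m) :=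
  Section.fib_eval_smul (E := E.family K) r σ (x := (p, m)) hm

lemma fib_val_sum {ι : Type*} (S : Finset ι) (σ : ι → (E.family K).Section) (p : K ⟶ A)
    {m : M.pts.obj A} {i : E.ι} (hm : m ∈ E.base i A) :
    E.fib i A (val (∑ n ∈ S, σ n) A p m) = ∑ n ∈ S, E.fib i A (val (σ n) A p m) :=
  Section.fib_eval_sum (E := E.family K) S σ (x := (p, m)) hm

variable (E K) in
/-- The families `(p, m) ↦ p(k) s(m)` with `k` even, as a bilinear map. -/
def evenFamilyBilin : K.part 0 →ₗ[ℝ] E.Section →ₗ[ℝ] (E.family K).Section :=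
  LinearMap.mk₂ ℝ evenFamily
    (fun k k' s => family_ext_fib fun A i p m hm => by
      simp only [fib_val_add _ _ _ hm, fib_evenFamily _ _ _ hm, map_add, add_smul])
    (fun r k s => family_ext_fib fun A i p m hm => by
      simp only [fib_val_real_smul _ _ _ hm, fib_evenFamily _ _ _ hm, map_smul, smul_assoc])
    (fun k s s' => family_ext_fib fun A i p m hm => by
      simp only [fib_val_add _ _ _ hm, fib_evenFamily _ _ _ hm, Section.fib_eval_add _ _ hm,
        smul_add])
    (fun r k s => family_ext_fib fun A i p m hm => by
      simp only [fib_val_real_smul _ _ _ hm, fib_evenFamily _ _ _ hm, Section.fib_eval_smul _ _ hm,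
        smul_comm r])

variable (E K) in
/-- The families `(p, m) ↦ p(k) t(m)` with `k` odd, as a bilinear map. -/
def oddFamilyBilin : K.part 1 →ₗ[ℝ] E.parityFlip.Section →ₗ[ℝ] (E.family K).Section :=
  LinearMap.mk₂ ℝ oddFamily
    (fun k k' t => family_ext_fib fun A i p m hm => by
      simp only [fib_val_add _ _ _ hm, fib_oddFamily _ _ _ hm, map_add, Bar.oddMul_add_left])
    (fun r k t => family_ext_fib fun A i p m hm => by
      simp only [fib_val_real_smul _ _ _ hm, fib_oddFamily _ _ _ hm, map_smul,
        Bar.oddMul_smul_left])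
    (fun k t t' => family_ext_fib fun A i p m hm => by
      simp only [fib_val_add _ _ _ hm, fib_oddFamily _ _ _ hm]
      rw [Section.fib_eval_add (E := E.parityFlip) t t' (i := i) hm]
      exact map_add (Bar.oddMul (Gr.Hom.res p 1 k)) _ _)
    (fun r k t => family_ext_fib fun A i p m hm => by
      simp only [fib_val_real_smul _ _ _ hm, fib_oddFamily _ _ _ hm]
      rw [Section.fib_eval_smul (E := E.parityFlip) r t (i := i) hm]
      exact map_smul (Bar.oddMul (Gr.Hom.res p 1 k)) _ _)

end SuperVectorBundle

/-! ### The functor of sections is superrepresentable -/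

namespace GTensor

variable {A : Gr} {i : ZMod 2} {V : Type u} {W : Type v} [AddCommGroup V] [Module ℝ V]
  [AddCommGroup W] [Module ℝ W]

/-- The linear map on `GTensor A i V` with given values at the elementary tensors. -/
def lift (f : A.part i →ₗ[ℝ] V →ₗ[ℝ] W) : GTensor A i V →ₗ[ℝ] W := TensorProduct.lift f

lemma lift_tmul (f : A.part i →ₗ[ℝ] V →ₗ[ℝ] W) (k : A.part i) (v : V) :
    lift f (tmul i k v) = f k v := TensorProduct.lift.tmul _ _

lemma exists_eq_sum_tmul {ι : Type*} [Fintype ι] (b : Module.Basis ι ℝ (A.part i))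
    (x : GTensor A i V) : ∃ v : ι → V, x = ∑ n, tmul i (b n) (v n) := by
  classical
  obtain ⟨c, hc⟩ := TensorProduct.eq_repr_basis_left b x
  exact ⟨c, hc.symm.trans (Finsupp.sum_fintype c _ fun _ => TensorProduct.tmul_zero _ _)⟩

end GTensor

namespace Bar

variable {A : Gr} {V₀ V₁ : Type u} [AddCommGroup V₀] [Module ℝ V₀] [AddCommGroup V₁] [Module ℝ V₁]

@[elab_as_elim]
lemma induction {P : Bar A V₀ V₁ → Prop} (even : ∀ k v, P (GTensor.tmul 0 k v, 0))
    (odd : ∀ k v, P (0, GTensor.tmul 1 k v)) (add : ∀ x y, P x → P y → P (x + y))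
    (x : Bar A V₀ V₁) : P x := by
  have fst (y : GTensor A 0 V₀) : P (y, 0) := by
    induction y using GTensor.induction with
    | h0 => simpa only [map_zero] using even 0 0
    | ht k v => exact even k v
    | ha y z hy hz => simpa only [Prod.mk_add_mk, add_zero] using add _ _ hy hz
  have snd (z : GTensor A 1 V₁) : P (0, z) := by
    induction z using GTensor.induction with
    | h0 => simpa only [map_zero] using odd 0 0
    | ht k v => exact odd k v
    | ha y z hy hz => simpa only [Prod.mk_add_mk, add_zero] using add _ _ hy hz
  simpa only [Prod.mk_add_mk, add_zero, zero_add] using add _ _ (fst x.1) (snd x.2)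

end Bar

namespace SuperVectorBundle

variable {M : SuperManifold.{u}} {V : SBanach.{u}} {E : SuperVectorBundle M V} {A K L : Gr}

lemma evenFamily_smul (a : K.Even) (k : K.part 0) (s : E.Section) :
    evenFamily (a • k) s = a • evenFamily k s :=
  family_ext_fib fun A i p m hm => by
    have hres : Gr.toEven (Gr.Hom.res p 0 (a • k)) =
        Gr.Hom.resEven p a * Gr.toEven (Gr.Hom.res p 0 k) :=
      Subtype.ext (map_mul (Gr.Hom.alg p) _ _)
    rw [fib_val_smul _ _ _ hm, fib_evenFamily _ _ _ hm, fib_evenFamily _ _ _ hm, hres, mul_smul]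

lemma oddFamily_smul (a : K.Even) (k : K.part 1) (t : E.parityFlip.Section) :
    oddFamily (a • k) t = a • oddFamily k t :=
  family_ext_fib fun A i p m hm => by
    have hres : Gr.Hom.res p 1 (a • k) = Gr.Hom.resEven p a • Gr.Hom.res p 1 k :=
      Subtype.ext (map_mul (Gr.Hom.alg p) _ _)
    rw [fib_val_smul _ _ _ hm, fib_oddFamily _ _ _ hm, fib_oddFamily _ _ _ hm, hres,
      Bar.oddMul_even_smul_left]

variable (E K) in
/-- The map from `(Λ ⊗ E)_0`, where `E` is the super vector space of sections, to the families of
sections. It sends `k ⊗ s` to the family `(p, m) ↦ p(k) s(m)`. -/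
def ofBar : Bar K E.Section E.parityFlip.Section →ₗ[ℝ] (E.family K).Section :=
  (GTensor.lift (E.evenFamilyBilin K)).coprod (GTensor.lift (E.oddFamilyBilin K))

lemma ofBar_tmul_zero (k : K.part 0) (s : E.Section) :
    E.ofBar K (GTensor.tmul 0 k s, 0) = evenFamily k s := by
  rw [ofBar, LinearMap.coprod_apply, map_zero, add_zero, GTensor.lift_tmul]
  rfl

lemma ofBar_zero_tmul (k : K.part 1) (t : E.parityFlip.Section) :
    E.ofBar K (0, GTensor.tmul 1 k t) = oddFamily k t := by
  rw [ofBar, LinearMap.coprod_apply, map_zero, zero_add, GTensor.lift_tmul]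
  rfl

lemma ofBar_smul (a : K.Even) (x : Bar K E.Section E.parityFlip.Section) :
    E.ofBar K (a • x) = a • E.ofBar K x := by
  induction x using Bar.induction with
  | even k s =>
    rw [Prod.smul_mk, smul_zero, GTensor.smul_tmul, ofBar_tmul_zero, ofBar_tmul_zero,
      evenFamily_smul]
  | odd k t =>
    rw [Prod.smul_mk, smul_zero, GTensor.smul_tmul, ofBar_zero_tmul, ofBar_zero_tmul,
      oddFamily_smul]
  | add x y hx hy => rw [smul_add, map_add, map_add, hx, hy, smul_add]

lemma ofBar_map (φ : K ⟶ L) (x : Bar K E.Section E.parityFlip.Section) :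
    E.ofBar L (Bar.map φ x) = E.sectionMap φ (E.ofBar K x) := by
  induction x using Bar.induction with
  | even k s =>
    rw [Bar.map, LinearMap.prodMap_apply, map_zero, GTensor.map_tmul, ofBar_tmul_zero,
      ofBar_tmul_zero]
    exact section_ext fun _ _ _ => rfl
  | odd k t =>
    rw [Bar.map, LinearMap.prodMap_apply, map_zero, GTensor.map_tmul, ofBar_zero_tmul,
      ofBar_zero_tmul]
    exact section_ext fun _ _ _ => rfl
  | add x y hx hy => rw [map_add, map_add, map_add, hx, hy, sectionMap_add]

section Basis

variable {ι₀ ι₁ : Type*} [Fintype ι₀] [Fintype ι₁] (b₀ : Module.Basis ι₀ ℝ (K.part 0))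
  (b₁ : Module.Basis ι₁ ℝ (K.part 1)) (s : ι₀ → E.Section) (t : ι₁ → E.parityFlip.Section)

lemma ofBar_sum : E.ofBar K (∑ n, GTensor.tmul 0 (b₀ n) (s n), ∑ n, GTensor.tmul 1 (b₁ n) (t n)) =
    ∑ n, evenFamily (b₀ n) (s n) + ∑ n, oddFamily (b₁ n) (t n) := by
  rw [ofBar, LinearMap.coprod_apply, map_sum, map_sum]
  simp only [GTensor.lift_tmul]
  rfl

lemma fib_ofBar_sum (p : K ⟶ A) {m : M.pts.obj A} {i : E.ι} (hm : m ∈ E.base i A) :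
    E.fib i A (val (E.ofBar K (∑ n, GTensor.tmul 0 (b₀ n) (s n), ∑ n, GTensor.tmul 1 (b₁ n) (t n)))
      A p m) = Bar.map (Gr.desc p (𝟙 A)) (∑ n, Bar.tensEvenMul (b₀ n) (E.fib i A ((s n).eval A m)) +
        ∑ n, Bar.tensOddMul (b₁ n) (E.parityFlip.fib i A ((t n).eval A m))) := by
  simp only [ofBar_sum, fib_val_add _ _ _ hm, fib_val_sum _ _ _ hm, fib_evenFamily _ _ _ hm,
    fib_oddFamily _ _ _ hm, map_add, map_sum, Bar.map_desc_tensEvenMul, Bar.map_desc_tensOddMul,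
    Bar.map_id]

lemma fib_ofBar_sum_generic {m : M.pts.obj A} {i : E.ι} (hm : m ∈ E.base i A) :
    E.fib i _ (generic (E.ofBar K (∑ n, GTensor.tmul 0 (b₀ n) (s n),
      ∑ n, GTensor.tmul 1 (b₁ n) (t n))) A m) =
      ∑ n, Bar.tensEvenMul (b₀ n) (E.fib i A ((s n).eval A m)) +
        ∑ n, Bar.tensOddMul (b₁ n) (E.parityFlip.fib i A ((t n).eval A m)) := by
  have hm' := E.base_map i (K.inr A) m hm
  have ht (n) : E.parityFlip.fib i _ ((t n).eval _ (M.pts.map (K.inr A) m)) =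
      Bar.map (K.inr A) (E.parityFlip.fib i A ((t n).eval A m)) :=
    (t n).fib_eval_map (K.inr A) (i := i) hm
  simp only [generic, ofBar_sum, fib_val_add _ _ _ hm', fib_val_sum _ _ _ hm',
    fib_evenFamily _ _ _ hm', fib_oddFamily _ _ _ hm', Section.fib_eval_map _ _ hm, ht,
    Bar.tensEvenMul_eq_smul, Bar.tensOddMul_eq_oddMul]

end Basis

lemma ofBar_injective : Function.Injective (E.ofBar K) := by
  classical
  rw [injective_iff_map_eq_zero]
  rintro ⟨x, y⟩ h
  let b₀ := Module.finBasis ℝ (K.part 0)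
  let b₁ := Module.finBasis ℝ (K.part 1)
  obtain ⟨s, rfl⟩ := GTensor.exists_eq_sum_tmul b₀ x
  obtain ⟨t, rfl⟩ := GTensor.exists_eq_sum_tmul b₁ y
  have generic_eq_zero A i (m : M.pts.obj A) (hm : m ∈ E.base i A) :
      ∑ n, Bar.tensEvenMul (b₀ n) (E.fib i A ((s n).eval A m)) +
        ∑ n, Bar.tensOddMul (b₁ n) (E.parityFlip.fib i A ((t n).eval A m)) = 0 := by
    rw [← fib_ofBar_sum_generic b₀ b₁ s t hm, h]
    exact fib_val_zero _ (E.base_map i _ m hm)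
  have hs : s = 0 := funext fun l => Section.ext_fib fun A i m hm => by
    have h := congrArg (Bar.contractEven (b₀.coord l)) (generic_eq_zero A i m hm)
    simp only [map_add, map_sum, Bar.contractEven_tensEvenMul, Bar.contractEven_tensOddMul,
      Finset.sum_const_zero, add_zero, map_zero, Module.Basis.coord_apply,
      Module.Basis.repr_self, Finsupp.single_apply, ite_smul, one_smul, zero_smul,
      Finset.sum_ite_eq', Finset.mem_univ, if_true] at h
    exact h.trans (Section.fib_eval_zero hm).symm
  have ht : t = 0 := funext fun l => Section.ext_fib fun A i m hm => by
    have h := congrArg (Bar.contractOdd (b₁.coord l)) (generic_eq_zero A i m hm)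
    simp only [map_add, map_sum, Bar.contractOdd_tensEvenMul, Bar.contractOdd_tensOddMul,
      Finset.sum_const_zero, zero_add, map_zero, Module.Basis.coord_apply,
      Module.Basis.repr_self, Finsupp.single_apply, ite_smul, one_smul, zero_smul,
      Finset.sum_ite_eq', Finset.mem_univ, if_true] at h
    exact h.trans (Section.fib_eval_zero (E := E.parityFlip) hm).symm
  subst hs ht
  simp only [Pi.zero_apply, map_zero, Finset.sum_const_zero, Prod.mk_zero_zero]

lemma ofBar_surjective : Function.Surjective (E.ofBar K) := by
  intro σ
  let b₀ := Module.finBasis ℝ (K.part 0)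
  let b₁ := Module.finBasis ℝ (K.part 1)
  choose s hs using fun n => exists_coeffEven σ (b₀.coord n)
  choose t ht using fun n => exists_coeffOdd σ (b₁.coord n)
  refine ⟨(∑ n, GTensor.tmul 0 (b₀ n) (s n), ∑ n, GTensor.tmul 1 (b₁ n) (t n)),
    family_ext_fib fun A i p m hm => ?_⟩
  have ht' (n) : E.parityFlip.fib i A ((t n).eval A m) =
      Bar.contractOdd (b₁.coord n) (E.fib i _ (generic σ A m)) := ht n A i m hm
  rw [fib_ofBar_sum b₀ b₁ s t p hm, ← map_desc_generic σ p m,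
    E.fib_map _ _ _ (proj_generic_mem σ hm),
    ← Bar.sum_tensMul_contract b₀ b₁ (E.fib i _ (generic σ A m))]
  simp only [hs _ A i m hm, ht']

lemma gammaHatModule_isIso (E : SuperVectorBundle M V) :
    E.gammaHatModule.IsIso (barModule E.Section E.parityFlip.Section) := by
  let e (K : Gr) : Bar K E.Section E.parityFlip.Section ≃ₗ[ℝ] (E.family K).Section :=
    .ofBijective (E.ofBar K) ⟨ofBar_injective, ofBar_surjective⟩
  have symm_smul K (a : K.Even) σ : (e K).symm (a • σ) = a • (e K).symm σ := by
    rw [LinearEquiv.symm_apply_eq]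
    refine Eq.trans ?_ (ofBar_smul a _).symm
    exact congrArg (a • ·) ((e K).apply_symm_apply σ).symm
  have symm_map K L (φ : K ⟶ L) σ :
      (e L).symm (E.sectionMap φ σ) = Bar.map φ ((e K).symm σ) := by
    rw [LinearEquiv.symm_apply_eq]
    refine Eq.trans ?_ (ofBar_map φ _).symm
    exact congrArg (E.sectionMap φ) ((e K).apply_symm_apply σ).symm
  exact ⟨fun K => (e K).symm.toEquiv, fun K => map_add (e K).symm, symm_smul, symm_map⟩

end SuperVectorBundle

end

end SuperGeom

theorem mainTheorem1 (M : SuperGeom.SuperManifold.{u}) (V : SuperGeom.SBanach.{u})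
    (E : SuperGeom.SuperVectorBundle M V) :
    ∃ S : SuperGeom.RbarModule E.gammaHat, E.IsPointwise S ∧ S.IsSuperrepresentable ∧
      ∃ E' : SuperGeom.SuperVectorBundle M V.flip, E.IsParityReversal E' ∧
        ∃ (_ : AddCommGroup E.Section) (_ : Module ℝ E.Section)
          (_ : AddCommGroup E'.Section) (_ : Module ℝ E'.Section),
          E.IsPointwiseSpace ∧ E'.IsPointwiseSpace ∧
            S.IsIso (SuperGeom.barModule E.Section E'.Section) :=
  ⟨E.gammaHatModule, E.isPointwise_gammaHatModule,
    ⟨E.Section, E.parityFlip.Section, inferInstance, inferInstance, inferInstance, inferInstance,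
      E.gammaHatModule_isIso⟩,
    E.parityFlip, E.isParityReversal_parityFlip, inferInstance, inferInstance, inferInstance,
    inferInstance, E.isPointwiseSpace, E.parityFlip.isPointwiseSpace, E.gammaHatModule_isIso⟩
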